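/- Let $\tau>0$, let $n,m\ge 1$ be integers, let $(\mathcal P,\pi)$ be a semiflow on a complete metric space (i.e. $\pi^{t+s}=\pi^t\circ\pi^s$, $\pi^0=\mathrm{id}$, $(t,\wp)\mapsto\pi^t(\wp)$ continuous on $[0,\infty)\times\mathcal P$), and let $\mathbb U$, $\mathbb M$ be finite-dimensional real inner product spaces. Let $\widetilde A\colon C([-\tau,0];\mathbb R^n)\to\mathbb R^n$, $C\colon C([-\tau,0];\mathbb R^n)\to\mathbb M$ and $\widetilde B\colon\mathbb U\to\mathbb R^n$ be bounded linear operators and let $F'\colon\mathcal P\to\mathcal L(\mathbb M;\mathbb U)$ be continuous and bounded. *Spaces.* Let $\mu=\mu_L+\delta_0$ on $[-\tau,0]$ (Lebesgue measure plus the unit mass at $0$), $\mathbb H=L_2([-\tau,0];\mu;\mathbb R^n)$ and $\mathcal L_m^{\otimes}=L_2([-\tau,0]^m;\mu^{\otimes m};(\mathbb R^n)^{\otimes m})$, which is identified with $\mathbb H^{\otimes m}$ by $(\phi_1\otimes\dots\otimes\phi_m)(\theta_1,\dots,\theta_m)=\phi_1(\theta_1)\otimes\dots\otimes\phi_m(\theta_m)$.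 Continuous functions on $[-\tau,0]$ are regarded as elements of $\mathbb H$. For $j_1<\dots<j_k$ in $\{1,\dots,m\}$, $0\le k\le m$, let $R_{j_1\dots j_k}\Phi\in L_2((-\tau,0)^k;(\mathbb R^n)^{\otimes m})$ be the restriction of $\Phi\in\mathcal L_m^\otimes$ to the face $\{\theta_i=0 \text{ for } i\notin\{j_1,\dots,j_k\}\}$, as a function of $\theta_{j_1},\dots,\theta_{j_k}$ modulo $k$-dimensional Lebesgue measure; for a non-monotone list of indices the list is first put in increasing order. Let $\partial_{j_1\dots j_k}\mathcal L_m^\otimes$ be the subspace of those $\Phi$ all of whose restrictions vanish except possibly $R_{j_1\dots j_k}\Phi$. *Operators.* Let $A$ be the operator in $\mathbb H$ whose domain $\mathcal D(A)$ consists of the (continuous representatives of) $\psi\in W^{1,2}(-\tau,0;\mathbb R^n)$, with $A\psi\in\mathbb H$ having the value $\widetilde A\psi$ at $0$ and being equal to $\psi'$ on $(-\tau,0)$. For a bounded operator $L$ on $\mathbb H$, $L^{\otimes m}$ is the bounded operator on $\mathcal L_m^\otimes$ with $L^{\otimes m}(\phi_1\otimes\dots\otimes\phi_m)=L\phi_1\otimes\dots\otimes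 L\phi_m$. Let $B\colon\mathbb U\to\mathbb H$, where $B\eta$ has the value $\widetilde B\eta$ at $0$ and vanishes on $(-\tau,0)$. For $\wp\in\mathcal P$ consider $$\dot\xi(t)=A\xi(t)+BF'(\pi^t(\wp))C\xi(t),\qquad t\ge0. \tag{1}$$ A classical solution is a $\xi\in C^1([0,\infty);\mathbb H)\cap C([0,\infty);\mathcal D(A))$ (graph norm on $\mathcal D(A)$) satisfying (1) for all $t\ge 0$; a solution is a limit of classical solutions, uniform on each $[0,T]$. *Tensor factors.* Put $\mathbb M_j=(\mathbb R^n)^{\otimes(j-1)}\otimes\mathbb M\otimes(\mathbb R^n)^{\otimes(m-j)}$ and $\mathbb U_j=(\mathbb R^n)^{\otimes(j-1)}\otimes\mathbb U\otimes(\mathbb R^n)^{\otimes(m-j)}$. Writing $C\phi=\int_{-\tau}^0 dc(\theta)\phi(\theta)$ with $c$ of bounded variation and $c_j=\mathrm{Id}\otimes c\otimes\mathrm{Id}$ ($c$ acting in the $j$-th factor), let $C^{(k)}_{j,J}\colon C([-\tau,0]^{k+1};(\mathbb R^n)^{\otimes m})\to C([-\tau,0]^k;\mathbb M_j)$ be $$(C^{(k)}_{j,J}\Psi)(\theta_1,\dots,\widehat{\theta_J},\dots,\theta_{k+1})=\int_{-\tau}^0dc_j(\theta_J)\Psi(\theta_1,\dots,\theta_{k+1}).$$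 Let $F'_j(\wp)\colon L_2((-\tau,0)^k;\mathbb M_j)\to L_2((-\tau,0)^k;\mathbb U_j)$ be the pointwise action of $\mathrm{Id}\otimes F'(\wp)\otimes\mathrm{Id}$, and let $B_j^{j_1\dots j_k}\colon L_2((-\tau,0)^k;\mathbb U_j)\to\partial_{j_1\dots j_k}\mathcal L_m^\otimes$ be given by $R_{j_1\dots j_k}(B_j^{j_1\dots j_k}\Psi)(\theta)=(\mathrm{Id}\otimes\widetilde B\otimes\mathrm{Id})\Psi(\theta)$. For $j\notin\{j_1,\dots,j_k\}$ let $J(j)$ be the position of $j$ in the increasingly ordered set $\{j,j_1,\dots,j_k\}$. **Theorem.** The operator $A$ generates a $C_0$-semigroup $G$ in $\mathbb H$, the compounds $G(t)^{\otimes m}$ form a $C_0$-semigroup in $\mathcal L_m^\otimes$, whose generator is denoted by $A^{[\otimes m]}$; there are bounded linear operators $\Xi^t(\wp)$ on $\mathbb H$ ($t\ge0$, $\wp\in\mathcal P$) such that $t\mapsto\Xi^t(\wp)v$ is a solution of (1) with the value $v$ at $t=0$ for every $v\in\mathbb H$, and their compounds $\Xi^t_m(\wp)=\Xi^t(\wp)^{\otimes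 m}$ exist. For any $\wp\in\mathcal P$ and any $m$ solutions $\xi_1,\dots,\xi_m$ of (1) with $\xi_1(0),\dots,\xi_m(0)\in\mathcal D(A)$, the function $$\Phi(t):=\xi_1(t)\otimes\dots\otimes\xi_m(t)=\Xi^t_m(\wp)\bigl(\xi_1(0)\otimes\dots\otimes\xi_m(0)\bigr),\qquad t\ge0,$$ is a $C^1$-differentiable $\mathcal L_m^\otimes$-valued mapping on $[0,\infty)$ with $\Phi\in C([0,\infty);\mathcal D(A^{[\otimes m]}))$ (graph norm) and $R_{j_1\dots j_k}\Phi\in C\bigl([0,\infty);C([-\tau,0]^k;(\mathbb R^n)^{\otimes m})\bigr)$ for all $k\in\{0,\dots,m\}$ and $1\le j_1<\dots<j_k\le m$, and for all $t\ge0$ $$\dot\Phi(t)=A^{[\otimes m]}\Phi(t)+\sum_{k=0}^{m-1}\ \sum_{1\le j_1<\dots<j_k\le m}\ \sum_{j\notin\{j_1,\dots,j_k\}}B^{j_1\dots j_k}_jF'_j(\pi^t(\wp))\,C^{(k)}_{j,J(j)}R_{jj_1\dots j_k}\Phi(t).$$ -/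

import Mathlib

open MeasureTheory Set Filter Topology
open scoped NNReal ENNReal ContDiff

namespace DelayCompound

noncomputable section

/-! ### Finite-dimensional tensor powers -/

/-- `ℝⁿ` with its Euclidean inner product. -/
abbrev RVec (n : ℕ) : Type := EuclideanSpace ℝ (Fin n)

/-- The Hilbert tensor power `(ℝⁿ)^{⊗m}`, realized as `n × ⋯ × n` arrays (with `m` factors) and the
Frobenius inner product; `⨂` of vectors is `tensorVec` below. -/
abbrev TPow (n m : ℕ) : Type := EuclideanSpace ℝ (Fin m → Fin n)

/-- The decomposable tensor `v₁ ⊗ ⋯ ⊗ v_m`. -/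
def tensorVec {n m : ℕ} (v : Fin m → RVec n) : TPow n m :=
  WithLp.toLp 2 fun a => ∏ i, v i (a i)

theorem inner_tensorVec {n m : ℕ} (v w : Fin m → RVec n) :
    inner ℝ (tensorVec v) (tensorVec w) = ∏ i, inner ℝ (v i) (w i) := by
  simp only [PiLp.inner_apply, tensorVec, RCLike.inner_apply, conj_trivial]
  rw [Finset.prod_univ_sum, Fintype.piFinset_univ]
  simp [Finset.prod_mul_distrib]

theorem norm_tensorVec {n m : ℕ} (v : Fin m → RVec n) : ‖tensorVec v‖ = ∏ i, ‖v i‖ := by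
  rw [← sq_eq_sq₀ (norm_nonneg _) (Finset.prod_nonneg fun _ _ => norm_nonneg _),
    ← real_inner_self_eq_norm_sq, inner_tensorVec, ← Finset.prod_pow]
  simp

theorem continuous_tensorVec {n m : ℕ} :
    Continuous (tensorVec : (Fin m → RVec n) → TPow n m) := by
  unfold tensorVec
  fun_prop

/-- The Hilbert tensor product `(ℝⁿ)^{⊗(j-1)} ⊗ V ⊗ (ℝⁿ)^{⊗(m-j)}`: the factors `ℝⁿ` are labelled by
the indices `i ≠ j`, and the tensor is written as a `V`-valued array over these labels. -/
abbrev Slot (n m : ℕ) (j : Fin m) (V : Type*) : Type _ :=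
  PiLp 2 (fun _ : {i : Fin m // i ≠ j} → Fin n => V)

section Slot

variable {n m : ℕ} (j : Fin m) {V W : Type*}
  [NormedAddCommGroup V] [InnerProductSpace ℝ V] [NormedAddCommGroup W] [InnerProductSpace ℝ W]

/-- The decomposable tensor with the vectors `v i` in the slots `i ≠ j` and `w` in the slot `j`. -/
def slotVec (v : Fin m → RVec n) (w : V) : Slot n m j V :=
  WithLp.toLp 2 fun a => (∏ i : {i : Fin m // i ≠ j}, v i (a i)) • w

/-- The multi-index with the value `c` at `j` and the values `a` at the other places. -/
def insertIdx (a : {i : Fin m // i ≠ j} → Fin n) (c : Fin n) : Fin m → Fin n :=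
  fun i => if h : i = j then c else a ⟨i, h⟩

/-- `Id ⊗ L ⊗ Id`, with `L` acting in the slot `j`. -/
def slotMap (L : V →L[ℝ] W) : Slot n m j V →L[ℝ] Slot n m j W :=
  (PiLp.continuousLinearEquiv 2 ℝ fun _ : {i : Fin m // i ≠ j} → Fin n => W).symm.toContinuousLinearMap ∘L
    ContinuousLinearMap.pi fun a => L ∘L PiLp.proj 2 (fun _ : {i : Fin m // i ≠ j} → Fin n => V) a

/-- The canonical identification of `(ℝⁿ)^{⊗m}` with `(ℝⁿ)^{⊗(j-1)} ⊗ ℝⁿ ⊗ (ℝⁿ)^{⊗(m-j)}`. -/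
def toSlot : TPow n m →L[ℝ] Slot n m j (RVec n) :=
  (PiLp.continuousLinearEquiv 2 ℝ fun _ : {i : Fin m // i ≠ j} → Fin n => RVec n).symm.toContinuousLinearMap ∘L
    ContinuousLinearMap.pi fun a =>
      (PiLp.continuousLinearEquiv 2 ℝ fun _ : Fin n => ℝ).symm.toContinuousLinearMap ∘L
        ContinuousLinearMap.pi fun c =>
          PiLp.proj 2 (fun _ : Fin m → Fin n => ℝ) (insertIdx j a c)

/-- The inverse identification. -/
def ofSlot : Slot n m j (RVec n) →L[ℝ] TPow n m :=
  (PiLp.continuousLinearEquiv 2 ℝ fun _ : Fin m → Fin n => ℝ).symm.toContinuousLinearMap ∘L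
    ContinuousLinearMap.pi fun a =>
      PiLp.proj 2 (fun _ : Fin n => ℝ) (a j) ∘L
        PiLp.proj 2 (fun _ : {i : Fin m // i ≠ j} → Fin n => RVec n) (fun i => a i)

theorem slotMap_apply (L : V →L[ℝ] W) (Y : Slot n m j V) (a : {i : Fin m // i ≠ j} → Fin n) :
    slotMap j L Y a = L (Y a) := rfl

theorem toSlot_apply (X : TPow n m) (a : {i : Fin m // i ≠ j} → Fin n) (c : Fin n) :
    toSlot j X a c = X (insertIdx j a c) := rfl

theorem ofSlot_apply (Y : Slot n m j (RVec n)) (a : Fin m → Fin n) :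
    ofSlot j Y a = Y (fun i => a i) (a j) := rfl

theorem slotMap_slotVec (L : V →L[ℝ] W) (v : Fin m → RVec n) (w : V) :
    slotMap j L (slotVec j v w) = slotVec j v (L w) := by
  ext a
  simp [slotMap_apply, slotVec]

theorem toSlot_tensorVec (v : Fin m → RVec n) :
    toSlot j (tensorVec v) = slotVec j v (v j) := by
  ext a c
  simp only [toSlot_apply, tensorVec, slotVec, PiLp.smul_apply, smul_eq_mul]
  rw [← Finset.mul_prod_erase _ _ (Finset.mem_univ j), mul_comm]
  congr 1
  · rw [Finset.prod_subtype (p := fun i => i ≠ j) (Finset.univ.erase j) (by simp)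
      (fun i => v i (insertIdx j a c i))]
    refine Finset.prod_congr rfl fun i _ => ?_
    simp [insertIdx, i.2]
  · simp [insertIdx]

theorem ofSlot_toSlot (X : TPow n m) : ofSlot j (toSlot j X) = X := by
  ext a
  rw [ofSlot_apply, toSlot_apply]
  refine congrArg X (funext fun i => ?_)
  by_cases h : i = j
  · subst h; simp [insertIdx]
  · simp [insertIdx, h]

theorem toSlot_ofSlot (Y : Slot n m j (RVec n)) : toSlot j (ofSlot j Y) = Y := by
  ext a c
  rw [toSlot_apply, ofSlot_apply]
  have h : (fun i : {i : Fin m // i ≠ j} => insertIdx j a c i) = a :=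
    funext fun i => by simp [insertIdx, i.2]
  rw [h]
  simp [insertIdx]

end Slot

/-! ### The history space -/

/-- The interval `[-τ, 0]`. -/
abbrev Hist (τ : ℝ) : Type := Set.Icc (-τ) (0 : ℝ)

/-- Lebesgue measure on `[-τ, 0]`. -/
def leb (τ : ℝ) : Measure (Hist τ) := (volume : Measure ℝ).comap Subtype.val

instance (τ : ℝ) : IsFiniteMeasure (leb τ) :=
  ⟨by
    rw [leb, (MeasurableEmbedding.subtype_coe measurableSet_Icc).comap_apply, image_univ,
      Subtype.range_coe, Real.volume_Icc]
    exact ENNReal.ofReal_lt_top⟩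

theorem leb_singleton {τ : ℝ} (x : Hist τ) : leb τ {x} = 0 := by
  rw [leb, (MeasurableEmbedding.subtype_coe measurableSet_Icc).comap_apply]
  simp

theorem integrable_leb_of_continuous {τ : ℝ} {n : ℕ} {ψ : Hist τ → RVec n} (h : Continuous ψ) :
    Integrable ψ (leb τ) :=
  h.integrable_of_hasCompactSupport (HasCompactSupport.of_compactSpace ψ)

/-! ### The measurement operators `C_{j,J(j)}^{(k)}`

A multi-index `j₁ < ⋯ < j_k` is the finite set `S = {j₁, …, j_k}`, and the variables of a function of
`θ_{j₁}, …, θ_{j_k}` are labelled by the elements of `S`. -/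

section Measurement

variable {τ : ℝ} {n m : ℕ} {M : Type*} [NormedAddCommGroup M] [InnerProductSpace ℝ M]

/-- Adds the value `s` of the variable `θ_j` to the variables labelled by `S`. -/
def insertVar (S : Finset (Fin m)) (j : Fin m) (θ : S → Hist τ) (s : Hist τ) :
    ↥(insert j S) → Hist τ :=
  fun i => if h : (i : Fin m) = j then s else θ ⟨i, Finset.mem_of_mem_insert_of_ne i.2 h⟩

theorem continuous_insertVar (S : Finset (Fin m)) (j : Fin m) :
    Continuous fun q : (S → Hist τ) × Hist τ => insertVar S j q.1 q.2 := by
  refine continuous_pi fun i => ?_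
  unfold insertVar
  by_cases h : (i : Fin m) = j
  · simp only [h, dite_true]; exact continuous_snd
  · simp only [h, dite_false]; fun_prop

/-- For fixed `θ` and a multi-index `a` over the slots `i ≠ j`, the function
`θ_j ↦ Φ(…, θ_j, …)` read off in the slot `j`. -/
def slice (S : Finset (Fin m)) (j : Fin m)
    (Φ : C(↥(insert j S) → Hist τ, TPow n m))
    (a : {i : Fin m // i ≠ j} → Fin n) : C(S → Hist τ, C(Hist τ, RVec n)) :=
  ContinuousMap.curry
    ⟨fun q : (S → Hist τ) × Hist τ => toSlot j (Φ (insertVar S j q.1 q.2)) a, by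
      have h := continuous_insertVar (τ := τ) S j
      have h2 : Continuous fun q : (S → Hist τ) × Hist τ => toSlot j (Φ (insertVar S j q.1 q.2)) :=
        (toSlot j).continuous.comp (Φ.continuous.comp h)
      fun_prop⟩

/-- The operator `C_{j,J(j)}^{(k)}` from `C([-τ, 0]^{S ∪ {j}}; (ℝⁿ)^{⊗m})` to `C([-τ, 0]^S; 𝕄_j)`:
`Id ⊗ C ⊗ Id` applied in the variable `θ_j` and the tensor slot `j`. If `C φ = ∫ dc(θ) φ(θ)`, it is
`Φ ↦ ∫ dc_j(θ_j) Φ` with `c_j = Id ⊗ c ⊗ Id`, see `measurement_isStieltjesIntegral`. -/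
def measurement (C : C(Hist τ, RVec n) →L[ℝ] M) (S : Finset (Fin m)) (j : Fin m)
    (Φ : C(↥(insert j S) → Hist τ, TPow n m)) : C(S → Hist τ, Slot n m j M) where
  toFun θ := WithLp.toLp 2 fun a => C (slice S j Φ a θ)
  continuous_toFun := by fun_prop

/-- `I` is the Riemann-Stieltjes integral `∫_{[-τ, 0]} dc(θ) φ(θ)`. -/
def IsStieltjesIntegral {V W : Type*} [NormedAddCommGroup V] [NormedSpace ℝ V]
    [NormedAddCommGroup W] [NormedSpace ℝ W] (c : Hist τ → V →L[ℝ] W) (φ : Hist τ → V) (I : W) :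
    Prop :=
  ∀ ε > 0, ∃ δ > 0, ∀ (N : ℕ) (q s : ℕ → Hist τ), Monotone q → (q 0 : ℝ) = -τ → (q N : ℝ) = 0 →
    (∀ i < N, (q (i + 1) : ℝ) - q i < δ) → (∀ i < N, q i ≤ s i ∧ s i ≤ q (i + 1)) →
    ‖∑ i ∈ Finset.range N, (c (q (i + 1)) - c (q i)) (φ (s i)) - I‖ < ε

theorem measurement_isStieltjesIntegral (C : C(Hist τ, RVec n) →L[ℝ] M)
    (c : Hist τ → RVec n →L[ℝ] M)
    (hc : ∀ φ : C(Hist τ, RVec n), IsStieltjesIntegral c φ (C φ)) (S : Finset (Fin m)) (j : Fin m)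
    (Φ : C(↥(insert j S) → Hist τ, TPow n m)) (θ : S → Hist τ) :
    IsStieltjesIntegral (fun s => slotMap j (c s) ∘L toSlot j)
      (fun s => Φ (insertVar S j θ s)) (measurement C S j Φ θ) := by
  intro ε hε
  set K : ℝ := Real.sqrt (Fintype.card ({i : Fin m // i ≠ j} → Fin n)) + 1 with hK
  have hKpos : 0 < K := by positivity
  choose! δ hδ h using fun a => hc (slice S j Φ a θ) (ε / K) (by positivity)
  obtain ⟨δ₀, hδ₀, hle⟩ : ∃ d > 0, ∀ a, d ≤ δ a := by
    rcases isEmpty_or_nonempty ({i : Fin m // i ≠ j} → Fin n) with he | he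
    · exact ⟨1, one_pos, fun a => he.elim a⟩
    · exact ⟨Finset.univ.inf' Finset.univ_nonempty δ, by simpa using hδ, fun a =>
        Finset.inf'_le _ (Finset.mem_univ a)⟩
  refine ⟨δ₀, hδ₀, fun N q s hq h0 hN hmesh hs => ?_⟩
  have hcomp : ∀ a, ‖(∑ i ∈ Finset.range N, (slotMap j (c (q (i + 1))) ∘L toSlot j -
      slotMap j (c (q i)) ∘L toSlot j) (Φ (insertVar S j θ (s i))) - measurement C S j Φ θ) a‖
        ≤ ε / K := by
    intro a
    refine le_of_eq_of_le ?_ (h a N q s hq h0 hN (fun i hi => (hmesh i hi).trans_le (hle a)) hs).le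
    congr 1
    rw [PiLp.sub_apply, WithLp.ofLp_sum, Finset.sum_apply]
    rfl
  refine lt_of_le_of_lt (b := Real.sqrt (Fintype.card ({i : Fin m // i ≠ j} → Fin n)) * (ε / K)) ?_ ?_
  · rw [PiLp.norm_eq_of_L2]
    rw [← Real.sqrt_sq (by positivity : 0 ≤ ε / K), ← Real.sqrt_mul (by positivity)]
    refine Real.sqrt_le_sqrt ?_
    refine (Finset.sum_le_card_nsmul _ _ ((ε / K) ^ 2) fun a _ => ?_).trans (by simp)
    exact pow_le_pow_left₀ (norm_nonneg _) (hcomp a) 2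
  · rw [← mul_div_assoc, div_lt_iff₀ hKpos]
    rw [hK]; nlinarith

end Measurement

variable {τ : ℝ} [hτ : Fact (0 < τ)]

/-- The point `0` of `[-τ, 0]`. -/
def hzero (τ : ℝ) [hτ : Fact (0 < τ)] : Hist τ := ⟨0, by constructor <;> linarith [hτ.out]⟩

/-- The measure `μ` on `[-τ, 0]`, Lebesgue measure plus the unit mass at `0`. -/
def histMeasure (τ : ℝ) [Fact (0 < τ)] : Measure (Hist τ) := leb τ + Measure.dirac (hzero τ)

instance : IsFiniteMeasure (histMeasure τ) := by unfold histMeasure; infer_instance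

/-- `ℍ = L₂([-τ, 0]; μ; ℝⁿ)`. -/
abbrev HSpace (τ : ℝ) [Fact (0 < τ)] (n : ℕ) : Type := Lp (RVec n) 2 (histMeasure τ)

/-- `𝓛 = L₂([-τ, 0]^m; μ^{⊗m}; (ℝⁿ)^{⊗m})`, the `m`-fold Hilbert tensor power of `ℍ`. -/
abbrev LSpace (τ : ℝ) [Fact (0 < τ)] (n m : ℕ) : Type :=
  Lp (TPow n m) 2 (Measure.pi fun _ : Fin m => histMeasure τ)

/-- The embedding of `C([-τ, 0]; ℝⁿ)` into `ℍ`. -/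
def embC (τ : ℝ) [Fact (0 < τ)] (n : ℕ) : C(Hist τ, RVec n) →L[ℝ] HSpace τ n :=
  ContinuousMap.toLp 2 (histMeasure τ) ℝ

theorem memLp_tensor {n m : ℕ} (φ : Fin m → HSpace τ n) :
    MemLp (fun θ : Fin m → Hist τ => tensorVec fun i => φ i (θ i)) 2
      (Measure.pi fun _ : Fin m => histMeasure τ) := by
  have hmeas : AEStronglyMeasurable (fun θ : Fin m → Hist τ => tensorVec fun i => φ i (θ i))
      (Measure.pi fun _ : Fin m => histMeasure τ) := by
    refine continuous_tensorVec.comp_aestronglyMeasurable (f := fun (θ : Fin m → Hist τ) i => φ i (θ i)) ?_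
    refine AEMeasurable.aestronglyMeasurable (aemeasurable_pi_lambda _ fun i => ?_)
    refine AEStronglyMeasurable.aemeasurable ?_
    exact (Lp.aestronglyMeasurable (φ i)).comp_quasiMeasurePreserving
      (Measure.quasiMeasurePreserving_eval _ i)
  rw [memLp_two_iff_integrable_sq_norm hmeas]
  simp_rw [norm_tensorVec, ← Finset.prod_pow]
  exact Integrable.fintype_prod (f := fun i x => ‖φ i x‖ ^ 2) fun i => by
    exact (memLp_two_iff_integrable_sq_norm (Lp.aestronglyMeasurable (φ i))).1 (Lp.memLp (φ i))

/-- The tensor product `φ₁ ⊗ ⋯ ⊗ φ_m ∈ 𝓛` of elements of `ℍ`, i.e. the function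
`(θ₁, …, θ_m) ↦ φ₁(θ₁) ⊗ ⋯ ⊗ φ_m(θ_m)`. -/
def tensor {n m : ℕ} (φ : Fin m → HSpace τ n) : LSpace τ n m := (memLp_tensor φ).toLp _


/-! ### Faces of the cube, restriction to a face and extension by zero from a face -/

/-- `[-τ, 0]^S → [-τ, 0]^m`, filling in `θ_i = 0` for `i ∉ S`. -/
def faceEmb {m : ℕ} (S : Finset (Fin m)) (θ : S → Hist τ) : Fin m → Hist τ :=
  fun i => if h : i ∈ S then θ ⟨i, h⟩ else hzero τ

/-- The relative interior part of the face: `θ_i = 0` exactly for `i ∉ S`. -/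
def openFace (τ : ℝ) [Fact (0 < τ)] {m : ℕ} (S : Finset (Fin m)) : Set (Fin m → Hist τ) :=
  {θ | ∀ i, θ i = hzero τ ↔ i ∉ S}

/-- Lebesgue measure on `[-τ, 0]^S`. -/
abbrev faceLeb (τ : ℝ) {m : ℕ} (S : Finset (Fin m)) : Measure (S → Hist τ) :=
  Measure.pi fun _ : S => leb τ

theorem openFace_eq {m : ℕ} (S : Finset (Fin m)) :
    openFace τ S = Set.univ.pi fun i => if i ∈ S then {hzero τ}ᶜ else {hzero τ} := by
  ext θ
  simp only [openFace, mem_ofPred_eq, Set.mem_pi, mem_univ, true_imp_iff]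
  refine forall_congr' fun i => ?_
  by_cases h : i ∈ S <;> simp [h]

theorem measurableSet_openFace {m : ℕ} (S : Finset (Fin m)) : MeasurableSet (openFace τ S) := by
  rw [openFace_eq]
  refine MeasurableSet.univ_pi fun i => ?_
  split_ifs
  · exact (measurableSet_singleton _).compl
  · exact measurableSet_singleton _

theorem measurable_faceEmb {m : ℕ} (S : Finset (Fin m)) :
    Measurable (faceEmb (τ := τ) S) := by
  refine measurable_pi_lambda _ fun i => ?_
  unfold faceEmb
  by_cases h : i ∈ S
  · simp only [h, dite_true]; exact measurable_pi_apply _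
  · simp only [h, dite_false]; exact measurable_const

theorem restrict_openFace {m : ℕ} (S : Finset (Fin m)) :
    (Measure.pi fun _ : Fin m => histMeasure τ).restrict (openFace τ S) =
      Measure.pi fun i => if i ∈ S then leb τ else Measure.dirac (hzero τ) := by
  rw [openFace_eq, Measure.restrict_pi_pi]
  congr 1
  ext1 i
  by_cases h : i ∈ S
  · simp only [h, if_true, histMeasure, Measure.restrict_add]
    rw [Measure.restrict_eq_self_of_ae_mem (μ := leb τ), Measure.restrict_eq_zero.2, add_zero]
    · simp
    · rw [ae_iff]; simpa using leb_singleton (hzero τ)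
  · simp only [h, if_false, histMeasure, Measure.restrict_add]
    rw [Measure.restrict_eq_zero.2 (leb_singleton _), zero_add,
      Measure.restrict_eq_self_of_ae_mem (μ := Measure.dirac _)]
    simp

theorem measurePreserving_faceEmb {m : ℕ} (S : Finset (Fin m)) :
    MeasurePreserving (faceEmb (τ := τ) S) (faceLeb τ S)
      ((Measure.pi fun _ : Fin m => histMeasure τ).restrict (openFace τ S)) := by
  have hfin : ∀ i : Fin m, IsFiniteMeasure (if i ∈ S then leb τ else Measure.dirac (hzero τ)) := by
    intro i; split_ifs <;> infer_instance
  refine ⟨measurable_faceEmb S, ?_⟩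
  rw [restrict_openFace]
  refine (Measure.pi_eq fun s hs => ?_).symm
  rw [Measure.map_apply (measurable_faceEmb S) (MeasurableSet.univ_pi hs)]
  have hprod : ∏ i, (if i ∈ S then leb τ else Measure.dirac (hzero τ)) (s i) =
      (∏ i : S, leb τ (s i)) * ∏ i ∈ Sᶜ, Measure.dirac (hzero τ) (s i) := by
    rw [← Finset.prod_mul_prod_compl S]
    congr 1
    · rw [Finset.prod_coe_sort S fun i => leb τ (s i)]
      exact Finset.prod_congr rfl fun i hi => by simp [hi]
    · exact Finset.prod_congr rfl fun i hi => by simp [Finset.mem_compl.1 hi]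
  rw [hprod]
  by_cases h0 : ∀ i ∈ Sᶜ, hzero τ ∈ s i
  · rw [Finset.prod_eq_one (s := Sᶜ) fun i hi => by simp [h0 i hi], mul_one, ← Measure.pi_pi]
    congr 1
    ext θ
    simp only [mem_preimage, Set.mem_pi, mem_univ, true_imp_iff, faceEmb]
    constructor
    · intro h i; simpa using h i
    · intro h i
      by_cases hi : i ∈ S
      · simpa [hi] using h ⟨i, hi⟩
      · simpa [hi] using h0 i (by simpa using hi)
  · push Not at h0
    obtain ⟨i, hi, hi0⟩ := h0
    rw [Finset.prod_eq_zero hi (by simp [hi0, hs i]), mul_zero]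
    convert measure_empty (μ := faceLeb τ S)
    rw [eq_empty_iff_forall_notMem]
    intro θ h
    have := h i (mem_univ i)
    simp [faceEmb, Finset.mem_compl.1 hi, hi0] at this

theorem measurePreserving_faceRestr {m : ℕ} (S : Finset (Fin m)) :
    MeasurePreserving (fun (θ : Fin m → Hist τ) (i : S) => θ i)
      ((Measure.pi fun _ : Fin m => histMeasure τ).restrict (openFace τ S)) (faceLeb τ S) := by
  have hmeas : Measurable fun (θ : Fin m → Hist τ) (i : S) => θ i :=
    measurable_pi_lambda _ fun i => measurable_pi_apply _
  refine ⟨hmeas, ?_⟩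
  rw [← (measurePreserving_faceEmb S).map_eq, Measure.map_map hmeas (measurable_faceEmb S)]
  convert Measure.map_id
  ext θ i
  simp [faceEmb]

section Faces

variable {m : ℕ} {E : Type*} [NormedAddCommGroup E]

theorem memLp_restrictFace (S : Finset (Fin m))
    (Φ : Lp E 2 (Measure.pi fun _ : Fin m => histMeasure τ)) :
    MemLp (fun θ => Φ (faceEmb S θ)) 2 (faceLeb τ S) :=
  ((Lp.memLp Φ).mono_measure Measure.restrict_le_self).comp_measurePreserving
    (measurePreserving_faceEmb S)

/-- The restriction operator `R_S`: `(R_S Φ)(θ_{j₁}, …, θ_{j_k})` is the value of `Φ` at the point of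
the face with `θ_i = 0` for `i ∉ S`, as an element of `L₂` over the Lebesgue measure. -/
def restrictFace (S : Finset (Fin m)) (Φ : Lp E 2 (Measure.pi fun _ : Fin m => histMeasure τ)) :
    Lp E 2 (faceLeb τ S) := (memLp_restrictFace S Φ).toLp _

theorem memLp_extendFace (S : Finset (Fin m)) (f : Lp E 2 (faceLeb τ S)) :
    MemLp ((openFace τ S).indicator fun θ => f fun i => θ i) 2
      (Measure.pi fun _ : Fin m => histMeasure τ) := by
  rw [memLp_indicator_iff_restrict (measurableSet_openFace S)]
  exact (Lp.memLp f).comp_measurePreserving (measurePreserving_faceRestr S)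

/-- The element of the boundary subspace `∂_S 𝓛` whose restriction to the face `S` is `f`; it
vanishes on all other faces (see `restrictFace_extendFace`). -/
def extendFace (S : Finset (Fin m)) (f : Lp E 2 (faceLeb τ S)) :
    Lp E 2 (Measure.pi fun _ : Fin m => histMeasure τ) := (memLp_extendFace S f).toLp _

theorem ae_faceEmb_mem_openFace (S : Finset (Fin m)) :
    ∀ᵐ θ ∂faceLeb τ S, faceEmb S θ ∈ openFace τ S :=
  (measurePreserving_faceEmb S).quasiMeasurePreserving.ae
    (ae_restrict_mem (measurableSet_openFace S))

theorem restrictFace_extendFace (S S' : Finset (Fin m)) (f : Lp E 2 (faceLeb τ S)) :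
    (restrictFace S (extendFace S f) = f) ∧ (S' ≠ S → restrictFace S' (extendFace S f) = 0) := by
  have key : ∀ S' : Finset (Fin m), restrictFace S' (extendFace S f) =ᵐ[faceLeb τ S']
      fun θ => (openFace τ S).indicator (fun θ => f fun i => θ i) (faceEmb S' θ) := by
    intro S'
    refine (MemLp.coeFn_toLp (memLp_restrictFace S' _)).trans ?_
    exact (measurePreserving_faceEmb S').quasiMeasurePreserving.ae_eq_comp
      (ae_restrict_of_ae (MemLp.coeFn_toLp (memLp_extendFace S f)))
  constructor
  · refine Lp.ext ?_
    filter_upwards [key S, ae_faceEmb_mem_openFace S] with θ h1 h2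
    rw [h1, indicator_of_mem h2]
    congr 1
    ext i
    simp [faceEmb]
  · intro hne
    refine Lp.ext ?_
    filter_upwards [key S', ae_faceEmb_mem_openFace S', Lp.coeFn_zero E 2 (faceLeb τ S')]
      with θ h1 h2 h3
    rw [h1, h3, indicator_of_notMem]
    · rfl
    · intro h4
      refine hne (Finset.ext fun i => ?_)
      have := (h2 i).symm.trans (h4 i)
      tauto

end Faces

/-! ### Strongly continuous semigroups, generators, compounds -/

section Semigroups

variable {X : Type*} [NormedAddCommGroup X] [NormedSpace ℝ X]

/-- `G` is a `C₀`-semigroup in `X`. -/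
structure IsC0Semigroup (G : ℝ≥0 → X →L[ℝ] X) : Prop where
  zero : G 0 = ContinuousLinearMap.id ℝ X
  add : ∀ t s, G (t + s) = G t ∘L G s
  continuous : ∀ x, Continuous fun t => G t x

/-- The graph of the generator: all `(x, y)` with `h⁻¹ (G(h) x - x) → y` as `h → 0+`. -/
def generatorGraph (G : ℝ≥0 → X →L[ℝ] X) : Submodule ℝ (X × X) where
  carrier := {p | Tendsto (fun h : ℝ≥0 => (h : ℝ)⁻¹ • (G h p.1 - p.1)) (𝓝[>] 0) (𝓝 p.2)}
  add_mem' := by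
    intro p q hp hq
    have := Tendsto.add hp hq
    refine this.congr fun h => ?_
    simp only [Prod.fst_add, map_add, ← smul_add]
    congr 1
    abel
  zero_mem' := by simp
  smul_mem' := by
    intro c p hp
    have := Tendsto.const_smul hp c
    refine this.congr fun h => ?_
    simp only [Prod.smul_fst, map_smul, ← smul_sub]
    rw [smul_comm]

theorem generatorGraph_snd_eq_zero (G : ℝ≥0 → X →L[ℝ] X) (p : X × X)
    (hp : p ∈ generatorGraph G) (h0 : p.1 = 0) : p.2 = 0 := by
  have h : Tendsto (fun h : ℝ≥0 => (h : ℝ)⁻¹ • (G h p.1 - p.1)) (𝓝[>] 0) (𝓝 p.2) := hp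
  simp only [h0, map_zero, sub_zero, smul_zero] at h
  exact tendsto_nhds_unique h tendsto_const_nhds

/-- The (infinitesimal) generator of `G`. -/
def generator (G : ℝ≥0 → X →L[ℝ] X) : X →ₗ.[ℝ] X := (generatorGraph G).toLinearPMap

theorem mem_graph_generator (G : ℝ≥0 → X →L[ℝ] X) (x y : X) :
    (x, y) ∈ (generator G).graph ↔
      Tendsto (fun h : ℝ≥0 => (h : ℝ)⁻¹ • (G h x - x)) (𝓝[>] 0) (𝓝 y) := by
  rw [generator, Submodule.toLinearPMap_graph_eq _ (generatorGraph_snd_eq_zero G)]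
  rfl

/-- `u ∈ C([0, ∞); 𝒟(T))`, where `𝒟(T)` carries the graph norm. -/
def ContinuousInDomain (T : X →ₗ.[ℝ] X) (u : ℝ → X) : Prop :=
  ContinuousOn u (Ici 0) ∧
    ∃ y : ℝ → X, ContinuousOn y (Ici 0) ∧ ∀ t, 0 ≤ t → (u t, y t) ∈ T.graph

end Semigroups

/-- `Lm` is the `m`-fold multiplicative compound `L^{⊗m}` of `L`. -/
def IsMultiplicativeCompound {n m : ℕ} (L : HSpace τ n →L[ℝ] HSpace τ n)
    (Lm : LSpace τ n m →L[ℝ] LSpace τ n m) : Prop :=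
  ∀ φ : Fin m → HSpace τ n, Lm (tensor φ) = tensor fun i => L (φ i)

/-- `Am` is the `m`-fold additive compound `A^{[⊗m]}` of `A`: `A` generates a `C₀`-semigroup `G`, and
`Am` is the generator of the `C₀`-semigroup `G^{⊗m}`. -/
def IsAdditiveCompound {n m : ℕ} (A : HSpace τ n →ₗ.[ℝ] HSpace τ n)
    (Am : LSpace τ n m →ₗ.[ℝ] LSpace τ n m) : Prop :=
  ∃ (G : ℝ≥0 → HSpace τ n →L[ℝ] HSpace τ n) (Gm : ℝ≥0 → LSpace τ n m →L[ℝ] LSpace τ n m),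
    IsC0Semigroup G ∧ generator G = A ∧
    IsC0Semigroup Gm ∧ (∀ t, IsMultiplicativeCompound (G t) (Gm t)) ∧ generator Gm = Am

/-! ### The operator `A` of the delay equation -/

/-- `f` is the weak derivative of `ψ` on `(-τ, 0)`. -/
def IsWeakDeriv {n : ℕ} (ψ f : Hist τ → RVec n) : Prop :=
  ∀ χ : ℝ → ℝ, ContDiff ℝ ∞ χ → HasCompactSupport χ → tsupport χ ⊆ Ioo (-τ) 0 →
    ∫ θ, deriv χ θ • ψ θ ∂leb τ = -∫ θ, χ θ • f θ ∂leb τ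

theorem ae_histMeasure_iff (Q : Hist τ → Prop) :
    (∀ᵐ θ ∂histMeasure τ, Q θ) ↔ (∀ᵐ θ ∂leb τ, Q θ) ∧ Q (hzero τ) := by
  rw [histMeasure, ae_add_measure_iff, ae_dirac_eq, eventually_pure]

instance : (leb τ).IsOpenPosMeasure := by
  refine ⟨fun U hU ⟨x, hx⟩ => ?_⟩
  obtain ⟨V, hV, rfl⟩ := isOpen_induced_iff.1 hU
  have hx2 : (x : ℝ) ∈ closure (Ioo (-τ) 0) := by
    rw [closure_Ioo (by linarith [hτ.out] : (-τ) ≠ 0)]; exact x.2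
  obtain ⟨y, hyV, hy⟩ := mem_closure_iff.1 hx2 V hV hx
  rw [leb, (MeasurableEmbedding.subtype_coe measurableSet_Icc).comap_apply]
  refine ne_of_gt (lt_of_lt_of_le ((hV.inter isOpen_Ioo).measure_pos volume ⟨y, hyV, hy⟩) ?_)
  refine measure_mono fun z hz => ⟨⟨z, hz.2.1.le, hz.2.2.le⟩, hz.1, rfl⟩

theorem integrable_leb_smul {n : ℕ} {χ : ℝ → ℝ} (h : Continuous χ) (y : HSpace τ n) :
    Integrable (fun θ : Hist τ => χ θ • y θ) (leb τ) := by
  have hy : MemLp y 2 (leb τ) := (Lp.memLp y).mono_measure (Measure.le_add_right le_rfl)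
  have hχ : MemLp (fun θ : Hist τ => χ θ) 2 (leb τ) :=
    (h.comp continuous_subtype_val).memLp_of_hasCompactSupport (HasCompactSupport.of_compactSpace _)
  exact memLp_one_iff_integrable.1 (hy.smul hχ)

/-- The graph of `A`: pairs `(φ, y)` where `φ` is the image of the continuous representative `ψ` of
an element of `W^{1,2}(-τ, 0; ℝⁿ)`, the value of `y` at the atom `0` is `Ã ψ`, and `y` is the weak
derivative of `ψ` on `(-τ, 0)`. -/
def delayGraph {n : ℕ} (Atil : C(Hist τ, RVec n) →L[ℝ] RVec n) :
    Submodule ℝ (HSpace τ n × HSpace τ n) where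
  carrier := {p | ∃ ψ : C(Hist τ, RVec n), p.1 = embC τ n ψ ∧
    p.2 (hzero τ) = Atil ψ ∧ IsWeakDeriv ψ p.2}
  add_mem' := by
    rintro p q ⟨ψ, h1, h2, h3⟩ ⟨ψ', h1', h2', h3'⟩
    have hadd := (ae_histMeasure_iff _).1 (Lp.coeFn_add p.2 q.2)
    refine ⟨ψ + ψ', by simp [h1, h1'], ?_, fun χ hχ hc hs => ?_⟩
    · rw [Prod.snd_add, hadd.2]; simp [h2, h2']
    · have hd : Continuous (deriv χ) := hχ.continuous_deriv (by simp)
      have e1 : ∫ θ, deriv χ θ • (ψ + ψ') θ ∂leb τ =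
          ∫ θ, deriv χ θ • ψ θ ∂leb τ + ∫ θ, deriv χ θ • ψ' θ ∂leb τ := by
        rw [← integral_add]
        · simp
        · exact integrable_leb_of_continuous (by fun_prop)
        · exact integrable_leb_of_continuous (by fun_prop)
      have e2 : ∫ θ, χ θ • (p + q).2 θ ∂leb τ =
          ∫ θ, χ θ • p.2 θ ∂leb τ + ∫ θ, χ θ • q.2 θ ∂leb τ := by
        rw [← integral_add (integrable_leb_smul hχ.continuous _)
          (integrable_leb_smul hχ.continuous _)]
        refine integral_congr_ae ?_
        filter_upwards [hadd.1] with θ hθ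
        rw [Prod.snd_add, hθ, Pi.add_apply, smul_add]
      rw [e1, e2, h3 χ hχ hc hs, h3' χ hχ hc hs, neg_add]
  zero_mem' := by
    have h0 := (ae_histMeasure_iff _).1 (Lp.coeFn_zero (RVec n) 2 (histMeasure τ))
    refine ⟨0, by simp, by rw [Prod.snd_zero, h0.2]; simp, fun χ _ _ _ => ?_⟩
    have e : ∫ θ, χ θ • (0 : HSpace τ n × HSpace τ n).2 θ ∂leb τ = 0 := by
      rw [integral_congr_ae (g := fun _ => 0), integral_zero]
      filter_upwards [h0.1] with θ hθ
      rw [Prod.snd_zero, hθ]; simp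
    rw [e]
    simp
  smul_mem' := by
    rintro c p ⟨ψ, h1, h2, h3⟩
    have hsm := (ae_histMeasure_iff _).1 (Lp.coeFn_smul c p.2)
    refine ⟨c • ψ, by simp [h1], by rw [Prod.smul_snd, hsm.2]; simp [h2],
      fun χ hχ hc hs => ?_⟩
    have e2 : ∫ θ, χ θ • (c • p).2 θ ∂leb τ = c • ∫ θ, χ θ • p.2 θ ∂leb τ := by
      rw [← integral_smul]
      refine integral_congr_ae ?_
      filter_upwards [hsm.1] with θ hθ
      rw [Prod.smul_snd, hθ, Pi.smul_apply, smul_comm]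
    have e1 : ∫ θ, deriv χ θ • (c • ψ) θ ∂leb τ = c • ∫ θ, deriv χ θ • ψ θ ∂leb τ := by
      rw [← integral_smul]
      simp only [ContinuousMap.smul_apply, smul_comm c]
    rw [e1, e2, h3 χ hχ hc hs, smul_neg]

theorem delayGraph_snd_eq_zero {n : ℕ} (Atil : C(Hist τ, RVec n) →L[ℝ] RVec n)
    (p : HSpace τ n × HSpace τ n) (hp : p ∈ delayGraph Atil) (h0 : p.1 = 0) : p.2 = 0 := by
  obtain ⟨ψ, h1, h2, h3⟩ := hp
  have hψ0 : ψ =ᵐ[leb τ] (0 : C(Hist τ, RVec n)) := by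
    have e := (ContinuousMap.coeFn_toLp (p := 2) (𝕜 := ℝ) (histMeasure τ) ψ).symm
    have e2 : embC τ n ψ = 0 := by rw [← h1, h0]
    unfold embC at e2
    rw [e2] at e
    filter_upwards [((ae_histMeasure_iff _).1 e).1,
      ((ae_histMeasure_iff _).1 (Lp.coeFn_zero (RVec n) 2 (histMeasure τ))).1] with θ a b
    rw [a, b]; rfl
  have hψ : ψ = 0 := ContinuousMap.coe_injective
    (Continuous.ae_eq_iff_eq (leb τ) ψ.continuous (0 : C(Hist τ, RVec n)).continuous |>.1 hψ0)
  subst hψ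
  have hemb : MeasurableEmbedding (Subtype.val : Hist τ → ℝ) :=
    MeasurableEmbedding.subtype_coe measurableSet_Icc
  set g : ℝ → RVec n := Function.extend Subtype.val p.2 0 with hg
  have hgv : ∀ θ : Hist τ, g θ = p.2 θ := fun θ => Subtype.val_injective.extend_apply _ _ θ
  have hint : Integrable g ((leb τ).map Subtype.val) := by
    rw [hemb.integrable_map_iff]
    refine (integrable_leb_smul (χ := fun _ => 1) continuous_const p.2).congr ?_
    exact ae_of_all _ fun θ => by simp [hgv]
  have hz := isOpen_Ioo.ae_eq_zero_of_integral_contDiff_smul_eq_zero (U := Ioo (-τ) 0)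
    (μ := (leb τ).map Subtype.val) (f := g) (hint.locallyIntegrable.locallyIntegrableOn _) (by
      intro χ hχ hc hs
      rw [hemb.integral_map]
      have := h3 χ hχ hc hs
      simp only [ContinuousMap.zero_apply, smul_zero, integral_zero] at this
      simp only [hgv]
      exact neg_eq_zero.1 this.symm)
  rw [hemb.ae_map_iff] at hz
  have hfin : ∀ᵐ θ ∂histMeasure τ, p.2 θ = 0 := by
    refine (ae_histMeasure_iff _).2 ⟨?_, by rw [h2]; simp⟩
    have n0 : ∀ᵐ θ ∂leb τ, θ ≠ hzero τ := by
      rw [ae_iff]; simpa using leb_singleton (hzero τ)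
    have n1 : ∀ᵐ θ ∂leb τ, θ ≠ (⟨-τ, le_rfl, by linarith [hτ.out]⟩ : Hist τ) := by
      rw [ae_iff]; simpa using leb_singleton _
    filter_upwards [hz, n0, n1] with θ a b c
    rw [← hgv]
    refine a ⟨lt_of_le_of_ne θ.2.1 fun h => c (Subtype.ext h.symm),
      lt_of_le_of_ne θ.2.2 fun h => b (Subtype.ext h)⟩
  refine Lp.ext ?_
  filter_upwards [hfin, Lp.coeFn_zero (RVec n) 2 (histMeasure τ)] with θ a b
  rw [a, b]; rfl

/-- The operator `A` in `ℍ` with `R₀(A φ) = Ã R₁ φ` and `R₁(A φ) = d/dθ R₁ φ`, whose domain is the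
image of `W^{1,2}(-τ, 0; ℝⁿ)`. -/
def delayOperator {n : ℕ} (Atil : C(Hist τ, RVec n) →L[ℝ] RVec n) :
    HSpace τ n →ₗ.[ℝ] HSpace τ n := (delayGraph Atil).toLinearPMap

theorem mem_graph_delayOperator {n : ℕ} (Atil : C(Hist τ, RVec n) →L[ℝ] RVec n)
    (φ y : HSpace τ n) :
    (φ, y) ∈ (delayOperator Atil).graph ↔ ∃ ψ : C(Hist τ, RVec n), φ = embC τ n ψ ∧
      y (hzero τ) = Atil ψ ∧ IsWeakDeriv ψ y := by
  rw [delayOperator, Submodule.toLinearPMap_graph_eq _ (delayGraph_snd_eq_zero Atil)]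
  rfl

/-! ### Solutions of the nonautonomous equation -/

/-- The element `B η` of `ℍ` with `R₀ B η = v` and `R₁ B η = 0`, where `v = B̃ η`. -/
def atomVec {n : ℕ} (v : RVec n) : HSpace τ n :=
  indicatorConstLp 2 (measurableSet_singleton (hzero τ)) (measure_ne_top (histMeasure τ) _) v

section Solutions

variable {n : ℕ} {P U M : Type*} [TopologicalSpace P]
  [NormedAddCommGroup U] [InnerProductSpace ℝ U] [NormedAddCommGroup M] [InnerProductSpace ℝ M]

/-- Classical solutions on `[0, ∞)` of `ξ' = A ξ + B F'(π^t(p)) C ξ`. Here `C φ := C ψ` if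
`φ ∈ ℍ` is the image of `ψ ∈ C([-τ, 0]; ℝⁿ)`. -/
structure IsClassicalSolution (Atil : C(Hist τ, RVec n) →L[ℝ] RVec n) (Btil : U →L[ℝ] RVec n)
    (C : C(Hist τ, RVec n) →L[ℝ] M) (π : Flow ℝ≥0 P) (F' : P → M →L[ℝ] U) (p : P)
    (ξ : ℝ → HSpace τ n) : Prop where
  contDiffOn : ContDiffOn ℝ 1 ξ (Ici 0)
  continuousInDomain : ContinuousInDomain (delayOperator Atil) ξ
  equation : ∀ t, 0 ≤ t → ∃ (y : HSpace τ n) (ψ : C(Hist τ, RVec n)),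
    (ξ t, y) ∈ (delayOperator Atil).graph ∧ ξ t = embC τ n ψ ∧
    HasDerivWithinAt ξ (y + atomVec (Btil (F' (π t.toNNReal p) (C ψ)))) (Ici 0) t

/-- Solutions (in the generalized sense) on `[0, ∞)`: limits of classical solutions, uniformly on
each interval `[0, T]`. -/
def IsSolution (Atil : C(Hist τ, RVec n) →L[ℝ] RVec n) (Btil : U →L[ℝ] RVec n)
    (C : C(Hist τ, RVec n) →L[ℝ] M) (π : Flow ℝ≥0 P) (F' : P → M →L[ℝ] U) (p : P)
    (ξ : ℝ → HSpace τ n) : Prop :=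
  ∃ u : ℕ → ℝ → HSpace τ n, (∀ l, IsClassicalSolution Atil Btil C π F' p (u l)) ∧
    ∀ T, TendstoUniformlyOn u ξ atTop (Icc 0 T)

/-- `Ξ` is the cocycle generated by the equation: `Ξ^t(p, ·)` is bounded and linear, and
`t ↦ Ξ^t(p, v)` is a solution with the initial value `v`. -/
def IsSolutionCocycle (Atil : C(Hist τ, RVec n) →L[ℝ] RVec n) (Btil : U →L[ℝ] RVec n)
    (C : C(Hist τ, RVec n) →L[ℝ] M) (π : Flow ℝ≥0 P) (F' : P → M →L[ℝ] U)
    (Ξ : ℝ≥0 → P → HSpace τ n →L[ℝ] HSpace τ n) : Prop :=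
  ∀ p v, Ξ 0 p v = v ∧ IsSolution Atil Btil C π F' p fun t => Ξ t.toNNReal p v

end Solutions

/-! ### The operators `F'_j` and `B_j` on faces -/

section FaceOperators

variable {n m : ℕ} {U M : Type*}
  [NormedAddCommGroup U] [InnerProductSpace ℝ U] [NormedAddCommGroup M] [InnerProductSpace ℝ M]

/-- The operator `F'_j` from `L₂((-τ, 0)^S; 𝕄_j)` to `L₂((-τ, 0)^S; 𝕌_j)`. -/
def faceF (S : Finset (Fin m)) (j : Fin m) (L : M →L[ℝ] U)
    (f : Lp (Slot n m j M) 2 (faceLeb τ S)) : Lp (Slot n m j U) 2 (faceLeb τ S) :=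
  (slotMap j L).compLp f

/-- The boundary operator `B_j^S` from `L₂((-τ, 0)^S; 𝕌_j)` to `∂_S 𝓛`. -/
def faceB (Btil : U →L[ℝ] RVec n) (S : Finset (Fin m)) (j : Fin m)
    (f : Lp (Slot n m j U) 2 (faceLeb τ S)) : LSpace τ n m :=
  extendFace S ((ofSlot j ∘L slotMap j Btil).compLp f)

end FaceOperators

end
end DelayCompound

open DelayCompound

namespace DelayCompound

noncomputable section

set_option linter.unusedSectionVars false

variable {τ : ℝ} [hτ : Fact (0 < τ)]

/-! ### History segments and the norm of `ℍ` -/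

section Segments

variable {n : ℕ}

/-! In terms of functions x on the line, equation (1) is the delay equation x'(t) = L(t)x_t with
segments x_t(θ) = x(t + θ) and L(t) = Ã + B̃F'(π^t ℘)C. The maps L(t) act on continuous functions
and are in general unbounded on ℍ, so well-posedness in ℍ rests on a bound in the mean, ∫₀ᵗ
|L(s)x_s|² ds ≤ κ ∫_{-τ}^t |x|² (`integral_sq_functional_seg_le`, collected in `DelayCoeff`). With
Gronwall's inequality it bounds the ℍ-norm of x_t by that of x_0 (`IsTraj.norm_embC_le`).
Trajectories with continuous initial data come from a contraction (`exists_isTraj`), and by density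
the solution operators extend to ℍ (`evol`). The constant coefficient Ã gives the semigroup G, the
coefficient above gives the cocycle Ξ.

The graph of A is described by primitives (`mem_graph_iff_prim`). A trajectory starting in the
domain of A is a C¹ curve in ℍ whose derivative is the weak derivative of x_t off θ = 0 and L(t)x_t
at the atom (`IsTraj.exists_derivative`). Hence it equals Ax_t plus an atom with the value B̃F'Cx_t.
This identifies the generator of G (`generator_evol`) and produces classical solutions. Conversely,
every solution is an orbit of the evolution (`eq_evol_of_hasDerivWithinAt`, `IsSolution.eq_evol`).

On the span of the decomposable tensors L^{⊗m} has norm at most ‖L‖^m, by the Schur product theorem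
applied to Gram matrices (`norm_tensorComb_le`), so it extends to the whole tensor power.

Finally, the product rule writes the derivative of ξ₁ ⊗ ⋯ ⊗ ξ_m as a sum over j of tensors with ξ_j'
in the slot j. The parts Aξ_j add up to A^{[⊗m]}Φ (`mem_graph_addCompound`). In each remaining term
the slot j holds an atom vector. The cube is partitioned into open faces indexed by S = {i : θ_i ≠
0}; such a term vanishes on the faces with j ∈ S, and on a face with j ∉ S it is exactly B_j F'_j
C_j applied to the restriction of Φ to the face S ∪ {j} (`sum_tensor_update_atomVec`). -/

theorem integral_leb {E : Type*} [NormedAddCommGroup E] [NormedSpace ℝ E] (f : ℝ → E) :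
    ∫ θ : Hist τ, f θ ∂leb τ = ∫ s in (-τ)..0, f s := by
  rw [leb, integral_subtype_comap measurableSet_Icc, integral_Icc_eq_integral_Ioc,
    intervalIntegral.integral_of_le (by linarith [hτ.out])]

theorem norm_sq_eq_integral_leb_add (φ : HSpace τ n) :
    ‖φ‖ ^ 2 = ∫ θ, ‖φ θ‖ ^ 2 ∂leb τ + ‖φ (hzero τ)‖ ^ 2 := by
  have hint := (memLp_two_iff_integrable_sq_norm (Lp.aestronglyMeasurable φ)).1 (Lp.memLp φ)
  rw [← real_inner_self_eq_norm_sq, L2.inner_def]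
  simp only [real_inner_self_eq_norm_sq]
  unfold histMeasure at hint ⊢
  rw [integral_add_measure (hint.mono_measure (Measure.le_add_right le_rfl))
    (hint.mono_measure (Measure.le_add_left le_rfl)), integral_dirac]

/-- Evaluation at the atom `0`. -/
def atomEval (τ : ℝ) [Fact (0 < τ)] (n : ℕ) : HSpace τ n →L[ℝ] RVec n :=
  LinearMap.mkContinuous
    { toFun := fun φ => φ (hzero τ)
      map_add' := fun φ ψ => ((ae_histMeasure_iff _).1 (Lp.coeFn_add φ ψ)).2
      map_smul' := fun c φ => ((ae_histMeasure_iff _).1 (Lp.coeFn_smul c φ)).2 } 1 fun φ => by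
    have h := norm_sq_eq_integral_leb_add φ
    have h0 : 0 ≤ ∫ θ, ‖φ θ‖ ^ 2 ∂leb τ := integral_nonneg fun _ => by positivity
    rw [one_mul]
    exact abs_le_of_sq_le_sq' (by simpa using by linarith) (norm_nonneg _) |>.2

theorem coeFn_embC (ψ : C(Hist τ, RVec n)) :
    (∀ᵐ θ ∂leb τ, embC τ n ψ θ = ψ θ) ∧ embC τ n ψ (hzero τ) = ψ (hzero τ) :=
  (ae_histMeasure_iff _).1 (ContinuousMap.coeFn_toLp (p := 2) (𝕜 := ℝ) (histMeasure τ) ψ)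

theorem atomEval_embC (ψ : C(Hist τ, RVec n)) : atomEval τ n (embC τ n ψ) = ψ (hzero τ) :=
  (coeFn_embC ψ).2

theorem embC_injective : Function.Injective (embC τ n) := by
  intro ψ ψ' h
  refine ContinuousMap.coe_injective
    ((Continuous.ae_eq_iff_eq (leb τ) ψ.continuous ψ'.continuous).1 ?_)
  filter_upwards [(coeFn_embC ψ).1, (coeFn_embC ψ').1] with θ a b
  rw [← a, ← b, h]

theorem denseRange_embC : DenseRange (embC τ n) :=
  ContinuousMap.toLp_denseRange (RVec n) (histMeasure τ) ℝ (by simp)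

/-- The segment `θ ↦ x(s + θ)` of `x`. -/
def seg (τ : ℝ) (x : C(ℝ, RVec n)) (s : ℝ) : C(Hist τ, RVec n) :=
  ⟨fun θ => x (s + θ), by fun_prop⟩

theorem seg_apply (x : C(ℝ, RVec n)) (s : ℝ) (θ : Hist τ) : seg τ x s θ = x (s + θ) := rfl

theorem seg_hzero (x : C(ℝ, RVec n)) (s : ℝ) : seg τ x s (hzero τ) = x s := by
  simp [seg_apply, hzero]

theorem seg_add (x y : C(ℝ, RVec n)) (s : ℝ) : seg τ (x + y) s = seg τ x s + seg τ y s := rfl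

theorem seg_sub (x y : C(ℝ, RVec n)) (s : ℝ) : seg τ (x - y) s = seg τ x s - seg τ y s := rfl

theorem seg_smul (c : ℝ) (x : C(ℝ, RVec n)) (s : ℝ) : seg τ (c • x) s = c • seg τ x s := rfl

theorem continuous_seg (x : C(ℝ, RVec n)) : Continuous (seg τ x) :=
  (ContinuousMap.curry ⟨fun q : ℝ × Hist τ => x (q.1 + q.2), by fun_prop⟩).continuous

theorem norm_sq_embC_seg (x : C(ℝ, RVec n)) (t : ℝ) :
    ‖embC τ n (seg τ x t)‖ ^ 2 = (∫ s in (t - τ)..t, ‖x s‖ ^ 2) + ‖x t‖ ^ 2 := by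
  rw [norm_sq_eq_integral_leb_add, (coeFn_embC _).2, seg_hzero]
  congr 1
  rw [integral_congr_ae (g := fun θ : Hist τ => ‖x (t + θ)‖ ^ 2)]
  · rw [integral_leb fun s => ‖x (t + s)‖ ^ 2,
      intervalIntegral.integral_comp_add_left (fun s => ‖x s‖ ^ 2)]
    simp [sub_eq_add_neg]
  · filter_upwards [(coeFn_embC (seg τ x t)).1] with θ h
    rw [h, seg_apply]

/-- The shifted function `x(a + ·)`. -/
def shift (x : C(ℝ, RVec n)) (a : ℝ) : C(ℝ, RVec n) := ⟨fun s => x (a + s), by fun_prop⟩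

theorem shift_apply (x : C(ℝ, RVec n)) (a s : ℝ) : shift x a s = x (a + s) := rfl

theorem seg_shift (x : C(ℝ, RVec n)) (a s : ℝ) : seg τ (shift x a) s = seg τ x (a + s) := by
  ext1 θ
  simp [seg_apply, shift_apply, add_assoc]

/-- The extension of a function on `[-τ, 0]` by constants. -/
def constExt (φ : C(Hist τ, RVec n)) : C(ℝ, RVec n) :=
  ⟨fun s => φ (projIcc (-τ) 0 (by linarith [hτ.out]) s), by fun_prop⟩

theorem seg_constExt (φ : C(Hist τ, RVec n)) : seg τ (constExt φ) 0 = φ := by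
  ext1 θ
  simp [seg_apply, constExt]

theorem constExt_of_nonneg (φ : C(Hist τ, RVec n)) {t : ℝ} (ht : 0 ≤ t) :
    constExt φ t = φ (hzero τ) := by
  simp only [constExt, ContinuousMap.coe_mk]
  rw [projIcc_of_right_le _ ht]
  rfl

theorem constExt_of_mem (φ : C(Hist τ, RVec n)) (θ : Hist τ) : constExt φ θ = φ θ := by
  simp [constExt]

theorem norm_constExt_le (φ : C(Hist τ, RVec n)) (t : ℝ) : ‖constExt φ t‖ ≤ ‖φ‖ :=
  φ.norm_coe_le_norm _

end Segments

/-! ### The energy estimate for bounded functionals on segments -/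

section Energy

variable {n : ℕ}

/-- A pointwise bound of l(x_s) by the ℍ-norm of x_s is not available; instead the square is
absorbed into the functional. The left side I equals l(Ψ) with Ψ = ∫₀ᵗ l(x_s) x_s ds in C([-τ,0]),
so I ≤ c‖Ψ‖. For each θ Young's inequality gives c|Ψ(θ)| ≤ I/2 + (c²/2) ∫₀ᵗ |x(s + θ)|² ds, and the
shifted window [θ, t + θ] lies in [-τ, t]. Half of I is then absorbed on the left. -/
theorem integral_sq_functional_seg_le (l : C(Hist τ, RVec n) →L[ℝ] ℝ) {c : ℝ} (hc : 0 ≤ c)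
    (hl : ∀ φ, ‖l φ‖ ≤ c * ‖φ‖) (x : C(ℝ, RVec n)) {t : ℝ} (ht : 0 ≤ t) :
    ∫ s in 0..t, (l (seg τ x s)) ^ 2 ≤ c ^ 2 * ∫ s in (-τ)..t, ‖x s‖ ^ 2 := by
  set X := ∫ s in (-τ)..t, ‖x s‖ ^ 2 with hX
  set I := ∫ s in 0..t, (l (seg τ x s)) ^ 2 with hI
  have hseg := continuous_seg (τ := τ) x
  have hf : Continuous fun s => l (seg τ x s) := l.continuous.comp hseg
  have hτ0 := hτ.out
  have hXnn : 0 ≤ X := intervalIntegral.integral_nonneg (by linarith) fun _ _ => by positivity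
  have hInn : 0 ≤ I := intervalIntegral.integral_nonneg ht fun _ _ => by positivity
  set Ψ : C(Hist τ, RVec n) := ∫ s in 0..t, l (seg τ x s) • seg τ x s with hΨ
  have hΨi : IntervalIntegrable (fun s => l (seg τ x s) • seg τ x s) volume 0 t :=
    (hf.smul hseg).intervalIntegrable _ _
  have h1 : I = l Ψ := by
    rw [hΨ, ← ContinuousLinearMap.intervalIntegral_comp_comm _ hΨi]
    simp [hI, sq]
  have h2 : c * ‖Ψ‖ ≤ I / 2 + c ^ 2 * X / 2 := by
    have : ‖c • Ψ‖ ≤ I / 2 + c ^ 2 * X / 2 := by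
      refine (ContinuousMap.norm_le _ (by positivity)).2 fun θ => ?_
      have e : (c • Ψ) θ = ∫ s in 0..t, c • (l (seg τ x s) • x (s + θ)) := by
        have := (ContinuousMap.evalCLM ℝ θ : C(Hist τ, RVec n) →L[ℝ] RVec n).intervalIntegral_comp_comm
          hΨi
        rw [intervalIntegral.integral_smul, ContinuousMap.smul_apply]
        exact congrArg _ this.symm
      have hθ : ∫ s in 0..t, ‖x (s + θ)‖ ^ 2 ≤ X := by
        rw [intervalIntegral.integral_comp_add_right (fun s => ‖x s‖ ^ 2)]
        refine intervalIntegral.integral_mono_interval (by linarith [θ.2.1]) (by linarith)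
          (by linarith [θ.2.2]) (ae_of_all _ fun _ => by positivity) ?_
        exact Continuous.intervalIntegrable (by fun_prop) _ _
      rw [e]
      have hc1 : Continuous fun s : ℝ => ‖x (s + θ)‖ ^ 2 := by fun_prop
      calc ‖∫ s in 0..t, c • (l (seg τ x s) • x (s + θ))‖
          ≤ ∫ s in 0..t, ((l (seg τ x s)) ^ 2 / 2 + c ^ 2 / 2 * ‖x (s + θ)‖ ^ 2) := by
            refine intervalIntegral.norm_integral_le_of_norm_le ht (ae_of_all _ fun s _ => ?_) ?_
            · rw [norm_smul, norm_smul, Real.norm_of_nonneg hc, Real.norm_eq_abs]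
              nlinarith [sq_nonneg (|l (seg τ x s)| - c * ‖x (s + θ)‖), sq_abs (l (seg τ x s))]
            · exact Continuous.intervalIntegrable (by fun_prop) _ _
        _ = I / 2 + c ^ 2 / 2 * ∫ s in 0..t, ‖x (s + θ)‖ ^ 2 := by
            rw [intervalIntegral.integral_add, intervalIntegral.integral_div,
              intervalIntegral.integral_const_mul]
            · exact Continuous.intervalIntegrable (by fun_prop) _ _
            · exact Continuous.intervalIntegrable (by fun_prop) _ _
        _ ≤ I / 2 + c ^ 2 * X / 2 := by nlinarith [sq_nonneg c]
    rwa [norm_smul, Real.norm_of_nonneg hc] at this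
  have h3 : I ≤ c * ‖Ψ‖ := by
    rw [h1]
    exact (le_abs_self _).trans (hl Ψ)
  linarith

/-- The scalar estimate is applied to the coordinates in an orthonormal basis, which costs the
factor dim W. This is where finite dimension enters. -/
theorem integral_sq_operator_seg_le {W : Type*} [NormedAddCommGroup W] [InnerProductSpace ℝ W]
    [FiniteDimensional ℝ W] (l : C(Hist τ, RVec n) →L[ℝ] W) {c : ℝ} (hc : 0 ≤ c)
    (hl : ∀ φ, ‖l φ‖ ≤ c * ‖φ‖) (x : C(ℝ, RVec n)) {t : ℝ} (ht : 0 ≤ t) :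
    ∫ s in 0..t, ‖l (seg τ x s)‖ ^ 2 ≤
      (Module.finrank ℝ W * c ^ 2) * ∫ s in (-τ)..t, ‖x s‖ ^ 2 := by
  set b := stdOrthonormalBasis ℝ W
  have hseg := continuous_seg (τ := τ) x
  have e : ∀ s, ‖l (seg τ x s)‖ ^ 2 = ∑ i, (((innerSL ℝ (b i)) ∘L l) (seg τ x s)) ^ 2 := by
    intro s
    rw [← b.sum_sq_norm_inner_right]
    simp
  simp_rw [e]
  rw [intervalIntegral.integral_finsetSum fun i _ => Continuous.intervalIntegrable (by fun_prop) _ _]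
  calc _ ≤ ∑ i : Fin (Module.finrank ℝ W), c ^ 2 * ∫ s in (-τ)..t, ‖x s‖ ^ 2 := by
        refine Finset.sum_le_sum fun i _ =>
          integral_sq_functional_seg_le ((innerSL ℝ (b i)) ∘L l) hc (fun φ => ?_) x ht
        refine (norm_inner_le_norm (b i) (l φ)).trans ?_
        rw [b.norm_eq_one, one_mul]
        exact hl φ
    _ = _ := by simp [mul_assoc]

/-- Families `L(s)` of functionals on segments for which `x' = L(t) x_t` is well posed in `ℍ`, with the
constant `κ` controlling the norms and the energy estimate. -/
structure DelayCoeff (κ : ℝ) (L : ℝ → C(Hist τ, RVec n) →L[ℝ] RVec n) : Prop where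
  nonneg : 0 ≤ κ
  continuous : Continuous fun q : ℝ × C(Hist τ, RVec n) => L q.1 q.2
  norm_le : ∀ s φ, ‖L s φ‖ ≤ κ * ‖φ‖
  energy : ∀ (a : ℝ) (x : C(ℝ, RVec n)) (t : ℝ), 0 ≤ t →
    ∫ s in 0..t, ‖L (a + s) (seg τ x s)‖ ^ 2 ≤ κ * ∫ s in (-τ)..t, ‖x s‖ ^ 2

theorem DelayCoeff.shift {κ : ℝ} {L : ℝ → C(Hist τ, RVec n) →L[ℝ] RVec n} (h : DelayCoeff κ L)
    (a : ℝ) : DelayCoeff κ fun s => L (a + s) where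
  nonneg := h.nonneg
  continuous := h.continuous.comp (by fun_prop : Continuous fun q : ℝ × C(Hist τ, RVec n) => (a + q.1, q.2))
  norm_le s := h.norm_le _
  energy b x t ht := by simpa [add_assoc] using h.energy (a + b) x t ht

theorem DelayCoeff.continuous_seg {κ : ℝ} {L : ℝ → C(Hist τ, RVec n) →L[ℝ] RVec n}
    (h : DelayCoeff κ L) (x : C(ℝ, RVec n)) : Continuous fun s => L s (seg τ x s) :=
  h.continuous.comp (continuous_id.prodMk (DelayCompound.continuous_seg x))

/-- The constant `κ` for `Ã + N(s) C` with `‖Ã‖ ≤ a`, `‖C‖ ≤ c`, `‖N(s)‖ ≤ Λ` and `dim 𝕄 = d`. -/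
def delayConst (n d : ℕ) (a c Λ : ℝ) : ℝ :=
  a + Λ * c + (2 * (n * a ^ 2) + 2 * (Λ ^ 2 * (d * c ^ 2)))

/-- The time-dependent factor N(s) acts after C, so it is bounded by Λ pointwise and the energy
estimates are needed only for the time-independent operators Ã and C. In `delayConst` the summands a
+ Λc serve the norm bound, the other two the energy bound via (u + v)² ≤ 2u² + 2v². -/
theorem delayCoeff_perturbed {M : Type*} [NormedAddCommGroup M] [InnerProductSpace ℝ M]
    [FiniteDimensional ℝ M] {Atil : C(Hist τ, RVec n) →L[ℝ] RVec n}
    {C : C(Hist τ, RVec n) →L[ℝ] M} {N : ℝ → M →L[ℝ] RVec n} {a c Λ : ℝ} (ha : 0 ≤ a) (hc : 0 ≤ c)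
    (hA : ∀ φ, ‖Atil φ‖ ≤ a * ‖φ‖) (hC : ∀ φ, ‖C φ‖ ≤ c * ‖φ‖) (hN : Continuous N)
    (hΛ : ∀ s, ‖N s‖ ≤ Λ) :
    DelayCoeff (delayConst n (Module.finrank ℝ M) a c Λ) fun s => Atil + N s ∘L C := by
  have hΛ0 : 0 ≤ Λ := (norm_nonneg _).trans (hΛ 0)
  have hle : ∀ s φ, ‖(Atil + N s ∘L C) φ‖ ≤ ‖Atil φ‖ + Λ * ‖C φ‖ := fun s φ =>
    (norm_add_le _ _).trans (add_le_add_right (((N s).le_opNorm _).trans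
      (mul_le_mul_of_nonneg_right (hΛ s) (norm_nonneg _))) _)
  have hcont : Continuous fun q : ℝ × C(Hist τ, RVec n) => (Atil + N q.1 ∘L C) q.2 :=
    (Atil.continuous.comp continuous_snd).add
      ((hN.comp continuous_fst).clm_apply (C.continuous.comp continuous_snd))
  refine ⟨by unfold delayConst; positivity, hcont, fun s φ => ?_, fun b x t ht => ?_⟩
  · refine (hle s φ).trans ?_
    have h1 := hA φ
    have h2 := mul_le_mul_of_nonneg_left (hC φ) hΛ0
    have h3 : 0 ≤ (2 * (n * a ^ 2) + 2 * (Λ ^ 2 * (Module.finrank ℝ M * c ^ 2))) * ‖φ‖ := by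
      positivity
    unfold delayConst
    linarith
  · have hτ0 := hτ.out
    have hX : 0 ≤ ∫ s in (-τ)..t, ‖x s‖ ^ 2 :=
      intervalIntegral.integral_nonneg (by linarith) fun _ _ => by positivity
    have hseg := continuous_seg (τ := τ) x
    have h1 := integral_sq_operator_seg_le Atil ha hA x ht
    have h2 := integral_sq_operator_seg_le C hc hC x ht
    rw [finrank_euclideanSpace_fin] at h1
    have i1 : Continuous fun s => ‖Atil (seg τ x s)‖ ^ 2 := by fun_prop
    have i2 : Continuous fun s => ‖C (seg τ x s)‖ ^ 2 := by fun_prop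
    calc ∫ s in 0..t, ‖(Atil + N (b + s) ∘L C) (seg τ x s)‖ ^ 2
        ≤ ∫ s in 0..t, (2 * ‖Atil (seg τ x s)‖ ^ 2 + (2 * Λ ^ 2) * ‖C (seg τ x s)‖ ^ 2) := by
          refine intervalIntegral.integral_mono_on ht ?_ ?_ fun s _ => ?_
          · have : Continuous fun s => (Atil + N (b + s) ∘L C) (seg τ x s) :=
              hcont.comp ((continuous_const.add continuous_id).prodMk hseg)
            exact (this.norm.pow 2).intervalIntegrable _ _
          · exact ((i1.const_mul 2).add (i2.const_mul _)).intervalIntegrable _ _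
          · refine (pow_le_pow_left₀ (norm_nonneg _) (hle (b + s) (seg τ x s)) 2).trans ?_
            nlinarith [sq_nonneg (‖Atil (seg τ x s)‖ - Λ * ‖C (seg τ x s)‖)]
      _ = 2 * (∫ s in 0..t, ‖Atil (seg τ x s)‖ ^ 2) +
            (2 * Λ ^ 2) * ∫ s in 0..t, ‖C (seg τ x s)‖ ^ 2 := by
          rw [intervalIntegral.integral_add, intervalIntegral.integral_const_mul,
            intervalIntegral.integral_const_mul]
          · exact (i1.const_mul 2).intervalIntegrable _ _
          · exact (i2.const_mul _).intervalIntegrable _ _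
      _ ≤ 2 * ((n * a ^ 2) * ∫ s in (-τ)..t, ‖x s‖ ^ 2) +
            (2 * Λ ^ 2) * ((Module.finrank ℝ M * c ^ 2) * ∫ s in (-τ)..t, ‖x s‖ ^ 2) := by
          gcongr
      _ ≤ delayConst n (Module.finrank ℝ M) a c Λ * ∫ s in (-τ)..t, ‖x s‖ ^ 2 := by
          have h4 : 0 ≤ (a + Λ * c) * ∫ s in (-τ)..t, ‖x s‖ ^ 2 := by positivity
          unfold delayConst
          nlinarith

end Energy

/-! ### Trajectories of `x' = L(t) x_t` -/

section Trajectories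

variable {n : ℕ} {κ : ℝ} {L : ℝ → C(Hist τ, RVec n) →L[ℝ] RVec n}

/-- `x` solves `x'(t) = L(t) x_t` for `t ≥ 0`. -/
def IsTraj (L : ℝ → C(Hist τ, RVec n) →L[ℝ] RVec n) (x : C(ℝ, RVec n)) : Prop :=
  ∀ t, 0 ≤ t → x t = x 0 + ∫ s in 0..t, L s (seg τ x s)

theorem IsTraj.shift (hL : DelayCoeff κ L) {x : C(ℝ, RVec n)} (hx : IsTraj L x) {a : ℝ}
    (ha : 0 ≤ a) : IsTraj (fun s => L (a + s)) (shift x a) := by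
  intro t ht
  have hc := hL.continuous_seg x
  simp only [shift_apply, seg_shift, add_zero]
  rw [hx _ (add_nonneg ha ht), hx a ha,
    intervalIntegral.integral_comp_add_left (fun s => L s (seg τ x s)), add_assoc, add_zero,
    intervalIntegral.integral_add_adjacent_intervals (hc.intervalIntegrable _ _)
      (hc.intervalIntegrable _ _)]

theorem IsTraj.add (hL : DelayCoeff κ L) {x y : C(ℝ, RVec n)} (hx : IsTraj L x)
    (hy : IsTraj L y) : IsTraj L (x + y) := by
  intro t ht
  simp only [ContinuousMap.add_apply, seg_add, map_add]
  rw [hx t ht, hy t ht, intervalIntegral.integral_add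
    ((hL.continuous_seg x).intervalIntegrable _ _) ((hL.continuous_seg y).intervalIntegrable _ _)]
  abel

theorem IsTraj.sub (hL : DelayCoeff κ L) {x y : C(ℝ, RVec n)} (hx : IsTraj L x)
    (hy : IsTraj L y) : IsTraj L (x - y) := by
  intro t ht
  simp only [ContinuousMap.sub_apply, seg_sub, map_sub]
  rw [hx t ht, hy t ht, intervalIntegral.integral_sub
    ((hL.continuous_seg x).intervalIntegrable _ _) ((hL.continuous_seg y).intervalIntegrable _ _)]
  abel

theorem IsTraj.smul {x : C(ℝ, RVec n)} (hx : IsTraj L x) (c : ℝ) : IsTraj L (c • x) := by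
  intro t ht
  simp only [ContinuousMap.smul_apply, seg_smul, map_smul]
  rw [hx t ht, intervalIntegral.integral_smul, smul_add]

/-- The growth bound of the solution operators. -/
def growth (κ t : ℝ) : ℝ := 3 * (1 + κ) * Real.exp ((1 + κ) * t)

theorem one_le_growth (hκ : 0 ≤ κ) {t : ℝ} (ht : 0 ≤ t) : 1 ≤ growth κ t := by
  have : 1 ≤ Real.exp ((1 + κ) * t) := Real.one_le_exp (by positivity)
  unfold growth
  nlinarith

theorem growth_mono (hκ : 0 ≤ κ) {s t : ℝ} (h : s ≤ t) : growth κ s ≤ growth κ t := by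
  unfold growth
  gcongr

/-- The derivative of |x|² is at most |x|² + |L(s)x_s|², and the energy estimate turns its integral
into |x(t)|² ≤ W(t) = A + (1 + κ)∫₀ᵗ |x|², where A collects the initial data. As W' ≤ (1 + κ)W,
Gronwall applies. Both summands on the left are bounded by W(t), hence the factor 2. -/
theorem IsTraj.norm_sq_le (hL : DelayCoeff κ L) {x : C(ℝ, RVec n)} (hx : IsTraj L x) {t : ℝ}
    (ht : 0 ≤ t) :
    ‖x t‖ ^ 2 + (1 + κ) * ∫ s in 0..t, ‖x s‖ ^ 2 ≤
      2 * (1 + κ) * Real.exp ((1 + κ) * t) * ‖embC τ n (seg τ x 0)‖ ^ 2 := by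
  have hκ := hL.nonneg
  have hτ0 := hτ.out
  have hg := hL.continuous_seg x
  have hx2 : Continuous fun s => ‖x s‖ ^ 2 := by fun_prop
  have hg2 : Continuous fun s => ‖L s (seg τ x s)‖ ^ 2 := hg.norm.pow 2
  -- The integral equation holds only for t ≥ 0; F coincides with x there and is differentiable on
  -- the whole line.
  set F : ℝ → RVec n := fun t => x 0 + ∫ s in 0..t, L s (seg τ x s) with hF
  have hFd : ∀ t, HasDerivAt F (L t (seg τ x t)) t := fun t =>
    (hg.integral_hasStrictDerivAt 0 t).hasDerivAt.const_add _
  have hFx : ∀ t, 0 ≤ t → F t = x t := fun t ht => (hx t ht).symm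
  have hFc : Continuous F := continuous_iff_continuousAt.2 fun t => (hFd t).continuousAt
  set A := ‖x 0‖ ^ 2 + κ * ∫ s in (-τ)..0, ‖x s‖ ^ 2 with hA
  have hA0 : 0 ≤ ∫ s in (-τ)..0, ‖x s‖ ^ 2 :=
    intervalIntegral.integral_nonneg (by linarith) fun _ _ => by positivity
  have hAle : A ≤ (1 + κ) * ‖embC τ n (seg τ x 0)‖ ^ 2 := by
    rw [norm_sq_embC_seg, zero_sub]
    nlinarith [sq_nonneg ‖x 0‖]
  have key : ∀ t, 0 ≤ t → ‖x t‖ ^ 2 ≤ A + (1 + κ) * ∫ s in 0..t, ‖x s‖ ^ 2 := by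
    intro t ht
    have hd : ∀ s ∈ uIcc 0 t, HasDerivAt (fun s => ‖F s‖ ^ 2) (2 * inner ℝ (F s) (L s (seg τ x s))) s :=
      fun s _ => (hFd s).norm_sq
    have hi : Continuous fun s => 2 * inner ℝ (F s) (L s (seg τ x s)) :=
      continuous_const.mul (hFc.inner hg)
    have e := intervalIntegral.integral_eq_sub_of_hasDerivAt hd (hi.intervalIntegrable _ _)
    rw [hFx t ht, hFx 0 le_rfl] at e
    have hle : ∫ s in 0..t, 2 * inner ℝ (F s) (L s (seg τ x s)) ≤
        ∫ s in 0..t, (‖x s‖ ^ 2 + ‖L s (seg τ x s)‖ ^ 2) := by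
      refine intervalIntegral.integral_mono_on ht (hi.intervalIntegrable _ _)
        ((hx2.add hg2).intervalIntegrable _ _) fun s hs => ?_
      rw [hFx s hs.1]
      have := real_inner_le_norm (x s) (L s (seg τ x s))
      nlinarith [sq_nonneg (‖x s‖ - ‖L s (seg τ x s)‖)]
    rw [intervalIntegral.integral_add (hx2.intervalIntegrable _ _)
      (hg2.intervalIntegrable _ _)] at hle
    have hen := hL.energy 0 x t ht
    simp only [zero_add] at hen
    rw [← intervalIntegral.integral_add_adjacent_intervals (hx2.intervalIntegrable (-τ) 0)
      (hx2.intervalIntegrable 0 t)] at hen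
    rw [hA]
    linarith
  set W : ℝ → ℝ := fun t => A + (1 + κ) * ∫ s in 0..t, ‖x s‖ ^ 2 with hW
  have hWd : ∀ t, HasDerivAt W ((1 + κ) * ‖x t‖ ^ 2) t := fun t =>
    ((hx2.integral_hasStrictDerivAt 0 t).hasDerivAt.const_mul _).const_add _
  have hAnn : 0 ≤ A := by positivity
  have hWA : ∀ t, 0 ≤ t → A ≤ W t := fun t ht => by
    have : 0 ≤ ∫ s in 0..t, ‖x s‖ ^ 2 :=
      intervalIntegral.integral_nonneg ht fun _ _ => by positivity
    simp only [hW]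
    nlinarith
  have gr := norm_le_gronwallBound_of_norm_deriv_right_le (f := W) (f' := fun t => (1 + κ) * ‖x t‖ ^ 2)
    (δ := A) (K := 1 + κ) (ε := 0) (a := 0) (b := t)
    (fun s _ => (hWd s).continuousAt.continuousWithinAt) (fun s _ => (hWd s).hasDerivWithinAt)
    (by simp [hW, abs_of_nonneg hAnn]) (fun s hs => by
      have h1 := key s hs.1
      rw [Real.norm_of_nonneg (by positivity), Real.norm_of_nonneg (hAnn.trans (hWA s hs.1)), add_zero]
      exact mul_le_mul_of_nonneg_left h1 (by positivity)) t ⟨ht, le_rfl⟩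
  rw [gronwallBound_ε0, sub_zero, Real.norm_of_nonneg (hAnn.trans (hWA t ht))] at gr
  have hfin : W t ≤ (1 + κ) * ‖embC τ n (seg τ x 0)‖ ^ 2 * Real.exp ((1 + κ) * t) :=
    gr.trans (mul_le_mul_of_nonneg_right hAle (Real.exp_pos _).le)
  have h1 := key t ht
  have h2 : (1 + κ) * ∫ s in 0..t, ‖x s‖ ^ 2 ≤ W t := by simp only [hW]; linarith
  change ‖x t‖ ^ 2 ≤ W t at h1
  linarith

/-- The squared ℍ-norm of x_t is |x(t)|² plus an integral over [t - τ, t], which is covered by the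
initial interval and [0, t]. The initial part costs one more multiple of the initial norm, which
makes the 2 of `IsTraj.norm_sq_le` the 3 in `growth`. -/
theorem IsTraj.norm_embC_le (hL : DelayCoeff κ L) {x : C(ℝ, RVec n)} (hx : IsTraj L x) {t : ℝ}
    (ht : 0 ≤ t) : ‖embC τ n (seg τ x t)‖ ≤ growth κ t * ‖embC τ n (seg τ x 0)‖ := by
  have hκ := hL.nonneg
  have hτ0 := hτ.out
  have hx2 : Continuous fun s => ‖x s‖ ^ 2 := by fun_prop
  have h1 := hx.norm_sq_le hL ht
  have hg := one_le_growth hκ ht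
  refine abs_le_of_sq_le_sq' ?_ (by positivity) |>.2
  have h2 : ∫ s in (t - τ)..t, ‖x s‖ ^ 2 ≤
      (∫ s in (-τ)..0, ‖x s‖ ^ 2) + ∫ s in 0..t, ‖x s‖ ^ 2 := by
    rw [intervalIntegral.integral_add_adjacent_intervals (hx2.intervalIntegrable _ _)
      (hx2.intervalIntegrable _ _)]
    exact intervalIntegral.integral_mono_interval (by linarith) (by linarith) le_rfl
      (ae_of_all _ fun _ => by positivity) (hx2.intervalIntegrable _ _)
  have h3 := norm_sq_embC_seg (τ := τ) x 0
  rw [zero_sub] at h3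
  have h4 : 0 ≤ ∫ s in 0..t, ‖x s‖ ^ 2 :=
    intervalIntegral.integral_nonneg ht fun _ _ => by positivity
  have h5 : 1 ≤ (1 + κ) * Real.exp ((1 + κ) * t) := by
    have : 1 ≤ Real.exp ((1 + κ) * t) := Real.one_le_exp (by positivity)
    nlinarith
  set E := ‖embC τ n (seg τ x 0)‖ ^ 2
  have hE : 0 ≤ E := sq_nonneg _
  calc ‖embC τ n (seg τ x t)‖ ^ 2 ≤ growth κ t * E := by
        rw [norm_sq_embC_seg]
        have h6 : 0 ≤ ‖x 0‖ ^ 2 := by positivity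
        have h7 : E ≤ (1 + κ) * Real.exp ((1 + κ) * t) * E := le_mul_of_one_le_left hE h5
        have h8 : 0 ≤ κ * ∫ s in 0..t, ‖x s‖ ^ 2 := by positivity
        unfold growth
        linarith
    -- The squared norms are compared with the factor `growth`, which is at least 1 and so at most
    -- its own square.
    _ ≤ (growth κ t * ‖embC τ n (seg τ x 0)‖) ^ 2 := by
        rw [mul_pow]
        refine mul_le_mul_of_nonneg_right ?_ hE
        nlinarith

theorem IsTraj.norm_le (hL : DelayCoeff κ L) {x : C(ℝ, RVec n)} (hx : IsTraj L x) {t : ℝ}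
    (ht : 0 ≤ t) : ‖x t‖ ≤ growth κ t * ‖embC τ n (seg τ x 0)‖ := by
  refine le_trans ?_ (hx.norm_embC_le hL ht)
  have := norm_sq_embC_seg (τ := τ) x t
  have h0 : 0 ≤ ∫ s in (t - τ)..t, ‖x s‖ ^ 2 :=
    intervalIntegral.integral_nonneg (by linarith [hτ.out]) fun _ _ => by positivity
  exact abs_le_of_sq_le_sq' (by linarith) (norm_nonneg _) |>.2

theorem IsTraj.eq_of_seg_eq (hL : DelayCoeff κ L) {x y : C(ℝ, RVec n)} (hx : IsTraj L x)
    (hy : IsTraj L y) (h : seg τ x 0 = seg τ y 0) {t : ℝ} (ht : 0 ≤ t) :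
    seg τ x t = seg τ y t := by
  have := (hx.sub hL hy).norm_embC_le hL ht
  rw [seg_sub, seg_sub, h, sub_self, map_zero, norm_zero, mul_zero, norm_le_zero_iff, map_sub] at this
  exact embC_injective (sub_eq_zero.1 this)

/-- The contraction estimate in the weighted norm. The weight is increasing, so a segment at time s
is controlled by the weight at s, and integrating κ e^{(2κ+1)s} yields the factor κ/(2κ+1) < 1/2. -/
theorem norm_integral_coeff_seg_le (hL : DelayCoeff κ L) {x : C(ℝ, RVec n)} {D : ℝ} (hD : 0 ≤ D)
    (hx : ∀ r, -τ ≤ r → ‖x r‖ ≤ D * Real.exp ((2 * κ + 1) * r)) {t : ℝ} (ht : 0 ≤ t) :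
    ‖∫ s in 0..t, L s (seg τ x s)‖ ≤ D / 2 * Real.exp ((2 * κ + 1) * t) := by
  have hκ := hL.nonneg
  have hc : Continuous fun s : ℝ => κ * (D * Real.exp ((2 * κ + 1) * s)) := by fun_prop
  have h1 : ‖∫ s in 0..t, L s (seg τ x s)‖ ≤
      ∫ s in 0..t, κ * (D * Real.exp ((2 * κ + 1) * s)) := by
    refine intervalIntegral.norm_integral_le_of_norm_le ht (ae_of_all _ fun s hs => ?_)
      (hc.intervalIntegrable _ _)
    refine (hL.norm_le _ _).trans (mul_le_mul_of_nonneg_left ?_ hκ)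
    refine (ContinuousMap.norm_le _ (by positivity)).2 fun θ => ?_
    refine (hx _ (by linarith [θ.2.1, hs.1])).trans ?_
    gcongr
    linarith [θ.2.2]
  have hd : ∀ s ∈ uIcc 0 t, HasDerivAt
      (fun s => κ * D / (2 * κ + 1) * Real.exp ((2 * κ + 1) * s))
      (κ * (D * Real.exp ((2 * κ + 1) * s))) s := by
    intro s _
    have := (((hasDerivAt_id s).const_mul (2 * κ + 1)).exp).const_mul (κ * D / (2 * κ + 1))
    refine this.congr_deriv ?_
    have : 2 * κ + 1 ≠ 0 := by positivity
    simp only [id]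
    field_simp
  rw [intervalIntegral.integral_eq_sub_of_hasDerivAt hd (hc.intervalIntegrable _ _)] at h1
  have h2 : κ * D / (2 * κ + 1) ≤ D / 2 := by
    rw [div_le_div_iff₀ (by positivity) (by positivity)]
    nlinarith
  have h3 : 0 ≤ κ * D / (2 * κ + 1) * Real.exp ((2 * κ + 1) * 0) := by positivity
  have h4 := mul_le_mul_of_nonneg_right h2 (Real.exp_pos ((2 * κ + 1) * t)).le
  linarith

open BoundedContinuousFunction in
-- Picard iteration on the whole half-line at once: in the norm weighted by e^{ρt} the Volterra
-- operator is a contraction with constant 1/2, so no continuation from short intervals is needed.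
theorem exists_isTraj (hL : DelayCoeff κ L) (φ : C(Hist τ, RVec n)) :
    ∃ x : C(ℝ, RVec n), seg τ x 0 = φ ∧ IsTraj L x := by
  have hκ := hL.nonneg
  have hτ0 := hτ.out
  set ρ := 2 * κ + 1 with hρ
  have hρ0 : 0 < ρ := by positivity
  -- A bounded z stands for the function e^{ρt} z(t). The maximum freezes the weight to the left of
  -- -τ, where the values do not matter, and keeps its inverse bounded.
  set unw : (ℝ →ᵇ RVec n) → C(ℝ, RVec n) := fun z =>
    ⟨fun t => Real.exp (ρ * max t (-τ)) • z t, by fun_prop⟩ with hunw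
  have hunw_le : ∀ (z w : ℝ →ᵇ RVec n) (r : ℝ), -τ ≤ r →
      ‖(unw z - unw w) r‖ ≤ dist z w * Real.exp (ρ * r) := by
    intro z w r hr
    simp only [hunw, ContinuousMap.sub_apply, ContinuousMap.coe_mk, max_eq_left hr]
    rw [← smul_sub, norm_smul, Real.norm_of_nonneg (Real.exp_pos _).le, mul_comm, ← dist_eq_norm]
    exact mul_le_mul_of_nonneg_right (dist_coe_le_dist _) (Real.exp_pos _).le
  -- The integral is cut off to 0 for t ≤ 0, so every iterate has the initial segment φ once the
  -- weight is removed.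
  set V : C(ℝ, RVec n) → ℝ → RVec n := fun x t => ∫ s in 0..(max t 0), L s (seg τ x s) with hV
  have hVc : ∀ x, Continuous (V x) := fun x =>
    (continuous_iff_continuousAt.2 fun t =>
      ((hL.continuous_seg x).integral_hasStrictDerivAt 0 t).hasDerivAt.continuousAt).comp (continuous_id.max continuous_const)
  have hVdiff : ∀ (z w : ℝ →ᵇ RVec n) t,
      ‖V (unw z) t - V (unw w) t‖ ≤ dist z w / 2 * Real.exp (ρ * max t 0) := by
    intro z w t
    simp only [hV]
    rw [← intervalIntegral.integral_sub ((hL.continuous_seg _).intervalIntegrable _ _)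
      ((hL.continuous_seg _).intervalIntegrable _ _)]
    have := norm_integral_coeff_seg_le hL dist_nonneg (hunw_le z w) (le_max_right t 0)
    simpa only [seg_sub, map_sub] using this
  have hV0 : ∀ t, V (unw 0) t = 0 := by
    intro t
    have h0 : unw 0 = 0 := by ext1 t; simp [hunw]
    have hs : ∀ s, seg τ (0 : C(ℝ, RVec n)) s = 0 := fun s => rfl
    simp only [hV, h0, hs, map_zero, intervalIntegral.integral_zero]
  have hexp : ∀ t, Real.exp (-(ρ * max t (-τ))) * Real.exp (ρ * max t 0) ≤ Real.exp (ρ * τ) := by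
    intro t
    rw [← Real.exp_add]
    refine Real.exp_le_exp.2 ?_
    rcases le_total 0 t with h | h
    · rw [max_eq_left h, max_eq_left (by linarith)]
      nlinarith
    · rw [max_eq_right h]
      nlinarith [le_max_right t (-τ)]
  have hexp' : ∀ t, Real.exp (-(ρ * max t (-τ))) ≤ Real.exp (ρ * τ) := fun t =>
    Real.exp_le_exp.2 (by nlinarith [le_max_right t (-τ)])
  set Γ : (ℝ →ᵇ RVec n) → (ℝ →ᵇ RVec n) := fun z =>
    BoundedContinuousFunction.ofNormedAddCommGroup
      (fun t => Real.exp (-(ρ * max t (-τ))) • (constExt φ t + V (unw z) t))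
      (by have := hVc (unw z); fun_prop)
      (Real.exp (ρ * τ) * ‖φ‖ + Real.exp (ρ * τ) * (dist z 0 / 2)) (by
        intro t
        rw [smul_add]
        refine (norm_add_le _ _).trans (add_le_add ?_ ?_)
        · rw [norm_smul, Real.norm_of_nonneg (Real.exp_pos _).le]
          exact mul_le_mul (hexp' t) (norm_constExt_le φ t) (norm_nonneg _) (Real.exp_pos _).le
        · rw [norm_smul, Real.norm_of_nonneg (Real.exp_pos _).le]
          have h1 := hVdiff z 0 t
          rw [hV0, sub_zero] at h1
          have h2 := mul_le_mul_of_nonneg_left h1 (Real.exp_pos (-(ρ * max t (-τ)))).le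
          have h3 := mul_le_mul_of_nonneg_right (hexp t) (by positivity : 0 ≤ dist z 0 / 2)
          linarith) with hΓ
  have hΓa : ∀ z t, Γ z t = Real.exp (-(ρ * max t (-τ))) • (constExt φ t + V (unw z) t) :=
    fun z t => rfl
  have hcontr : ContractingWith (1 / 2) Γ := by
    refine ⟨by rw [← NNReal.coe_lt_coe]; norm_num, LipschitzWith.of_dist_le_mul fun z w => ?_⟩
    refine (BoundedContinuousFunction.dist_le (by positivity)).2 fun t => ?_
    rw [hΓa, hΓa, dist_eq_norm, ← smul_sub, add_sub_add_left_eq_sub, norm_smul,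
      Real.norm_of_nonneg (Real.exp_pos _).le]
    rcases le_total 0 t with h | h
    · have h1 := hVdiff z w t
      rw [max_eq_left h] at h1
      rw [max_eq_left (by linarith)]
      calc _ ≤ Real.exp (-(ρ * t)) * (dist z w / 2 * Real.exp (ρ * t)) := by gcongr
        _ = dist z w / 2 * (Real.exp (-(ρ * t)) * Real.exp (ρ * t)) := by ring
        _ = _ := by rw [← Real.exp_add]; simp; ring
    · simp only [hV, max_eq_right h, intervalIntegral.integral_same, sub_zero, norm_zero, mul_zero]
      positivity
  obtain ⟨z, hz⟩ : ∃ z, Γ z = z := ⟨hcontr.fixedPoint, hcontr.fixedPoint_isFixedPt⟩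
  have hx : ∀ t, unw z t = constExt φ t + V (unw z) t := by
    intro t
    have h1 : unw z t = Real.exp (ρ * max t (-τ)) • z t := rfl
    rw [h1, ← hz, hΓa, smul_smul, ← Real.exp_add, hz]
    simp
  refine ⟨unw z, ?_, fun t ht => ?_⟩
  · ext1 θ
    rw [seg_apply, zero_add, hx, constExt_of_mem]
    simp [hV, max_eq_right θ.2.2]
  · rw [hx t, hx 0, constExt_of_nonneg _ ht, constExt_of_nonneg _ le_rfl]
    simp [hV, max_eq_left ht]

end Trajectories

/-! ### Solution operators on `ℍ` -/

section Evolution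

variable {n : ℕ} {κ : ℝ} {L : ℝ → C(Hist τ, RVec n) →L[ℝ] RVec n}

open Classical in
/-- The solution operator of `x' = L(t) x_t` from time `0` to time `t`, extended to `ℍ`. -/
def evol (L : ℝ → C(Hist τ, RVec n) →L[ℝ] RVec n) (t : ℝ) : HSpace τ n →L[ℝ] HSpace τ n :=
  if h : ∃ U : HSpace τ n →L[ℝ] HSpace τ n,
      ∀ x, IsTraj L x → U (embC τ n (seg τ x 0)) = embC τ n (seg τ x t) then h.choose else 0

/-- On continuous initial data the map φ ↦ x_t is linear by uniqueness of trajectories, and it is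
bounded in the norm of ℍ by `IsTraj.norm_embC_le`. It therefore extends from the dense subspace of
continuous functions. -/
theorem exists_evol (hL : DelayCoeff κ L) {t : ℝ} (ht : 0 ≤ t) :
    ∃ U : HSpace τ n →L[ℝ] HSpace τ n,
      ∀ x, IsTraj L x → U (embC τ n (seg τ x 0)) = embC τ n (seg τ x t) := by
  choose X hX0 hX using exists_isTraj hL
  have hadd : ∀ φ ψ, seg τ (X (φ + ψ)) t = seg τ (X φ) t + seg τ (X ψ) t := fun φ ψ =>
    (hX _).eq_of_seg_eq hL ((hX φ).add hL (hX ψ)) (by rw [seg_add, hX0, hX0, hX0]) ht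
  have hsmul : ∀ (c : ℝ) φ, seg τ (X (c • φ)) t = c • seg τ (X φ) t := fun c φ =>
    (hX _).eq_of_seg_eq hL ((hX φ).smul c) (by rw [seg_smul, hX0, hX0]) ht
  let f : C(Hist τ, RVec n) →ₗ[ℝ] HSpace τ n :=
    { toFun := fun φ => embC τ n (seg τ (X φ) t)
      map_add' := fun φ ψ => by rw [hadd, map_add]
      map_smul' := fun c φ => by rw [hsmul, map_smul, RingHom.id_apply] }
  refine ⟨f.extendOfNorm (embC τ n).toLinearMap, fun x hx => ?_⟩
  have := LinearMap.extendOfNorm_eq (f := f) (e := (embC τ n).toLinearMap) denseRange_embC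
    ⟨growth κ t, fun φ => by
      have := (hX φ).norm_embC_le hL ht
      rwa [hX0] at this⟩ (seg τ x 0)
  refine this.trans ?_
  exact congrArg (embC τ n) ((hX _).eq_of_seg_eq hL hx (hX0 _) ht)

theorem evol_apply (hL : DelayCoeff κ L) {x : C(ℝ, RVec n)} (hx : IsTraj L x) {t : ℝ} (ht : 0 ≤ t) :
    evol L t (embC τ n (seg τ x 0)) = embC τ n (seg τ x t) := by
  rw [evol, dif_pos (exists_evol hL ht)]
  exact (exists_evol hL ht).choose_spec x hx

theorem dense_induction_embC {p : HSpace τ n → Prop} (hc : IsClosed {v | p v})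
    (h : ∀ φ, p (embC τ n φ)) (v : HSpace τ n) : p v :=
  denseRange_embC.induction_on v hc h

theorem norm_evol_apply_le (hL : DelayCoeff κ L) {t : ℝ} (ht : 0 ≤ t) (v : HSpace τ n) :
    ‖evol L t v‖ ≤ growth κ t * ‖v‖ := by
  refine dense_induction_embC (p := fun v => ‖evol L t v‖ ≤ growth κ t * ‖v‖)
    (isClosed_le (by fun_prop) (by fun_prop)) (fun φ => ?_) v
  obtain ⟨x, rfl, hx⟩ := exists_isTraj hL φ
  rw [evol_apply hL hx ht]
  exact hx.norm_embC_le hL ht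

theorem evol_zero (hL : DelayCoeff κ L) (v : HSpace τ n) : evol L 0 v = v := by
  refine dense_induction_embC (p := fun v => evol L 0 v = v)
    (isClosed_eq (by fun_prop) (by fun_prop)) (fun φ => ?_) v
  obtain ⟨x, rfl, hx⟩ := exists_isTraj hL φ
  exact evol_apply hL hx le_rfl

theorem evol_add (hL : DelayCoeff κ L) {s t : ℝ} (hs : 0 ≤ s) (ht : 0 ≤ t) (v : HSpace τ n) :
    evol L (s + t) v = evol (fun r => L (s + r)) t (evol L s v) := by
  refine dense_induction_embC
    (p := fun v => evol L (s + t) v = evol (fun r => L (s + r)) t (evol L s v))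
    (isClosed_eq (by fun_prop) (by fun_prop)) (fun φ => ?_) v
  obtain ⟨x, rfl, hx⟩ := exists_isTraj hL φ
  rw [evol_apply hL hx (add_nonneg hs ht), evol_apply hL hx hs]
  have := evol_apply (hL.shift s) (hx.shift hL hs) ht
  simp only [seg_shift, add_zero] at this
  exact this.symm

/-- For continuous initial data the orbit is a continuous curve of segments. The general case
follows by density, since the growth bound is uniform on [0, t + 1]. -/
theorem continuousOn_evol (hL : DelayCoeff κ L) (v : HSpace τ n) :
    ContinuousOn (fun t => evol L t v) (Ici 0) := by
  have hκ := hL.nonneg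
  intro t ht
  rw [Metric.continuousWithinAt_iff]
  intro ε hε
  have hg : 0 < growth κ (t + 1) := one_pos.trans_le (one_le_growth hκ (add_nonneg ht zero_le_one))
  obtain ⟨φ, hφ⟩ := denseRange_embC.exists_dist_lt v (ε := ε / (4 * growth κ (t + 1))) (by positivity)
  obtain ⟨x, rfl, hx⟩ := exists_isTraj hL φ
  have hc : Continuous fun s => embC τ n (seg τ x s) := by
    have := continuous_seg (τ := τ) x
    fun_prop
  obtain ⟨δ, hδ, h⟩ := Metric.continuous_iff.1 hc t (ε / 2) (by positivity)
  have hclose : ∀ s, 0 ≤ s → s ≤ t + 1 → ‖evol L s v - evol L s (embC τ n (seg τ x 0))‖ ≤ ε / 4 := by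
    intro s hs hst
    rw [← map_sub]
    refine (norm_evol_apply_le hL hs _).trans ?_
    rw [← dist_eq_norm]
    calc _ ≤ growth κ (t + 1) * (ε / (4 * growth κ (t + 1))) :=
          mul_le_mul (growth_mono hκ hst) hφ.le dist_nonneg hg.le
      _ = ε / 4 := by field_simp
  refine ⟨min δ 1, by positivity, fun s hs hd => ?_⟩
  have h1 : s ≤ t + 1 := by
    have := (abs_lt.1 (hd.trans_le (min_le_right _ _))).2
    linarith
  have e1 := hclose s hs h1
  have e2 := hclose t ht (by linarith)
  have e3 := h s (hd.trans_le (min_le_left _ _))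
  rw [evol_apply hL hx hs] at e1
  rw [evol_apply hL hx ht] at e2
  rw [dist_eq_norm] at e3 ⊢
  calc ‖evol L s v - evol L t v‖ = ‖(evol L s v - embC τ n (seg τ x s)) -
        (evol L t v - embC τ n (seg τ x t)) + (embC τ n (seg τ x s) - embC τ n (seg τ x t))‖ := by
          congr 1; abel
    _ ≤ ‖evol L s v - embC τ n (seg τ x s)‖ + ‖evol L t v - embC τ n (seg τ x t)‖ +
        ‖embC τ n (seg τ x s) - embC τ n (seg τ x t)‖ :=
          (norm_add_le _ _).trans (add_le_add_left (norm_sub_le _ _) _)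
    _ < ε := by linarith

/-- Up to time 0 the trajectory and the constant extension agree; afterwards they differ by an
integral over an interval of length at most h. The bound depends on L only through κ, which is what
makes the continuity in `evol_uniform_continuity` uniform. -/
theorem IsTraj.norm_seg_sub_constExt_le (hL : DelayCoeff κ L) {x : C(ℝ, RVec n)} (hx : IsTraj L x)
    {h : ℝ} (h0 : 0 ≤ h) (h1 : h ≤ 1) :
    ‖seg τ x h - seg τ (constExt (seg τ x 0)) h‖ ≤
      κ * (growth κ 1 * ‖embC τ n (seg τ x 0)‖ + ‖seg τ x 0‖) * h := by
  have hκ := hL.nonneg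
  have hτ0 := hτ.out
  have hg := one_le_growth hκ zero_le_one
  set B := growth κ 1 * ‖embC τ n (seg τ x 0)‖ + ‖seg τ x 0‖ with hB
  have hneg : ∀ r (h1 : -τ ≤ r) (h2 : r ≤ 0), x r = seg τ x 0 ⟨r, h1, h2⟩ :=
    fun r _ _ => by simp [seg_apply]
  have hsup : ∀ r, -τ ≤ r → r ≤ 1 → ‖x r‖ ≤ B := by
    intro r h1 h2
    rcases le_total r 0 with h | h
    · rw [hneg r h1 h]
      refine ((seg τ x 0).norm_coe_le_norm _).trans ?_
      have : 0 ≤ growth κ 1 * ‖embC τ n (seg τ x 0)‖ := by positivity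
      linarith
    · refine (hx.norm_le hL h).trans ?_
      have := mul_le_mul_of_nonneg_right (growth_mono hκ h2) (norm_nonneg (embC τ n (seg τ x 0)))
      have := norm_nonneg (seg τ x 0)
      linarith
  have hB0 : 0 ≤ B := by positivity
  refine (ContinuousMap.norm_le _ (by positivity)).2 fun θ => ?_
  rw [ContinuousMap.sub_apply, seg_apply, seg_apply]
  rcases le_total (h + θ) 0 with hr | hr
  · have e : x (h + θ) = constExt (seg τ x 0) (h + θ) := by
      rw [hneg (h + θ) (by linarith [θ.2.1]) hr]
      exact (constExt_of_mem (seg τ x 0) ⟨h + θ, _⟩).symm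
    rw [e, sub_self, norm_zero]
    positivity
  · rw [constExt_of_nonneg _ hr, seg_hzero, hx _ hr, add_sub_cancel_left]
    have hr' : h + θ ≤ h := by linarith [θ.2.2]
    have := intervalIntegral.norm_integral_le_of_norm_le_const (a := 0) (b := h + θ)
      (f := fun s => L s (seg τ x s)) (C := κ * B) fun s hs => by
        rw [uIoc_of_le hr] at hs
        refine (hL.norm_le _ _).trans (mul_le_mul_of_nonneg_left ?_ hκ)
        refine (ContinuousMap.norm_le _ hB0).2 fun η => ?_
        exact hsup _ (by linarith [hs.1, η.2.1]) (by linarith [hs.2, η.2.2])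
    refine this.trans ?_
    rw [sub_zero, abs_of_nonneg hr]
    exact mul_le_mul_of_nonneg_left hr' (by positivity)

/-- Strong continuity at `0`, uniformly over all coefficients with the constant `κ`. -/
theorem evol_uniform_continuity (hκ : 0 ≤ κ) (v : HSpace τ n) {ε : ℝ} (hε : 0 < ε) :
    ∃ δ > 0, ∀ L : ℝ → C(Hist τ, RVec n) →L[ℝ] RVec n, DelayCoeff κ L →
      ∀ h, 0 ≤ h → h < δ → ‖evol L h v - v‖ < ε := by
  have hg : 0 < growth κ 1 := one_pos.trans_le (one_le_growth hκ zero_le_one)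
  obtain ⟨φ, hφ⟩ := denseRange_embC.exists_dist_lt v (ε := ε / (4 * (growth κ 1 + 1))) (by positivity)
  set B := κ * (growth κ 1 * ‖embC τ n φ‖ + ‖φ‖) with hB
  have hB0 : 0 ≤ B := by positivity
  have hc : Continuous fun s => embC τ n (seg τ (constExt φ) s) := by
    have := continuous_seg (τ := τ) (constExt φ)
    fun_prop
  obtain ⟨δ, hδ, hδ'⟩ := Metric.continuous_iff.1 hc 0 (ε / 4) (by positivity)
  set E := ‖embC τ n‖ with hE
  have hE0 : 0 ≤ E := ContinuousLinearMap.opNorm_nonneg _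
  refine ⟨min (min δ 1) (ε / (4 * (E * B + 1))), by positivity, fun L hL h h0 hlt => ?_⟩
  have hl1 : h < δ := hlt.trans_le ((min_le_left _ _).trans (min_le_left _ _))
  have hl2 : h < 1 := hlt.trans_le ((min_le_left _ _).trans (min_le_right _ _))
  have hl3 : h < ε / (4 * (E * B + 1)) := hlt.trans_le (min_le_right _ _)
  obtain ⟨x, hx0, hx⟩ := exists_isTraj hL φ
  have e1 := hδ' h (by simpa [abs_of_nonneg h0] using hl1)
  rw [seg_constExt, dist_eq_norm] at e1
  have e2 := hx.norm_seg_sub_constExt_le hL h0 hl2.le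
  rw [hx0] at e2
  have e3 : ‖embC τ n (seg τ x h) - embC τ n (seg τ (constExt φ) h)‖ ≤ ε / 4 := by
    rw [← map_sub]
    refine ((embC τ n).le_opNorm _).trans ?_
    calc E * ‖seg τ x h - seg τ (constExt φ) h‖ ≤ E * (B * h) := mul_le_mul_of_nonneg_left e2 hE0
      _ ≤ (E * B + 1) * h := by nlinarith
      _ ≤ (E * B + 1) * (ε / (4 * (E * B + 1))) := by gcongr
      _ = ε / 4 := by field_simp
  have e4 : ‖evol L h v - evol L h (embC τ n φ)‖ + ‖embC τ n φ - v‖ ≤ ε / 4 := by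
    rw [← map_sub]
    have := norm_evol_apply_le hL h0 (v - embC τ n φ)
    have h2 := mul_le_mul_of_nonneg_right (growth_mono hκ hl2.le) (norm_nonneg (v - embC τ n φ))
    rw [norm_sub_rev (embC τ n φ) v]
    rw [dist_eq_norm] at hφ
    calc _ ≤ (growth κ 1 + 1) * ‖v - embC τ n φ‖ := by linarith
      _ ≤ (growth κ 1 + 1) * (ε / (4 * (growth κ 1 + 1))) := by gcongr
      _ = ε / 4 := by field_simp
  have e5 : evol L h (embC τ n φ) = embC τ n (seg τ x h) := by
    rw [← hx0]; exact evol_apply hL hx h0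
  rw [e5] at e4
  calc ‖evol L h v - v‖ = ‖(evol L h v - embC τ n (seg τ x h)) + (embC τ n φ - v) +
        (embC τ n (seg τ x h) - embC τ n (seg τ (constExt φ) h)) +
        (embC τ n (seg τ (constExt φ) h) - embC τ n φ)‖ := by congr 1; abel
    _ ≤ ‖evol L h v - embC τ n (seg τ x h)‖ + ‖embC τ n φ - v‖ +
        ‖embC τ n (seg τ x h) - embC τ n (seg τ (constExt φ) h)‖ +
        ‖embC τ n (seg τ (constExt φ) h) - embC τ n φ‖ := norm_add₄_le
    _ < ε := by linarith

/-- A continuous curve whose right derivatives are those of the evolution started on it coincides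
with the evolution. -/
theorem eq_evol_of_hasDerivWithinAt (hL : DelayCoeff κ L) {ξ : ℝ → HSpace τ n}
    (hc : ContinuousOn ξ (Ici 0)) (D : ℝ → HSpace τ n)
    (hξ : ∀ s, 0 ≤ s → HasDerivWithinAt ξ (D s) (Ici s) s)
    (hev : ∀ s, 0 ≤ s → HasDerivWithinAt (fun h => evol (fun r => L (s + r)) h (ξ s)) (D s) (Ici 0) 0)
    {t : ℝ} (ht : 0 ≤ t) : ξ t = evol L t (ξ 0) := by
  have hκ := hL.nonneg
  -- The value ξ(s) is transported from time s to time t. If ξ is an orbit, f is constant; the aim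
  -- is to show that its right derivative vanishes.
  set f : ℝ → HSpace τ n := fun s => evol (fun r => L (s + r)) (t - s) (ξ s) with hf
  set γ := growth κ t with hγ
  have hγ1 : 1 ≤ γ := one_le_growth hκ ht
  -- By the cocycle property f(b) - f(a) is the transport from b to t of the defect of ξ on [a, b].
  -- Thus the evolution never has to be differentiated in its starting time.
  have hdiff : ∀ a b, 0 ≤ a → a ≤ b → b ≤ t →
      ‖f b - f a‖ ≤ γ * ‖ξ b - evol (fun r => L (a + r)) (b - a) (ξ a)‖ := by
    intro a b ha hab hbt
    have e : f a = evol (fun r => L (b + r)) (t - b) (evol (fun r => L (a + r)) (b - a) (ξ a)) := by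
      have := evol_add (hL.shift a) (sub_nonneg.2 hab) (sub_nonneg.2 hbt) (ξ a)
      rw [show b - a + (t - b) = t - a by ring] at this
      simp only [hf, this, ← add_assoc, add_sub_cancel]
    rw [e, hf, ← map_sub]
    refine (norm_evol_apply_le (hL.shift b) (sub_nonneg.2 hbt) _).trans ?_
    exact mul_le_mul_of_nonneg_right (growth_mono hκ (by linarith)) (norm_nonneg _)
  -- For r < c the evolution in the defect starts at the moving time r, so strong continuity is
  -- needed uniformly over the shifted coefficients.
  have hcont : ContinuousOn f (Icc 0 t) := by
    intro c hcm
    rw [Metric.continuousWithinAt_iff]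
    intro ε hε
    obtain ⟨δ₁, hδ₁, h1⟩ := evol_uniform_continuity (n := n) (τ := τ) hκ (ξ c)
      (ε := ε / (2 * γ)) (by positivity)
    obtain ⟨δ₂, hδ₂, h2⟩ := Metric.continuousWithinAt_iff.1 (hc c hcm.1) (ε / (2 * γ * (γ + 1)))
      (by positivity)
    refine ⟨min δ₁ δ₂, by positivity, fun r hr hd => ?_⟩
    have hd1 : |r - c| < δ₁ := hd.trans_le (min_le_left _ _)
    have hd2 := h2 hr.1 (hd.trans_le (min_le_right _ _))
    rw [dist_eq_norm] at hd2 ⊢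
    have fin : ‖f r - f c‖ < γ * ((γ + 1) * (ε / (2 * γ * (γ + 1))) + ε / (2 * γ)) := by
      rcases le_total c r with h | h
      · refine (hdiff c r hcm.1 h hr.2).trans_lt (mul_lt_mul_of_pos_left ?_ (by positivity))
        have e1 := h1 _ (hL.shift c) (r - c) (sub_nonneg.2 h) (by rwa [abs_of_nonneg (by linarith)] at hd1)
        have e2 : ‖ξ r - evol (fun r => L (c + r)) (r - c) (ξ c)‖ ≤
            ‖ξ r - ξ c‖ + ‖evol (fun r => L (c + r)) (r - c) (ξ c) - ξ c‖ := by
          rw [norm_sub_rev (evol (fun r => L (c + r)) (r - c) (ξ c))]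
          exact norm_sub_le_norm_sub_add_norm_sub _ _ _
        have e3 : 0 ≤ γ * ‖ξ r - ξ c‖ := by positivity
        have e4 := mul_lt_mul_of_pos_left hd2 (by positivity : 0 < γ + 1)
        linarith
      · rw [norm_sub_rev]
        refine (hdiff r c hr.1 h hcm.2).trans_lt (mul_lt_mul_of_pos_left ?_ (by positivity))
        have e1 := h1 _ (hL.shift r) (c - r) (sub_nonneg.2 h)
          (by rwa [abs_of_nonpos (by linarith), neg_sub] at hd1)
        have e2 : ‖ξ c - evol (fun s => L (r + s)) (c - r) (ξ r)‖ ≤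
            ‖evol (fun s => L (r + s)) (c - r) (ξ c) - ξ c‖ +
              ‖evol (fun s => L (r + s)) (c - r) (ξ r - ξ c)‖ := by
          rw [← norm_neg (ξ c - _), map_sub]
          refine le_trans (le_of_eq ?_) (norm_add_le _ _)
          congr 1; abel
        have e3 := norm_evol_apply_le (hL.shift r) (sub_nonneg.2 h) (ξ r - ξ c)
        have e4 := mul_le_mul_of_nonneg_right (growth_mono hκ (by linarith [hr.1, hcm.2] : c - r ≤ t))
          (norm_nonneg (ξ r - ξ c))
        have e5 := mul_lt_mul_of_pos_left hd2 (by positivity : 0 < γ + 1)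
        have e6 := norm_nonneg (ξ r - ξ c)
        linarith
    refine fin.trans_eq ?_
    field_simp
    ring
  -- The curve and the evolution started on it at s have the same right derivative, so the defect on
  -- [s, r] is o(r - s).
  have hder : ∀ s ∈ Ico 0 t, HasDerivWithinAt f 0 (Ici s) s := by
    intro s hs
    have h1 : HasDerivWithinAt (fun r => evol (fun r => L (s + r)) (r - s) (ξ s)) (D s) (Ici s) s := by
      have h2 : HasDerivWithinAt (fun r : ℝ => r - s) 1 (Ici s) s :=
        ((hasDerivAt_id s).sub_const s).hasDerivWithinAt
      have := HasDerivWithinAt.scomp (g₁ := fun h => evol (fun r => L (s + r)) h (ξ s)) (t' := Ici 0) s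
        (by simpa using hev s hs.1) h2 (fun r hr => by simpa using hr)
      simpa [Function.comp_def] using this
    have h3 := (hξ s hs.1).sub h1
    rw [sub_self, hasDerivWithinAt_iff_isLittleO] at h3
    rw [hasDerivWithinAt_iff_isLittleO]
    simp only [smul_zero, sub_zero] at h3 ⊢
    refine Asymptotics.IsBigO.trans_isLittleO ?_ h3
    refine Asymptotics.IsBigO.of_bound γ ?_
    have : ∀ᶠ r in 𝓝[Ici s] s, r < t := (eventually_lt_nhds hs.2).filter_mono nhdsWithin_le_nhds
    filter_upwards [this, self_mem_nhdsWithin] with r hr hsr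
    refine (hdiff s r hs.1 hsr hr.le).trans (le_of_eq ?_)
    simp [evol_zero (hL.shift s)]
  have := constant_of_has_deriv_right_zero hcont hder t ⟨ht, le_rfl⟩
  simp only [hf, sub_self, sub_zero, zero_add] at this
  rwa [evol_zero (hL.shift t)] at this

end Evolution

/-! ### Primitives of elements of `ℍ` and the graph of `A` -/

section Primitives

variable {n : ℕ}

/-- The primitive `s ↦ ∫₀ˢ e`. -/
def primExt (e : C(ℝ, RVec n)) : C(ℝ, RVec n) :=
  ⟨fun s => ∫ r in 0..s, e r, continuous_iff_continuousAt.2 fun s =>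
    (e.continuous.integral_hasStrictDerivAt 0 s).hasDerivAt.continuousAt⟩

theorem primExt_apply (e : C(ℝ, RVec n)) (s : ℝ) : primExt e s = ∫ r in 0..s, e r := rfl

theorem hasDerivAt_primExt (e : C(ℝ, RVec n)) (s : ℝ) : HasDerivAt (primExt e) (e s) s :=
  (e.continuous.integral_hasStrictDerivAt 0 s).hasDerivAt

theorem seg_primExt (e : C(ℝ, RVec n)) (t : ℝ) :
    seg τ (primExt e) t = seg τ (primExt e) 0 + ∫ r in 0..t, seg τ e r := by
  ext1 θ
  have h := (ContinuousMap.evalCLM ℝ θ : C(Hist τ, RVec n) →L[ℝ] RVec n).intervalIntegral_comp_comm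
    ((continuous_seg (τ := τ) e).intervalIntegrable 0 t (μ := volume))
  have h' : (∫ r in 0..t, seg τ e r) θ = ∫ r in 0..t, e (r + θ) := h.symm
  rw [ContinuousMap.add_apply, h', seg_apply, seg_apply, primExt_apply, primExt_apply,
    intervalIntegral.integral_comp_add_right (fun s => e s), zero_add,
    intervalIntegral.integral_add_adjacent_intervals (e.continuous.intervalIntegrable _ _)
      (e.continuous.intervalIntegrable _ _)]

/-- Integration maps the ℍ-norm to the supremum norm continuously, which lets primitives be defined
for all of ℍ. With a the ℍ-norm of φ, the inequality a|φ| ≤ a² + |φ|² replaces Cauchy–Schwarz and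
gives τ + 1; dividing by a is why φ = 0 is treated apart. -/
theorem norm_seg_primExt_constExt_le (φ : C(Hist τ, RVec n)) :
    ‖seg τ (primExt (constExt φ)) 0‖ ≤ (τ + 1) * ‖embC τ n φ‖ := by
  have hτ0 := hτ.out
  rcases eq_or_ne φ 0 with rfl | hφ
  · have h0 : seg τ (primExt (constExt (0 : C(Hist τ, RVec n)))) 0 = 0 := by
      ext1 θ
      simp [seg_apply, primExt_apply, constExt]
    rw [h0]
    simp
  set a := ‖embC τ n φ‖ with ha
  have ha0 : 0 < a := norm_pos_iff.2 fun h => hφ (embC_injective (h.trans (map_zero _).symm))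
  refine (ContinuousMap.norm_le _ (by positivity)).2 fun θ => ?_
  have hc : Continuous fun s => ‖constExt φ s‖ := by fun_prop
  have hc2 : Continuous fun s => ‖constExt φ s‖ ^ 2 := by fun_prop
  have h1 : ‖seg τ (primExt (constExt φ)) 0 θ‖ ≤ ∫ s in (-τ)..0, ‖constExt φ s‖ := by
    rw [seg_apply, zero_add, primExt_apply, intervalIntegral.integral_symm, norm_neg]
    refine (intervalIntegral.norm_integral_le_integral_norm θ.2.2).trans ?_
    exact intervalIntegral.integral_mono_interval θ.2.1 θ.2.2 le_rfl
      (ae_of_all _ fun _ => norm_nonneg _) (hc.intervalIntegrable _ _)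
  have h2 : a * ∫ s in (-τ)..0, ‖constExt φ s‖ ≤
      ∫ s in (-τ)..0, (a ^ 2 + ‖constExt φ s‖ ^ 2) := by
    rw [← intervalIntegral.integral_const_mul]
    refine intervalIntegral.integral_mono_on (by linarith) ((hc.const_mul a).intervalIntegrable _ _)
      ((continuous_const.add hc2).intervalIntegrable _ _) fun s _ => ?_
    nlinarith [sq_nonneg (a - ‖constExt φ s‖), sq_nonneg a, sq_nonneg ‖constExt φ s‖]
  rw [intervalIntegral.integral_add (continuous_const.intervalIntegrable _ _)
    (hc2.intervalIntegrable _ _), intervalIntegral.integral_const, smul_eq_mul] at h2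
  have h3 := norm_sq_embC_seg (τ := τ) (constExt φ) 0
  rw [seg_constExt, zero_sub, ← ha] at h3
  have h4 : a * ∫ s in (-τ)..0, ‖constExt φ s‖ ≤ a * ((τ + 1) * a) := by
    nlinarith [sq_nonneg ‖constExt φ 0‖]
  exact h1.trans (le_of_mul_le_mul_left h4 ha0)

theorem seg_primExt_constExt_add (φ ψ : C(Hist τ, RVec n)) :
    seg τ (primExt (constExt (φ + ψ))) 0 =
      seg τ (primExt (constExt φ)) 0 + seg τ (primExt (constExt ψ)) 0 := by
  ext1 θ
  simp only [ContinuousMap.add_apply, seg_apply, primExt_apply]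
  rw [← intervalIntegral.integral_add ((constExt φ).continuous.intervalIntegrable _ _)
    ((constExt ψ).continuous.intervalIntegrable _ _)]
  rfl

theorem seg_primExt_constExt_smul (c : ℝ) (φ : C(Hist τ, RVec n)) :
    seg τ (primExt (constExt (c • φ))) 0 = c • seg τ (primExt (constExt φ)) 0 := by
  ext1 θ
  simp only [ContinuousMap.smul_apply, seg_apply, primExt_apply]
  rw [← intervalIntegral.integral_smul]
  rfl

/-- The operator `y ↦ (θ ↦ ∫₀^θ y)` from `ℍ` to `C([-τ, 0]; ℝⁿ)`. -/
def primInt (τ : ℝ) [Fact (0 < τ)] (n : ℕ) : HSpace τ n →L[ℝ] C(Hist τ, RVec n) :=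
  LinearMap.extendOfNorm
    { toFun := fun φ => seg τ (primExt (constExt φ)) 0
      map_add' := seg_primExt_constExt_add
      map_smul' := seg_primExt_constExt_smul } (embC τ n).toLinearMap

theorem primInt_embC (φ : C(Hist τ, RVec n)) :
    primInt τ n (embC τ n φ) = seg τ (primExt (constExt φ)) 0 :=
  LinearMap.extendOfNorm_eq (e := (embC τ n).toLinearMap) denseRange_embC
    ⟨τ + 1, norm_seg_primExt_constExt_le⟩ φ

theorem primInt_hzero (v : HSpace τ n) : primInt τ n v (hzero τ) = 0 := by
  refine dense_induction_embC (p := fun v => primInt τ n v (hzero τ) = 0)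
    (isClosed_eq (by fun_prop) (by fun_prop)) (fun φ => ?_) v
  rw [primInt_embC, seg_hzero, primExt_apply, intervalIntegral.integral_same]

/-- The function `θ ↦ c + ∫₀^θ y`. -/
def prim (c : RVec n) (y : HSpace τ n) : C(Hist τ, RVec n) :=
  ContinuousMap.const _ c + primInt τ n y

theorem prim_apply (c : RVec n) (y : HSpace τ n) (θ : Hist τ) :
    prim c y θ = c + primInt τ n y θ := rfl

theorem prim_hzero (c : RVec n) (y : HSpace τ n) : prim c y (hzero τ) = c := by
  rw [prim_apply, primInt_hzero, add_zero]

theorem continuous_prim : Continuous fun q : RVec n × HSpace τ n => prim q.1 q.2 := by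
  unfold prim
  exact (ContinuousMap.continuous_const'.comp continuous_fst).add
    ((primInt τ n).continuous.comp continuous_snd)

theorem seg_primExt_eq_prim (e : C(ℝ, RVec n)) (t : ℝ) :
    seg τ (primExt e) t = prim (primExt e t) (embC τ n (seg τ e t)) := by
  ext1 θ
  rw [prim_apply, primInt_embC, seg_apply, seg_apply, zero_add, primExt_apply (constExt _),
    primExt_apply, primExt_apply]
  have : ∫ r in 0..(θ : ℝ), constExt (seg τ e t) r = ∫ r in 0..(θ : ℝ), e (t + r) := by
    refine intervalIntegral.integral_congr fun r hr => ?_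
    rw [uIcc_of_ge θ.2.2] at hr
    exact constExt_of_mem (seg τ e t) ⟨r, θ.2.1.trans hr.1, hr.2⟩
  rw [this, intervalIntegral.integral_comp_add_left (fun s => e s), add_zero,
    intervalIntegral.integral_add_adjacent_intervals (e.continuous.intervalIntegrable _ _)
      (e.continuous.intervalIntegrable _ _)]

/-- The function `θ ↦ χ(θ) a`. -/
def bump (τ : ℝ) {χ : ℝ → ℝ} (hχ : Continuous χ) (a : RVec n) : C(Hist τ, RVec n) :=
  ⟨fun θ => χ θ • a, by fun_prop⟩

/-- Since χ vanishes at 0, the atom does not contribute. Integration against a test function thus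
becomes an inner product in ℍ, which is visibly continuous in y. -/
theorem inner_embC_bump {χ : ℝ → ℝ} (hχ : Continuous χ) (h0 : χ 0 = 0) (a : RVec n)
    (y : HSpace τ n) :
    inner ℝ (embC τ n (bump τ hχ a)) y = inner ℝ a (∫ θ, χ θ • y θ ∂leb τ) := by
  have hint : Integrable (fun θ => inner ℝ (embC τ n (bump τ hχ a) θ) (y θ)) (histMeasure τ) :=
    L2.integrable_inner _ _
  rw [L2.inner_def, ← integral_inner (integrable_leb_smul hχ y)]
  unfold histMeasure at hint ⊢
  rw [integral_add_measure (hint.mono_measure (Measure.le_add_right le_rfl))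
    (hint.mono_measure (Measure.le_add_left le_rfl)), integral_dirac]
  have hz : embC τ n (bump τ hχ a) (hzero τ) = 0 := by
    rw [(coeFn_embC _).2]
    simp [bump, hzero, h0]
  unfold histMeasure at hz
  rw [hz, inner_zero_left, add_zero]
  refine integral_congr_ae ?_
  have := (coeFn_embC (bump τ hχ a)).1
  unfold histMeasure at this
  filter_upwards [this] with θ h
  rw [h]
  simp [bump, inner_smul_left, inner_smul_right]

theorem integral_leb_smul_embC (χ : ℝ → ℝ) (ψ : C(Hist τ, RVec n)) :
    ∫ θ, χ θ • embC τ n ψ θ ∂leb τ = ∫ θ, χ θ • ψ θ ∂leb τ := by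
  refine integral_congr_ae ?_
  filter_upwards [(coeFn_embC ψ).1] with θ h
  rw [h]

/-- Paired with a fixed vector a, both sides of the identity are continuous in y ∈ ℍ, so y may be
taken continuous. Then it is the ordinary integration by parts, with boundary terms killed by χ(-τ)
= χ(0) = 0. -/
theorem isWeakDeriv_prim (c : RVec n) (y : HSpace τ n) : IsWeakDeriv (prim c y) y := by
  intro χ hχ hc hs
  have hχc := hχ.continuous
  have hd : Continuous (deriv χ) := hχ.continuous_deriv (by simp)
  have h0 : χ 0 = 0 := image_eq_zero_of_notMem_tsupport fun h => (hs h).2.false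
  have hτ0 : χ (-τ) = 0 := image_eq_zero_of_notMem_tsupport fun h => (hs h).1.false
  have hd0 : deriv χ 0 = 0 := image_eq_zero_of_notMem_tsupport fun h =>
    (hs (tsupport_deriv_subset h)).2.false
  rw [← integral_leb_smul_embC]
  refine ext_inner_left ℝ fun a => ?_
  rw [inner_neg_right, ← inner_embC_bump hχc h0, ← inner_embC_bump hd hd0]
  refine dense_induction_embC (p := fun y => inner ℝ (embC τ n (bump τ hd a)) (embC τ n (prim c y)) =
    -inner ℝ (embC τ n (bump τ hχc a)) y) (isClosed_eq ?_ (by fun_prop)) (fun φ => ?_) y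
  · have : Continuous fun y : HSpace τ n => prim c y :=
      continuous_prim.comp (continuous_const.prodMk continuous_id)
    fun_prop
  · rw [inner_embC_bump hχc h0, inner_embC_bump hd hd0, ← inner_neg_right]
    congr 1
    rw [integral_leb_smul_embC, integral_leb_smul_embC]
    have e1 : ∀ θ : Hist τ, prim c (embC τ n φ) θ = c + primExt (constExt φ) θ := fun θ => by
      rw [prim_apply, primInt_embC, seg_apply, zero_add]
    have e2 : ∀ θ : Hist τ, φ θ = constExt φ θ := fun θ => (constExt_of_mem φ θ).symm
    simp_rw [e1, e2]
    rw [integral_leb (fun s => deriv χ s • (c + primExt (constExt φ) s)),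
      integral_leb (fun s => χ s • constExt φ s), eq_neg_iff_add_eq_zero,
      ← intervalIntegral.integral_add]
    · have hder : ∀ s ∈ uIcc (-τ) 0, HasDerivAt (fun s => χ s • (c + primExt (constExt φ) s))
          (deriv χ s • (c + primExt (constExt φ) s) + χ s • constExt φ s) s := fun s _ => by
        rw [add_comm]
        exact (hχ.differentiable (by simp) s).hasDerivAt.smul
          ((hasDerivAt_primExt (constExt φ) s).const_add c)
      rw [intervalIntegral.integral_eq_sub_of_hasDerivAt hder]
      · simp [h0, hτ0]
      · exact Continuous.intervalIntegrable (by fun_prop) _ _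
    · exact Continuous.intervalIntegrable (by fun_prop) _ _
    · exact Continuous.intervalIntegrable (by fun_prop) _ _

end Primitives

/-! ### Uniqueness of weak primitives and closedness of the graph of A -/

section Graph

variable {n : ℕ}

theorem prim_add (a b : RVec n) (v w : HSpace τ n) : prim (a + b) (v + w) = prim a v + prim b w := by
  ext1 θ
  simp only [prim_apply, ContinuousMap.add_apply, map_add]
  abel

theorem prim_smul (c : ℝ) (a : RVec n) (v : HSpace τ n) : prim (c • a) (c • v) = c • prim a v := by
  ext1 θ
  simp only [prim_apply, ContinuousMap.smul_apply, map_smul, smul_add]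

theorem prim_sub (a b : RVec n) (v w : HSpace τ n) : prim (a - b) (v - w) = prim a v - prim b w := by
  ext1 θ
  simp only [prim_apply, ContinuousMap.sub_apply, map_sub]
  abel

/-- The primitive vanishes to the left of the support of h trivially and to its right because h has
mean zero, so it is again a test function. -/
theorem exists_test_primitive {h : ℝ → ℝ} (hh : ContDiff ℝ ∞ h) {a b : ℝ} (ha : -τ < a) (hb : b < 0)
    (hs : Function.support h ⊆ Icc a b) (hi : ∫ x, h x = 0) :
    ∃ χ : ℝ → ℝ, ContDiff ℝ ∞ χ ∧ HasCompactSupport χ ∧ tsupport χ ⊆ Ioo (-τ) 0 ∧ deriv χ = h := by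
  have hd : ∀ t, HasDerivAt (fun t => ∫ s in (-τ)..t, h s) (h t) t := fun t =>
    (hh.continuous.integral_hasStrictDerivAt _ t).hasDerivAt
  have hderiv : deriv (fun t => ∫ s in (-τ)..t, h s) = h := funext fun t => (hd t).deriv
  have hsup : Function.support (fun t => ∫ s in (-τ)..t, h s) ⊆ Icc a b := by
    intro t ht
    by_contra hn
    refine ht ?_
    rw [mem_Icc, not_and_or, not_le, not_le] at hn
    rcases hn with hn | hn
    · refine intervalIntegral.integral_zero_ae (ae_of_all _ fun s hs' => ?_)
      by_contra h0
      have h1 := (hs (Function.mem_support.2 h0)).1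
      have h2 := (uIoc_subset_uIcc hs').2
      have h3 : max (-τ) t < a := max_lt ha hn
      exact absurd (h1.trans h2) (not_le.2 h3)
    · dsimp only
      rw [intervalIntegral.integral_eq_integral_of_support_subset, hi]
      exact hs.trans fun s hs => ⟨ha.trans_le hs.1, hs.2.trans hn.le⟩
  have hts : tsupport (fun t => ∫ s in (-τ)..t, h s) ⊆ Icc a b := closure_minimal hsup isClosed_Icc
  refine ⟨fun t => ∫ s in (-τ)..t, h s, ?_, ?_, hts.trans fun t ht => ⟨ha.trans_le ht.1, ht.2.trans_lt hb⟩,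
    hderiv⟩
  · rw [contDiff_infty_iff_deriv, hderiv]
    exact ⟨fun t => (hd t).differentiableAt, hh⟩
  · exact HasCompactSupport.of_support_subset_isCompact isCompact_Icc hsup

theorem integral_eq_integral_leb {f : ℝ → RVec n} (hf : Function.support f ⊆ Ioo (-τ) 0) :
    ∫ s, f s = ∫ θ : Hist τ, f θ ∂leb τ := by
  rw [integral_leb, intervalIntegral.integral_eq_integral_of_support_subset]
  exact hf.trans Ioo_subset_Ioc_self

/-- The du Bois-Reymond argument. With a fixed bump r of mean one, g - (∫g) r has mean zero for
every test function g and is therefore the derivative of a test function. Hence d is orthogonal to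
it, that is, d - c₀ is orthogonal to g with c₀ = ∫ r d. So d is constant on the open interval, by
continuity on [-τ, 0], and d(0) = 0. -/
theorem eq_zero_of_isWeakDeriv_zero (d : C(Hist τ, RVec n)) (h0 : d (hzero τ) = 0)
    (h : ∀ χ : ℝ → ℝ, ContDiff ℝ ∞ χ → HasCompactSupport χ → tsupport χ ⊆ Ioo (-τ) 0 →
      ∫ θ, deriv χ θ • d θ ∂leb τ = 0) : d = 0 := by
  have hτ0 := hτ.out
  let ρ : ContDiffBump (-τ / 2 : ℝ) := ⟨τ / 8, τ / 4, by positivity, by linarith⟩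
  set r : ℝ → ℝ := ρ.normed volume with hr
  have hrs : tsupport r = Icc (-τ / 2 - τ / 4) (-τ / 2 + τ / 4) := by
    rw [hr, ρ.tsupport_normed_eq, Real.closedBall_eq_Icc]
  have hrc : ContDiff ℝ ∞ r := ρ.contDiff_normed
  set c0 : RVec n := ∫ s, r s • constExt d s with hc0
  have hcd := (constExt d).continuous
  have key : ∀ g : ℝ → ℝ, ContDiff ℝ ∞ g → HasCompactSupport g → tsupport g ⊆ Ioo (-τ) 0 →
      ∫ s, g s • (constExt d s - c0) = 0 := by
    intro g hg hgc hgs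
    -- A compact set inside (-τ, 0) carrying the corrected test function; its extremal points are
    -- the bounds required by `exists_test_primitive`.
    set K := tsupport g ∪ tsupport r with hK
    have hKc : IsCompact K := hgc.isCompact.union (by rw [hrs]; exact isCompact_Icc)
    have hKne : K.Nonempty := ⟨-τ / 2, Or.inr (by rw [hrs]; constructor <;> linarith)⟩
    have hKs : K ⊆ Ioo (-τ) 0 := union_subset hgs (by
      rw [hrs]; intro s hs; exact ⟨by linarith [hs.1], by linarith [hs.2]⟩)
    have ha := hKs (hKc.sInf_mem hKne)
    have hb := hKs (hKc.sSup_mem hKne)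
    have hKI : K ⊆ Icc (sInf K) (sSup K) := fun s hs =>
      ⟨csInf_le hKc.bddBelow hs, le_csSup hKc.bddAbove hs⟩
    have hgi : Integrable g := hg.continuous.integrable_of_hasCompactSupport hgc
    have hri : Integrable r := hrc.continuous.integrable_of_hasCompactSupport ρ.hasCompactSupport_normed
    have hgs' : Function.support g ⊆ K := (subset_tsupport g).trans subset_union_left
    have hrs' : Function.support r ⊆ K := (subset_tsupport r).trans subset_union_right
    set q : ℝ → ℝ := fun s => g s - (∫ s, g s) * r s with hq
    have hqs : Function.support q ⊆ K := by
      intro s hs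
      by_contra hn
      refine hs ?_
      have h1 : g s = 0 := Function.notMem_support.1 fun h => hn (hgs' h)
      have h2 : r s = 0 := Function.notMem_support.1 fun h => hn (hrs' h)
      simp [hq, h1, h2]
    obtain ⟨χ, h1, h2, h3, h4⟩ := exists_test_primitive (τ := τ) (h := q)
      (hg.sub (contDiff_const.mul hrc)) ha.1 hb.2 (hqs.trans hKI) (by
        rw [hq, integral_sub hgi (hri.const_mul _), integral_const_mul, ρ.integral_normed, mul_one,
          sub_self])
    have h5 := h χ h1 h2 h3
    rw [h4] at h5
    have h6 : ∫ s, q s • constExt d s = 0 := by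
      rw [integral_eq_integral_leb (τ := τ)]
      · simpa only [constExt_of_mem] using h5
      · exact (Function.support_smul_subset_left _ _).trans (hqs.trans hKs)
    have i1 : Integrable fun s => g s • constExt d s :=
      (hg.continuous.smul hcd).integrable_of_hasCompactSupport hgc.smul_right
    have i2 : Integrable fun s => r s • constExt d s :=
      (hrc.continuous.smul hcd).integrable_of_hasCompactSupport ρ.hasCompactSupport_normed.smul_right
    have h7 : ∫ s, q s • constExt d s = (∫ s, g s • constExt d s) - (∫ s, g s) • c0 := by
      rw [hc0, ← integral_smul, ← integral_sub i1 (i2.smul (∫ s, g s) :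
        Integrable fun s => (∫ s, g s) • r s • constExt d s)]
      refine integral_congr_ae (ae_of_all _ fun s => ?_)
      simp only [hq, sub_smul, mul_smul]
    simp only [smul_sub]
    rw [integral_sub i1 (hgi.smul_const _), integral_smul_const, ← h7, h6]
  have hfc : Continuous fun s => constExt d s - c0 := by fun_prop
  have hae := isOpen_Ioo.ae_eq_zero_of_integral_contDiff_smul_eq_zero (U := Ioo (-τ) 0) (μ := volume)
    (f := fun s => constExt d s - c0) (hfc.locallyIntegrable.locallyIntegrableOn _) key
  have hEq : EqOn (fun s => constExt d s - c0) (fun _ => 0) (Ioo (-τ) 0) :=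
    Measure.eqOn_open_of_ae_eq (μ := volume) ((ae_restrict_iff' measurableSet_Ioo).2 hae) isOpen_Ioo
      hfc.continuousOn continuousOn_const
  have hEq2 := hEq.closure hfc continuous_const
  rw [closure_Ioo (by linarith : (-τ) ≠ 0)] at hEq2
  have hall : ∀ θ : Hist τ, d θ = c0 := fun θ => by
    have := hEq2 θ.2
    simp only [constExt_of_mem] at this
    exact sub_eq_zero.1 this
  ext1 θ
  rw [hall θ, ← hall (hzero τ), h0, ContinuousMap.zero_apply]

theorem IsWeakDeriv.eq_prim {ψ : C(Hist τ, RVec n)} {y : HSpace τ n} (h : IsWeakDeriv ψ y) :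
    ψ = prim (ψ (hzero τ)) y := by
  refine sub_eq_zero.1 (eq_zero_of_isWeakDeriv_zero (ψ - prim (ψ (hzero τ)) y) ?_
    fun χ hχ hc hs => ?_)
  · rw [ContinuousMap.sub_apply, prim_hzero, sub_self]
  · have hd : Continuous (deriv χ) := hχ.continuous_deriv (by simp)
    simp only [ContinuousMap.sub_apply, smul_sub]
    rw [integral_sub, h χ hχ hc hs, isWeakDeriv_prim _ y χ hχ hc hs, sub_self]
    · exact integrable_leb_of_continuous (by fun_prop)
    · exact integrable_leb_of_continuous (by fun_prop)

/-- The representative ψ is recovered as the primitive of y with the value of φ at the atom. This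
eliminates the existential quantifier and leaves two equations between continuous functions of (φ,
y), so the graph is closed. -/
theorem mem_graph_iff_prim (Atil : C(Hist τ, RVec n) →L[ℝ] RVec n) (φ y : HSpace τ n) :
    (φ, y) ∈ (delayOperator Atil).graph ↔
      φ = embC τ n (prim (atomEval τ n φ) y) ∧ atomEval τ n y = Atil (prim (atomEval τ n φ) y) := by
  rw [mem_graph_delayOperator]
  constructor
  · rintro ⟨ψ, rfl, h2, h3⟩
    rw [atomEval_embC, ← h3.eq_prim]
    exact ⟨rfl, h2⟩
  · rintro ⟨h1, h2⟩
    exact ⟨_, h1, h2, isWeakDeriv_prim _ y⟩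

theorem mem_graph_prim (Atil : C(Hist τ, RVec n) →L[ℝ] RVec n) (c : RVec n) (y : HSpace τ n)
    (h : atomEval τ n y = Atil (prim c y)) :
    (embC τ n (prim c y), y) ∈ (delayOperator Atil).graph :=
  (mem_graph_delayOperator _ _ _).2 ⟨_, rfl, h, isWeakDeriv_prim _ y⟩

theorem isClosed_graph (Atil : C(Hist τ, RVec n) →L[ℝ] RVec n) :
    IsClosed {p : HSpace τ n × HSpace τ n | p ∈ (delayOperator Atil).graph} := by
  have h : {p : HSpace τ n × HSpace τ n | p ∈ (delayOperator Atil).graph} =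
      {p | p.1 = embC τ n (prim (atomEval τ n p.1) p.2)} ∩
        {p | atomEval τ n p.2 = Atil (prim (atomEval τ n p.1) p.2)} := by
    ext ⟨φ, y⟩
    exact mem_graph_iff_prim Atil φ y
  have hc : Continuous fun p : HSpace τ n × HSpace τ n => prim (atomEval τ n p.1) p.2 :=
    continuous_prim.comp (((atomEval τ n).continuous.comp continuous_fst).prodMk continuous_snd)
  rw [h]
  exact (isClosed_eq continuous_fst (by fun_prop)).inter (isClosed_eq (by fun_prop) (by fun_prop))

theorem coeFn_atomVec (v : RVec n) :
    (∀ᵐ θ ∂leb τ, (atomVec v : HSpace τ n) θ = 0) ∧ (atomVec v : HSpace τ n) (hzero τ) = v := by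
  have h := (ae_histMeasure_iff _).1 (indicatorConstLp_coeFn (p := 2)
    (hs := measurableSet_singleton (hzero τ)) (hμs := measure_ne_top (histMeasure τ) _) (c := v))
  refine ⟨?_, by rw [atomVec, h.2]; simp⟩
  have n0 : ∀ᵐ θ ∂leb τ, θ ≠ hzero τ := by
    rw [ae_iff]; simpa using leb_singleton (hzero τ)
  filter_upwards [h.1, n0] with θ a b
  rw [atomVec, a, indicator_of_notMem (by simpa using b)]

theorem atomEval_atomVec (v : RVec n) : atomEval τ n (atomVec v) = v := (coeFn_atomVec v).2

/-- Primitives do not see the atom. Hence the value at 0 of a derivative can be altered freely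
without changing the function it integrates to. -/
theorem primInt_atomVec (v : RVec n) : primInt τ n (atomVec v) = 0 := by
  have h : IsWeakDeriv (0 : C(Hist τ, RVec n)) (atomVec v : HSpace τ n) := by
    intro χ _ _ _
    have : ∫ θ, χ θ • (atomVec v : HSpace τ n) θ ∂leb τ = 0 := by
      rw [integral_congr_ae (g := fun _ => 0), integral_zero]
      filter_upwards [(coeFn_atomVec v).1] with θ h
      rw [h, smul_zero]
    rw [this]
    simp
  have h2 := h.eq_prim
  ext1 θ
  have h3 := congrArg (fun ψ : C(Hist τ, RVec n) => ψ θ) h2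
  simpa [prim_apply] using h3.symm

end Graph

/-! ### Regularity of trajectories with initial values in the domain of `A` -/

section Regularity

variable {n : ℕ} {κ : ℝ} {L : ℝ → C(Hist τ, RVec n) →L[ℝ] RVec n}

theorem hasDerivWithinAt_of_eq_integral {E : Type*} [NormedAddCommGroup E] [NormedSpace ℝ E]
    [CompleteSpace E] {F g : ℝ → E} (hg : ContinuousOn g (Ici 0))
    (hF : ∀ t, 0 ≤ t → F t = F 0 + ∫ s in 0..t, g s) {t : ℝ} (ht : 0 ≤ t) :
    HasDerivWithinAt F (g t) (Ici 0) t := by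
  have hc : Continuous fun s => g (max s 0) :=
    hg.comp_continuous (continuous_id.max continuous_const) fun s => le_max_right s 0
  have h := ((hc.integral_hasStrictDerivAt 0 t).hasDerivAt.const_add (F 0)).hasDerivWithinAt (s := Ici 0)
  rw [max_eq_left ht] at h
  have e : ∀ s ∈ Ici (0 : ℝ), F s = F 0 + ∫ r in 0..s, g (max r 0) := fun s hs => by
    rw [hF s hs]
    congr 1
    refine intervalIntegral.integral_congr fun r hr => ?_
    rw [uIcc_of_le hs] at hr
    simp only [max_eq_left hr.1]
  exact h.congr e (e t ht)

theorem intervalIntegrable_evol (hL : DelayCoeff κ L) (v : HSpace τ n) {t : ℝ} (ht : 0 ≤ t) :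
    IntervalIntegrable (fun r => evol L r v) volume 0 t :=
  ((continuousOn_evol hL v).mono (by rw [uIcc_of_le ht]; exact fun s hs => hs.1)).intervalIntegrable

theorem continuous_integral_evol (hL : DelayCoeff κ L) {t : ℝ} (ht : 0 ≤ t) :
    Continuous fun v : HSpace τ n => ∫ r in 0..t, evol L r v := by
  have hg := one_le_growth hL.nonneg ht
  refine (LipschitzWith.of_dist_le_mul (K := Real.toNNReal (growth κ t * t)) fun v w => ?_).continuous
  rw [dist_eq_norm, ← intervalIntegral.integral_sub (intervalIntegrable_evol hL v ht)
    (intervalIntegrable_evol hL w ht)]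
  refine (intervalIntegral.norm_integral_le_of_norm_le_const (C := growth κ t * ‖v - w‖)
    fun r hr => ?_).trans (le_of_eq ?_)
  · rw [uIoc_of_le ht] at hr
    rw [← map_sub]
    refine (norm_evol_apply_le hL hr.1.le _).trans ?_
    exact mul_le_mul_of_nonneg_right (growth_mono hL.nonneg hr.2) (norm_nonneg _)
  · rw [sub_zero, abs_of_nonneg ht, dist_eq_norm, Real.coe_toNNReal _ (by positivity)]
    ring

theorem delayCoeff_zero : DelayCoeff (n := n) (τ := τ) 0 fun _ => 0 where
  nonneg := le_rfl
  continuous := by simpa using continuous_const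
  norm_le := by simp
  energy := by simp

/-- The shift semigroup on `ℍ`, which extends functions to the right by their value at `0`. -/
def histShift (t : ℝ) : HSpace τ n →L[ℝ] HSpace τ n := evol (fun _ => 0) t

theorem histShift_embC (φ : C(Hist τ, RVec n)) {t : ℝ} (ht : 0 ≤ t) :
    histShift t (embC τ n φ) = embC τ n (seg τ (constExt φ) t) := by
  have hx : IsTraj (τ := τ) (fun _ => 0) (constExt φ) := fun t ht => by
    rw [constExt_of_nonneg _ ht, constExt_of_nonneg _ le_rfl]
    simp
  have := evol_apply delayCoeff_zero hx ht
  rwa [seg_constExt] at this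

theorem atomEval_histShift (v : HSpace τ n) {t : ℝ} (ht : 0 ≤ t) :
    atomEval τ n (histShift t v) = atomEval τ n v := by
  refine dense_induction_embC (p := fun v => atomEval τ n (histShift t v) = atomEval τ n v)
    (isClosed_eq (by fun_prop) (by fun_prop)) (fun φ => ?_) v
  rw [histShift_embC _ ht, atomEval_embC, atomEval_embC, seg_hzero, constExt_of_nonneg _ ht]

/-- The primitive of the extension to the right of `v ∈ ℍ` by its value at `0`. -/
def histPrim (v : HSpace τ n) : C(ℝ, RVec n) :=
  ⟨fun s => constExt (primInt τ n v) s + max s 0 • atomEval τ n v, by fun_prop⟩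

theorem histPrim_of_nonneg (v : HSpace τ n) {s : ℝ} (hs : 0 ≤ s) :
    histPrim v s = s • atomEval τ n v := by
  simp only [histPrim, ContinuousMap.coe_mk]
  rw [constExt_of_nonneg _ hs, primInt_hzero, zero_add, max_eq_left hs]

theorem histPrim_of_mem (v : HSpace τ n) (θ : Hist τ) : histPrim v θ = primInt τ n v θ := by
  simp only [histPrim, ContinuousMap.coe_mk]
  rw [constExt_of_mem, max_eq_right θ.2.2, zero_smul, add_zero]

theorem seg_histPrim_embC (φ : C(Hist τ, RVec n)) {t : ℝ} (ht : 0 ≤ t) :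
    seg τ (histPrim (embC τ n φ)) t = seg τ (primExt (constExt φ)) t := by
  ext1 θ
  rw [seg_apply, seg_apply]
  rcases le_total (t + θ) 0 with h | h
  · have := histPrim_of_mem (embC τ n φ) ⟨t + θ, by linarith [θ.2.1], h⟩
    rw [primInt_embC, seg_apply, zero_add] at this
    exact this
  · rw [histPrim_of_nonneg _ h, atomEval_embC, primExt_apply]
    have : ∫ r in 0..(t + θ : ℝ), constExt φ r = ∫ r in 0..(t + θ : ℝ), φ (hzero τ) := by
      refine intervalIntegral.integral_congr fun r hr => ?_
      rw [uIcc_of_le h] at hr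
      exact constExt_of_nonneg _ hr.1
    rw [this, intervalIntegral.integral_const, sub_zero]

theorem continuous_seg_histPrim (t : ℝ) :
    Continuous fun v : HSpace τ n => seg τ (histPrim v) t := by
  refine ContinuousMap.continuous_of_continuous_uncurry _ ?_
  have : Function.uncurry (fun (v : HSpace τ n) (θ : Hist τ) => seg τ (histPrim v) t θ) =
      fun q => primInt τ n q.1 (projIcc (-τ) 0 (by linarith [hτ.out]) (t + q.2)) +
        max (t + (q.2 : ℝ)) 0 • atomEval τ n q.1 := rfl
  rw [this]
  fun_prop

/-- For continuous v this is the fundamental theorem of calculus for segments, `seg_primExt`; both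
sides are continuous in v ∈ ℍ. Even for discontinuous v the segments of the primitive thus form a C¹
curve in ℍ with the velocity given by the shift semigroup. -/
theorem embC_seg_histPrim (v : HSpace τ n) {t : ℝ} (ht : 0 ≤ t) :
    embC τ n (seg τ (histPrim v) t) =
      embC τ n (seg τ (histPrim v) 0) + ∫ r in 0..t, histShift r v := by
  refine dense_induction_embC (p := fun v => embC τ n (seg τ (histPrim v) t) =
      embC τ n (seg τ (histPrim v) 0) + ∫ r in 0..t, histShift r v)
    (isClosed_eq ((embC τ n).continuous.comp (continuous_seg_histPrim t))
      (((embC τ n).continuous.comp (continuous_seg_histPrim 0)).add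
        (continuous_integral_evol delayCoeff_zero ht))) (fun φ => ?_) v
  rw [seg_histPrim_embC _ ht, seg_histPrim_embC _ le_rfl, seg_primExt, map_add,
    ← (embC τ n).intervalIntegral_comp_comm
      ((continuous_seg (τ := τ) (constExt φ)).intervalIntegrable 0 t)]
  congr 1
  refine intervalIntegral.integral_congr fun r hr => ?_
  rw [uIcc_of_le ht] at hr
  exact (histShift_embC φ hr.1).symm

theorem seg_histPrim_eq_prim (v : HSpace τ n) {t : ℝ} (ht : 0 ≤ t) :
    seg τ (histPrim v) t = prim (histPrim v t) (histShift t v) := by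
  have hc : Continuous fun v : HSpace τ n => histPrim v t := by
    have := continuous_seg_histPrim (τ := τ) (n := n) t
    have h2 : Continuous fun v : HSpace τ n => seg τ (histPrim v) t (hzero τ) := by fun_prop
    simpa only [seg_hzero] using h2
  refine dense_induction_embC (p := fun v => seg τ (histPrim v) t =
      prim (histPrim v t) (histShift t v))
    (isClosed_eq (continuous_seg_histPrim t) (continuous_prim.comp (hc.prodMk (by fun_prop))))
    (fun φ => ?_) v
  have h := seg_histPrim_embC φ ht
  have h2 := congrArg (fun ψ : C(Hist τ, RVec n) => ψ (hzero τ)) h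
  simp only [seg_hzero] at h2
  rw [h, h2, histShift_embC _ ht]
  exact seg_primExt_eq_prim _ _

/-- A trajectory starting in the domain of `A` is a `C¹` curve in `ℍ`. -/
theorem IsTraj.exists_derivative (hL : DelayCoeff κ L) {x : C(ℝ, RVec n)} (hx : IsTraj L x)
    {c : RVec n} {y : HSpace τ n} (hx0 : seg τ x 0 = prim c y) :
    ∃ D : ℝ → HSpace τ n, ContinuousOn D (Ici 0) ∧
      (∀ t, 0 ≤ t → HasDerivWithinAt (fun t => embC τ n (seg τ x t)) (D t) (Ici 0) t) ∧
      (∀ t, 0 ≤ t → seg τ x t = prim (x t) (D t)) ∧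
      ∀ t, 0 ≤ t → atomEval τ n (D t) = L t (seg τ x t) := by
  set f : ℝ → RVec n := fun r => L r (seg τ x r) with hf
  have hfc : Continuous f := hL.continuous_seg x
  -- The initial velocity: y on the history interval, with the value at the atom replaced by the
  -- right derivative L(0)x_0. No compatibility condition at 0 is needed, as primitives ignore the
  -- atom.
  set z : HSpace τ n := y + atomVec (f 0 - atomEval τ n y) with hz
  have hz0 : atomEval τ n z = f 0 := by rw [hz, map_add, atomEval_atomVec]; abel
  have hzp : primInt τ n z = primInt τ n y := by rw [hz, map_add, primInt_atomVec, add_zero]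
  -- The velocity x' is z extended to the right by the constant f(0), plus e. All discontinuity sits
  -- in the first part, which the shift semigroup handles; e is continuous and vanishes for r ≤ 0.
  set e : C(ℝ, RVec n) := ⟨fun r => f (max r 0) - f 0, by fun_prop⟩ with he
  have he' : ∀ r, e r = f (max r 0) - f 0 := fun _ => rfl
  have hxc : x 0 = c := by rw [← seg_hzero (τ := τ) x 0, hx0, prim_hzero]
  have hseg : ∀ t, 0 ≤ t →
      seg τ x t = prim c 0 + seg τ (histPrim z) t + seg τ (primExt e) t := by
    intro t ht
    ext1 θ
    simp only [ContinuousMap.add_apply, seg_apply, prim_apply, map_zero, ContinuousMap.zero_apply,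
      add_zero]
    rcases le_total (t + θ) 0 with h | h
    · set η : Hist τ := ⟨t + θ, by linarith [θ.2.1], h⟩ with hη
      have h1 : x (t + θ) = c + primInt τ n y η := by
        have := congrArg (fun ψ : C(Hist τ, RVec n) => ψ η) hx0
        simpa [seg_apply, prim_apply, hη] using this
      have h2 : histPrim z (t + θ) = primInt τ n z η := histPrim_of_mem z η
      have h3 : primExt e (t + θ) = 0 := by
        rw [primExt_apply]
        refine intervalIntegral.integral_zero_ae (ae_of_all _ fun r hr => ?_)
        rw [uIoc_of_ge h] at hr
        rw [he', max_eq_right hr.2, sub_self]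
      rw [h1, h2, h3, hzp, add_zero]
    · have h3 : primExt e (t + θ) = (∫ r in 0..(t + θ : ℝ), f r) - (t + θ : ℝ) • f 0 := by
        have : ∫ r in 0..(t + θ : ℝ), e r = ∫ r in 0..(t + θ : ℝ), (f r - f 0) := by
          refine intervalIntegral.integral_congr fun r hr => ?_
          rw [uIcc_of_le h] at hr
          rw [he', max_eq_left hr.1]
        rw [primExt_apply, this, intervalIntegral.integral_sub (hfc.intervalIntegrable _ _)
          (continuous_const.intervalIntegrable _ _), intervalIntegral.integral_const, sub_zero]
      rw [hx _ h, hxc, histPrim_of_nonneg _ h, hz0, h3]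
      abel
  set D : ℝ → HSpace τ n := fun t => histShift t z + embC τ n (seg τ e t) with hD
  have hDc : ContinuousOn D (Ici 0) := (continuousOn_evol delayCoeff_zero z).add
    ((embC τ n).continuous.comp (continuous_seg (τ := τ) e)).continuousOn
  have hint : ∀ t, 0 ≤ t →
      embC τ n (seg τ x t) = embC τ n (seg τ x 0) + ∫ r in 0..t, D r := by
    intro t ht
    have hi : Continuous fun r => embC τ n (seg τ e r) :=
      (embC τ n).continuous.comp (continuous_seg (τ := τ) e)
    have hi2 : IntervalIntegrable (fun r => histShift r z) volume 0 t :=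
      intervalIntegrable_evol delayCoeff_zero z ht
    have hDi : ∫ r in 0..t, D r =
        (∫ r in 0..t, histShift r z) + ∫ r in 0..t, embC τ n (seg τ e r) :=
      intervalIntegral.integral_add hi2 (hi.intervalIntegrable _ _)
    rw [hseg t ht, hseg 0 le_rfl, hDi]
    simp only [map_add]
    rw [embC_seg_histPrim z ht, seg_primExt e t, map_add, ← (embC τ n).intervalIntegral_comp_comm
      ((continuous_seg (τ := τ) e).intervalIntegrable 0 t)]
    abel
  refine ⟨D, hDc, fun t ht => hasDerivWithinAt_of_eq_integral hDc hint ht, fun t ht => ?_,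
    fun t ht => ?_⟩
  · have h1 : x t = c + histPrim z t + primExt e t := by
      have := congrArg (fun ψ : C(Hist τ, RVec n) => ψ (hzero τ)) (hseg t ht)
      simpa only [ContinuousMap.add_apply, seg_hzero, prim_hzero] using this
    have h2 : D t = 0 + histShift t z + embC τ n (seg τ e t) := by rw [zero_add]
    rw [hseg t ht, h1, h2, prim_add, prim_add, ← seg_histPrim_eq_prim z ht, ← seg_primExt_eq_prim]
  · rw [hD, map_add, atomEval_histShift _ ht, hz0, atomEval_embC, seg_hzero, he', max_eq_left ht]
    abel

/-- The averages t⁻¹ ∫₀ᵗ S(r)v dr of the shift semigroup S tend to v. They are difference quotients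
of segments of `histPrim v`, hence primitives. -/
theorem dense_prim : Dense {φ : HSpace τ n | ∃ c y, φ = embC τ n (prim c y)} := by
  intro v
  have hc : ContinuousOn (fun t => histShift t v) (Ici 0) := continuousOn_evol delayCoeff_zero v
  have hd := hasDerivWithinAt_of_eq_integral (F := fun t => embC τ n (seg τ (histPrim v) t)) hc
    (fun t ht => embC_seg_histPrim v ht) le_rfl
  rw [hasDerivWithinAt_iff_tendsto_slope, Ici_sdiff_left] at hd
  have h0 : histShift 0 v = v := evol_zero delayCoeff_zero v
  rw [h0] at hd
  refine mem_closure_of_tendsto hd ?_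
  filter_upwards [self_mem_nhdsWithin] with t ht
  have ht0 : (0 : ℝ) ≤ t := le_of_lt ht
  refine ⟨(t - 0)⁻¹ • (histPrim v t - histPrim v 0), (t - 0)⁻¹ • (histShift t v - histShift 0 v), ?_⟩
  rw [prim_smul, prim_sub, ← seg_histPrim_eq_prim v ht0, ← seg_histPrim_eq_prim v le_rfl, map_smul,
    map_sub, slope, vsub_eq_sub]

end Regularity

/-! ### The semigroup generated by `A` and the solutions of the nonautonomous equation -/

section Solutions

variable {n : ℕ} {κ : ℝ} {L : ℝ → C(Hist τ, RVec n) →L[ℝ] RVec n}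
  {Atil : C(Hist τ, RVec n) →L[ℝ] RVec n}

theorem hist_ext {φ ψ : HSpace τ n} (h : ∀ᵐ θ ∂leb τ, φ θ = ψ θ)
    (h0 : φ (hzero τ) = ψ (hzero τ)) : φ = ψ :=
  Lp.ext ((ae_histMeasure_iff _).2 ⟨h, h0⟩)

/-- `v ↦ atomVec v` as a continuous linear map. -/
def atomVecL (τ : ℝ) [Fact (0 < τ)] (n : ℕ) : RVec n →L[ℝ] HSpace τ n :=
  LinearMap.toContinuousLinearMap
    { toFun := atomVec
      map_add' := fun v w => by
        have h := (ae_histMeasure_iff _).1 (Lp.coeFn_add (atomVec v : HSpace τ n) (atomVec w))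
        refine hist_ext ?_ ?_
        · filter_upwards [h.1, (coeFn_atomVec v).1, (coeFn_atomVec w).1, (coeFn_atomVec (v + w)).1]
            with θ h1 h2 h3 h4
          rw [h1, h4, Pi.add_apply, h2, h3, add_zero]
        · rw [h.2, Pi.add_apply, (coeFn_atomVec _).2, (coeFn_atomVec _).2, (coeFn_atomVec _).2]
      map_smul' := fun c v => by
        have h := (ae_histMeasure_iff _).1 (Lp.coeFn_smul c (atomVec v : HSpace τ n))
        refine hist_ext ?_ ?_
        · filter_upwards [h.1, (coeFn_atomVec v).1, (coeFn_atomVec (c • v)).1] with θ h1 h2 h3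
          rw [RingHom.id_apply, h1, h3, Pi.smul_apply, h2, smul_zero]
        · rw [RingHom.id_apply, h.2, Pi.smul_apply, (coeFn_atomVec _).2, (coeFn_atomVec _).2] }

theorem atomVecL_apply (v : RVec n) : atomVecL τ n v = atomVec v := rfl

theorem prim_add_atomVec (c : RVec n) (y : HSpace τ n) (v : RVec n) :
    prim c (y + atomVec v) = prim c y := by
  ext1 θ
  rw [prim_apply, prim_apply, map_add, primInt_atomVec, add_zero]

theorem eq_prim_of_mem_graph {ψ : C(Hist τ, RVec n)} {y : HSpace τ n}
    (h : (embC τ n ψ, y) ∈ (delayOperator Atil).graph) : ψ = prim (ψ (hzero τ)) y := by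
  have := ((mem_graph_iff_prim Atil _ _).1 h).1
  rw [atomEval_embC] at this
  exact embC_injective this

theorem exists_prim_of_mem_domain {φ : HSpace τ n} (h : φ ∈ (delayOperator Atil).domain) :
    ∃ c y, φ = embC τ n (prim c y) := by
  obtain ⟨y, hy⟩ := LinearPMap.mem_domain_iff.1 h
  exact ⟨_, _, ((mem_graph_iff_prim Atil _ _).1 hy).1⟩

/-- The derivative D of a trajectory has at the atom the value w prescribed by the full coefficient,
whereas A prescribes Ãψ. Subtracting the difference as an atom leaves the primitive intact and
yields Aψ; so D splits into Aψ and the perturbation. -/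
theorem mem_graph_of_prim {c : RVec n} {D : HSpace τ n} {ψ : C(Hist τ, RVec n)} (h : ψ = prim c D)
    {w : RVec n} (hw : atomEval τ n D = w) :
    (embC τ n ψ, D - atomVec (w - Atil ψ)) ∈ (delayOperator Atil).graph := by
  have e : ψ = prim c (D - atomVec (w - Atil ψ)) := by
    rw [sub_eq_add_neg, ← atomVecL_apply, ← map_neg, atomVecL_apply, prim_add_atomVec]
    exact h
  have := mem_graph_prim Atil c (D - atomVec (w - Atil ψ)) (by
    rw [map_sub, atomEval_atomVec, ← e, hw, sub_sub_cancel])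
  rwa [← e] at this

/-- The right derivative at 0 of an orbit starting in the domain of A. With L = Ã the atom term
vanishes and this is the generator; for shifted coefficients it matches the right side of (1) at
later times. -/
theorem hasDerivWithinAt_evol (hL : DelayCoeff κ L) {ψ : C(Hist τ, RVec n)} {y : HSpace τ n}
    (h : (embC τ n ψ, y) ∈ (delayOperator Atil).graph) :
    HasDerivWithinAt (fun t => evol L t (embC τ n ψ)) (y + atomVec (L 0 ψ - Atil ψ)) (Ici 0) 0 := by
  obtain ⟨x, hx0, hx⟩ := exists_isTraj hL ψ
  obtain ⟨D, -, hD, hDp, hDa⟩ := hx.exists_derivative hL (hx0.trans (eq_prim_of_mem_graph h))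
  have h1 := hDp 0 le_rfl
  have h2 := hDa 0 le_rfl
  rw [hx0] at h1 h2
  have h3 := mem_graph_of_prim (Atil := Atil) h1 h2
  have h4 : y = D 0 - atomVec (L 0 ψ - Atil ψ) := LinearPMap.mem_graph_snd_inj _ h h3 rfl
  rw [h4, sub_add_cancel]
  have e : ∀ t ∈ Ici (0 : ℝ), evol L t (embC τ n ψ) = embC τ n (seg τ x t) := fun t ht => by
    rw [← hx0]; exact evol_apply hL hx ht
  exact (hD 0 le_rfl).congr e (e 0 self_mem_Ici)

theorem exists_delayCoeff_const (Atil : C(Hist τ, RVec n) →L[ℝ] RVec n) :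
    ∃ κ, DelayCoeff κ fun _ => Atil := by
  -- With N = 0 there is no perturbation; Ã in the place of C is only a filler.
  have h := delayCoeff_perturbed (Atil := Atil) (C := Atil) (N := fun _ => 0) (Λ := 0)
    (ContinuousLinearMap.opNorm_nonneg _) (ContinuousLinearMap.opNorm_nonneg _) Atil.le_opNorm
    Atil.le_opNorm continuous_const (by simp)
  simp only [ContinuousLinearMap.zero_comp, add_zero] at h
  exact ⟨_, h⟩

theorem isC0Semigroup_evol (Atil : C(Hist τ, RVec n) →L[ℝ] RVec n) :
    IsC0Semigroup fun t : ℝ≥0 => evol (fun _ => Atil) (t : ℝ) := by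
  obtain ⟨κ, hL⟩ := exists_delayCoeff_const Atil
  refine ⟨?_, fun t s => ?_, fun v => ?_⟩
  · ext1 v
    exact evol_zero hL v
  · ext1 v
    rw [add_comm, NNReal.coe_add]
    exact evol_add hL s.2 t.2 v
  · exact (continuousOn_evol hL v).comp_continuous NNReal.continuous_coe fun t => t.2

theorem tendsto_of_hasDerivWithinAt {E : Type*} [NormedAddCommGroup E] [NormedSpace ℝ E] {F : ℝ → E}
    {y : E} (h : HasDerivWithinAt F y (Ici 0) 0) :
    Tendsto (fun h : ℝ≥0 => (h : ℝ)⁻¹ • (F h - F 0)) (𝓝[>] 0) (𝓝 y) := by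
  rw [hasDerivWithinAt_iff_tendsto_slope, Ici_sdiff_left] at h
  have hc : Tendsto (fun t : ℝ≥0 => (t : ℝ)) (𝓝[>] 0) (𝓝[>] 0) :=
    tendsto_nhdsWithin_iff.2 ⟨(NNReal.continuous_coe.tendsto 0).mono_left nhdsWithin_le_nhds, by
      filter_upwards [self_mem_nhdsWithin] with t ht
      exact NNReal.coe_pos.2 ht⟩
  refine (h.comp hc).congr fun t => ?_
  simp [slope]

/-- Integration commutes with the quotient map by S, under which the integrand vanishes. -/
theorem intervalIntegral_mem_of_isClosed {E : Type*} [NormedAddCommGroup E] [NormedSpace ℝ E]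
    [CompleteSpace E] (S : Submodule ℝ E) (hS : IsClosed (S : Set E)) {g : ℝ → E} {t : ℝ}
    (ht : 0 ≤ t) (hg : ContinuousOn g (Icc 0 t)) (h : ∀ s ∈ Icc 0 t, g s ∈ S) :
    ∫ s in 0..t, g s ∈ S := by
  have hi : IntervalIntegrable g volume 0 t := by
    rw [← uIcc_of_le ht] at hg
    exact hg.intervalIntegrable
  have := S.mkQL.intervalIntegral_comp_comm hi
  have e : ∫ s in 0..t, S.mkQL (g s) = 0 := by
    rw [intervalIntegral.integral_congr (g := fun _ => 0), intervalIntegral.integral_zero]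
    intro s hs
    rw [uIcc_of_le ht] at hs
    exact (Submodule.Quotient.mk_eq_zero S).2 (h s hs)
  rw [e] at this
  exact (Submodule.Quotient.mk_eq_zero S).1 this.symm

/-- If v is a primitive, the pairs of orbit and derivative lie in the graph for all times, and
integrating them over [0, t] gives the claim. Closedness of the graph and density of primitives
extend it to all v. -/
theorem integral_evol_mem_graph (Atil : C(Hist τ, RVec n) →L[ℝ] RVec n) {t : ℝ} (ht : 0 ≤ t)
    (v : HSpace τ n) :
    (∫ r in 0..t, evol (fun _ => Atil) r v, evol (fun _ => Atil) t v - v) ∈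
      (delayOperator Atil).graph := by
  obtain ⟨κ, hL⟩ := exists_delayCoeff_const Atil
  have hcl : IsClosed {v : HSpace τ n | (∫ r in 0..t, evol (fun _ => Atil) r v,
      evol (fun _ => Atil) t v - v) ∈ (delayOperator Atil).graph} :=
    (isClosed_graph Atil).preimage ((continuous_integral_evol hL ht).prodMk (by fun_prop))
  refine hcl.closure_subset_iff.2 ?_ (dense_prim v)
  rintro _ ⟨c, y, rfl⟩
  obtain ⟨x, hx0, hx⟩ := exists_isTraj hL (prim c y)
  obtain ⟨D, hDc, hD, hDp, hDa⟩ := hx.exists_derivative hL hx0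
  have e : ∀ r, 0 ≤ r → evol (fun _ => Atil) r (embC τ n (prim c y)) = embC τ n (seg τ x r) :=
    fun r hr => by rw [← hx0]; exact evol_apply hL hx hr
  have hg : ContinuousOn (fun r => (embC τ n (seg τ x r), D r)) (Icc 0 t) :=
    ((embC τ n).continuous.comp (continuous_seg x)).continuousOn.prodMk
      (hDc.mono fun r hr => hr.1)
  have hmem : ∀ r ∈ Icc 0 t, (embC τ n (seg τ x r), D r) ∈ (delayOperator Atil).graph := by
    intro r hr
    have := mem_graph_prim Atil (x r) (D r) (by rw [hDa r hr.1, ← hDp r hr.1])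
    rwa [← hDp r hr.1] at this
  have key := intervalIntegral_mem_of_isClosed (delayOperator Atil).graph (isClosed_graph Atil) ht hg hmem
  have hi : IntervalIntegrable (fun r => (embC τ n (seg τ x r), D r)) volume 0 t := by
    rw [← uIcc_of_le ht] at hg
    exact hg.intervalIntegrable
  have h1 := (ContinuousLinearMap.fst ℝ (HSpace τ n) (HSpace τ n)).intervalIntegral_comp_comm hi
  have h2 := (ContinuousLinearMap.snd ℝ (HSpace τ n) (HSpace τ n)).intervalIntegral_comp_comm hi
  simp only [ContinuousLinearMap.coe_fst', ContinuousLinearMap.coe_snd'] at h1 h2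
  have h3 : ∫ r in 0..t, D r = embC τ n (seg τ x t) - embC τ n (seg τ x 0) :=
    intervalIntegral.integral_eq_sub_of_hasDeriv_right_of_le ht
      ((embC τ n).continuous.comp (continuous_seg x)).continuousOn
      (fun r hr => (hD r hr.1.le).mono (Ioi_subset_Ici hr.1.le))
      (by
        refine ContinuousOn.intervalIntegrable (hDc.mono ?_)
        rw [uIcc_of_le ht]
        exact fun r hr => hr.1)
  have h4 : ∫ r in 0..t, evol (fun _ => Atil) r (embC τ n (prim c y)) =
      ∫ r in 0..t, embC τ n (seg τ x r) := by
    refine intervalIntegral.integral_congr fun r hr => ?_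
    rw [uIcc_of_le ht] at hr
    exact e r hr.1
  have e5 : (∫ r in 0..t, evol (fun _ => Atil) r (embC τ n (prim c y)),
      evol (fun _ => Atil) t (embC τ n (prim c y)) - embC τ n (prim c y)) =
      ∫ r in 0..t, (embC τ n (seg τ x r), D r) := by
    refine Prod.ext ?_ ?_
    · exact h4.trans h1
    · rw [← h2, h3, hx0]
      exact congrArg (· - _) (e t ht)
  rw [← e5] at key
  exact key

/-- That the generator extends A is `hasDerivWithinAt_evol`. Conversely, (φ, y) in the graph of the
generator is the limit of the pairs h⁻¹(∫₀ʰ G(r)φ dr, G(h)φ - φ), which lie in the closed graph of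
A. -/
theorem generator_evol (Atil : C(Hist τ, RVec n) →L[ℝ] RVec n) :
    generator (fun t : ℝ≥0 => evol (fun _ => Atil) (t : ℝ)) = delayOperator Atil := by
  obtain ⟨κ, hL⟩ := exists_delayCoeff_const Atil
  refine LinearPMap.eq_of_eq_graph (Submodule.ext fun p => ?_)
  obtain ⟨φ, y⟩ := p
  rw [mem_graph_generator]
  constructor
  · intro h
    have hint := hasDerivWithinAt_of_eq_integral (F := fun t => ∫ r in 0..t, evol (fun _ => Atil) r φ)
      (continuousOn_evol hL φ) (fun t _ => by simp) le_rfl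
    rw [evol_zero hL] at hint
    have h2 := tendsto_of_hasDerivWithinAt hint
    refine (isClosed_graph Atil).mem_of_tendsto (h2.prodMk_nhds h) (Eventually.of_forall fun t => ?_)
    have := (delayOperator Atil).graph.smul_mem ((t : ℝ)⁻¹) (integral_evol_mem_graph Atil t.2 φ)
    simpa using this
  · intro h
    obtain ⟨ψ, rfl, -⟩ := (mem_graph_delayOperator _ _ _).1 h
    have h1 := tendsto_of_hasDerivWithinAt (hasDerivWithinAt_evol hL h)
    rw [sub_self, ← atomVecL_apply, map_zero, add_zero, evol_zero hL] at h1
    exact h1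

theorem contDiffOn_Ici_of_hasDerivWithinAt {E : Type*} [NormedAddCommGroup E] [NormedSpace ℝ E]
    {F D : ℝ → E} (hc : ContinuousOn D (Ici 0))
    (h : ∀ t, 0 ≤ t → HasDerivWithinAt F (D t) (Ici 0) t) : ContDiffOn ℝ 1 F (Ici 0) := by
  rw [contDiffOn_one_iff_derivWithin (uniqueDiffOn_Ici 0)]
  exact ⟨fun t ht => (h t ht).differentiableWithinAt,
    hc.congr fun t ht => (h t ht).derivWithin (uniqueDiffOn_Ici 0 t ht)⟩

variable {P U M : Type*} [TopologicalSpace P]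
  [NormedAddCommGroup U] [InnerProductSpace ℝ U]
  [NormedAddCommGroup M] [InnerProductSpace ℝ M]
  {Btil : U →L[ℝ] RVec n} {C : C(Hist τ, RVec n) →L[ℝ] M}
  {π : Flow ℝ≥0 P} {F' : P → M →L[ℝ] U} {p : P} {ξ : ℝ → HSpace τ n}

/-- The functionals `Ã + B̃ F'(π^t(p)) C`. -/
def solCoeff (Atil : C(Hist τ, RVec n) →L[ℝ] RVec n) (Btil : U →L[ℝ] RVec n)
    (C : C(Hist τ, RVec n) →L[ℝ] M) (π : Flow ℝ≥0 P) (F' : P → M →L[ℝ] U) (p : P) (t : ℝ) :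
    C(Hist τ, RVec n) →L[ℝ] RVec n :=
  Atil + (Btil ∘L F' (π t.toNNReal p)) ∘L C

theorem solCoeff_sub (t : ℝ) (ψ : C(Hist τ, RVec n)) :
    solCoeff Atil Btil C π F' p t ψ - Atil ψ = Btil (F' (π t.toNNReal p) (C ψ)) :=
  add_sub_cancel_left _ _

theorem exists_delayCoeff_solCoeff [FiniteDimensional ℝ M] (Atil : C(Hist τ, RVec n) →L[ℝ] RVec n)
    (Btil : U →L[ℝ] RVec n) (C : C(Hist τ, RVec n) →L[ℝ] M) (π : Flow ℝ≥0 P) {F' : P → M →L[ℝ] U}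
    (hF' : Continuous F') {Λ : ℝ} (hΛ : ∀ p, ‖F' p‖ ≤ Λ) (p : P) :
    ∃ κ, DelayCoeff κ (solCoeff Atil Btil C π F' p) := by
  refine ⟨_, delayCoeff_perturbed (Λ := ‖Btil‖ * Λ)
    (ContinuousLinearMap.opNorm_nonneg _) (ContinuousLinearMap.opNorm_nonneg _) Atil.le_opNorm
    C.le_opNorm ?_ fun s => ?_⟩
  · refine continuous_const.clm_comp (hF'.comp (π.continuous ?_ continuous_const))
    exact continuous_real_toNNReal
  · exact (ContinuousLinearMap.opNorm_comp_le _ _).trans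
      (mul_le_mul_of_nonneg_left (hΛ _) (norm_nonneg _))

theorem isClassicalSolution_seg (hL : DelayCoeff κ (solCoeff Atil Btil C π F' p)) {x : C(ℝ, RVec n)}
    (hx : IsTraj (solCoeff Atil Btil C π F' p) x) {c : RVec n} {y : HSpace τ n}
    (hx0 : seg τ x 0 = prim c y) :
    IsClassicalSolution Atil Btil C π F' p fun t => embC τ n (seg τ x t) := by
  obtain ⟨D, hDc, hD, hDp, hDa⟩ := hx.exists_derivative hL hx0
  have hs := continuous_seg (τ := τ) x
  have hmem := fun t (ht : 0 ≤ t) => mem_graph_of_prim (Atil := Atil) (hDp t ht) (hDa t ht)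
  refine ⟨contDiffOn_Ici_of_hasDerivWithinAt hDc hD, ⟨?_, _, ?_, hmem⟩, fun t ht =>
    ⟨_, _, hmem t ht, rfl, ?_⟩⟩
  · exact ((embC τ n).continuous.comp hs).continuousOn
  · refine hDc.sub (Continuous.continuousOn ?_)
    exact (atomVecL τ n).continuous.comp ((hL.continuous_seg x).sub (Atil.continuous.comp hs))
  · rw [← solCoeff_sub (Atil := Atil), sub_add_cancel]
    exact hD t ht

theorem IsClassicalSolution.eq_evol (hL : DelayCoeff κ (solCoeff Atil Btil C π F' p))
    (hξ : IsClassicalSolution Atil Btil C π F' p ξ) {t : ℝ} (ht : 0 ≤ t) :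
    ξ t = evol (solCoeff Atil Btil C π F' p) t (ξ 0) := by
  -- At each time the equation and the evolution started from ξ(s) give the same velocity.
  have heq : ∀ s, ∃ D, 0 ≤ s → HasDerivWithinAt ξ D (Ici 0) s ∧ HasDerivWithinAt
      (fun h => evol (fun r => solCoeff Atil Btil C π F' p (s + r)) h (ξ s)) D (Ici 0) 0 := by
    intro s
    by_cases hs : 0 ≤ s
    · obtain ⟨y, ψ, h1, h2, h3⟩ := hξ.equation s hs
      refine ⟨_, fun _ => ⟨h3, ?_⟩⟩
      rw [h2] at h1 ⊢
      have := hasDerivWithinAt_evol (hL.shift s) h1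
      rwa [add_zero, solCoeff_sub] at this
    · exact ⟨0, fun h => absurd h hs⟩
  choose D hD using heq
  exact eq_evol_of_hasDerivWithinAt hL hξ.contDiffOn.continuousOn D
    (fun s hs => (hD s hs).1.mono (Ici_subset_Ici.2 hs)) (fun s hs => (hD s hs).2) ht

theorem IsSolution.eq_evol (hL : DelayCoeff κ (solCoeff Atil Btil C π F' p))
    (hξ : IsSolution Atil Btil C π F' p ξ) {t : ℝ} (ht : 0 ≤ t) :
    ξ t = evol (solCoeff Atil Btil C π F' p) t (ξ 0) := by
  obtain ⟨u, hu, hlim⟩ := hξ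
  have h1 := (hlim t).tendsto_at ⟨ht, le_rfl⟩
  have h0 := (hlim t).tendsto_at ⟨le_rfl, ht⟩
  refine tendsto_nhds_unique h1 ?_
  refine (((evol (solCoeff Atil Btil C π F' p) t).continuous.tendsto _).comp h0).congr fun l => ?_
  exact ((hu l).eq_evol hL ht).symm

/-- The initial value is approximated by primitives, whose orbits are classical; the growth bound
makes the convergence uniform on [0, T]. -/
theorem isSolution_evol (hL : DelayCoeff κ (solCoeff Atil Btil C π F' p)) (v : HSpace τ n) :
    IsSolution Atil Btil C π F' p fun t => evol (solCoeff Atil Btil C π F' p) (t.toNNReal : ℝ) v := by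
  obtain ⟨w, hw, hlim⟩ := mem_closure_iff_seq_limit.1 (dense_prim v)
  choose c y hcy using hw
  choose x hx0 hx using fun l => exists_isTraj hL (prim (c l) (y l))
  refine ⟨fun l t => embC τ n (seg τ (x l) t), fun l => isClassicalSolution_seg hL (hx l) (hx0 l),
    fun T => ?_⟩
  rw [Metric.tendstoUniformlyOn_iff]
  intro ε hε
  rcases lt_or_ge T 0 with hT | hT
  · simp [Icc_eq_empty (not_le.2 hT)]
  have hg := one_le_growth hL.nonneg hT
  filter_upwards [Metric.tendsto_nhds.1 hlim (ε / growth κ T) (by positivity)] with l hl t ht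
  have e : embC τ n (seg τ (x l) t) = evol (solCoeff Atil Btil C π F' p) t (w l) := by
    rw [hcy l, ← hx0 l]
    exact (evol_apply hL (hx l) ht.1).symm
  rw [e, Real.coe_toNNReal t ht.1, dist_comm, dist_eq_norm, ← map_sub]
  refine (norm_evol_apply_le hL ht.1 _).trans_lt ?_
  calc _ ≤ growth κ T * ‖w l - v‖ :=
        mul_le_mul_of_nonneg_right (growth_mono hL.nonneg ht.2) (norm_nonneg _)
    _ < growth κ T * (ε / growth κ T) := by
        rw [← dist_eq_norm]
        exact mul_lt_mul_of_pos_left hl (by positivity)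
    _ = ε := by field_simp

/-- A solution starting in the domain of `A` is classical and consists of segments of a function. -/
theorem IsSolution.exists_seg (hL : DelayCoeff κ (solCoeff Atil Btil C π F' p))
    (hξ : IsSolution Atil Btil C π F' p ξ) (h0 : ξ 0 ∈ (delayOperator Atil).domain) :
    ContDiffOn ℝ 1 ξ (Ici 0) ∧ ∃ (x : C(ℝ, RVec n)) (y : ℝ → HSpace τ n), (∀ t, 0 ≤ t → ξ t = embC τ n (seg τ x t)) ∧
      ContinuousOn y (Ici 0) ∧ (∀ t, 0 ≤ t → (ξ t, y t) ∈ (delayOperator Atil).graph) ∧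
      ∀ t, 0 ≤ t → HasDerivWithinAt ξ
        (y t + atomVec (Btil (F' (π t.toNNReal p) (C (seg τ x t))))) (Ici 0) t := by
  obtain ⟨c, z, hcz⟩ := exists_prim_of_mem_domain h0
  obtain ⟨x, hx0, hx⟩ := exists_isTraj hL (prim c z)
  have hcl := isClassicalSolution_seg hL hx hx0
  have e : ∀ t, 0 ≤ t → ξ t = embC τ n (seg τ x t) := fun t ht => by
    rw [hξ.eq_evol hL ht, hcz, ← hx0]
    exact evol_apply hL hx ht
  obtain ⟨-, y, hyc, hy⟩ := hcl.continuousInDomain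
  refine ⟨hcl.contDiffOn.congr e, x, y, e, hyc, fun t ht => by rw [e t ht]; exact hy t ht, fun t ht => ?_⟩
  obtain ⟨y', ψ, h1, h2, h3⟩ := hcl.equation t ht
  have h4 : y' = y t := LinearPMap.mem_graph_snd_inj _ h1 (hy t ht) rfl
  rw [← embC_injective h2, h4] at h3
  exact h3.congr (fun s hs => e s hs) (e t ht)

end Solutions

/-! ### Decomposable tensors: multilinearity, norm and product rule -/

variable {n m : ℕ}

theorem tensorVec_update_apply (v : Fin m → RVec n) (j : Fin m) (w : RVec n) (a : Fin m → Fin n) :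
    tensorVec (Function.update v j w) a = w (a j) * ∏ i ∈ Finset.univ.erase j, v i (a i) := by
  simp only [tensorVec]
  rw [← Finset.mul_prod_erase _ _ (Finset.mem_univ j), Function.update_self]
  congr 1
  refine Finset.prod_congr rfl fun i hi => ?_
  rw [Function.update_of_ne (Finset.ne_of_mem_erase hi)]

theorem tensorVec_update_add (v : Fin m → RVec n) (j : Fin m) (x y : RVec n) :
    tensorVec (Function.update v j (x + y)) =
      tensorVec (Function.update v j x) + tensorVec (Function.update v j y) := by
  ext a
  simp only [PiLp.add_apply, tensorVec_update_apply, add_mul]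

theorem tensorVec_update_smul (v : Fin m → RVec n) (j : Fin m) (c : ℝ) (x : RVec n) :
    tensorVec (Function.update v j (c • x)) = c • tensorVec (Function.update v j x) := by
  ext a
  simp only [PiLp.smul_apply, tensorVec_update_apply, smul_eq_mul, mul_assoc]

theorem coeFn_tensor (φ : Fin m → HSpace τ n) :
    tensor φ =ᵐ[Measure.pi fun _ : Fin m => histMeasure τ]
      fun θ => tensorVec fun i => φ i (θ i) :=
  MemLp.coeFn_toLp (memLp_tensor φ)

theorem ae_pi_eval {Q : Hist τ → Prop} (h : ∀ᵐ θ ∂histMeasure τ, Q θ) (i : Fin m) :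
    ∀ᵐ θ ∂(Measure.pi fun _ : Fin m => histMeasure τ), Q (θ i) :=
  (Measure.quasiMeasurePreserving_eval (fun _ : Fin m => histMeasure τ) i).ae h

theorem inner_tensor (φ ψ : Fin m → HSpace τ n) :
    inner ℝ (tensor φ) (tensor ψ) = ∏ i, inner ℝ (φ i) (ψ i) := by
  simp_rw [L2.inner_def]
  rw [← integral_fintype_prod_eq_prod (f := fun i θ => (inner ℝ (φ i θ) (ψ i θ) : ℝ))]
  refine integral_congr_ae ?_
  filter_upwards [coeFn_tensor φ, coeFn_tensor ψ] with θ h1 h2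
  rw [h1, h2, inner_tensorVec]

theorem norm_tensor (φ : Fin m → HSpace τ n) : ‖tensor φ‖ = ∏ i, ‖φ i‖ := by
  rw [← sq_eq_sq₀ (norm_nonneg _) (Finset.prod_nonneg fun _ _ => norm_nonneg _),
    ← real_inner_self_eq_norm_sq, inner_tensor, ← Finset.prod_pow]
  simp

theorem update_coeFn_apply (φ : Fin m → HSpace τ n) (j : Fin m) (x : HSpace τ n)
    (θ : Fin m → Hist τ) :
    (fun i => Function.update φ j x i (θ i)) = Function.update (fun i => φ i (θ i)) j (x (θ j)) := by
  ext1 i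
  rcases eq_or_ne i j with rfl | h
  · simp
  · simp [h]

theorem tensor_update_add (φ : Fin m → HSpace τ n) (j : Fin m) (x y : HSpace τ n) :
    tensor (Function.update φ j (x + y)) =
      tensor (Function.update φ j x) + tensor (Function.update φ j y) := by
  refine Lp.ext ?_
  filter_upwards [coeFn_tensor (Function.update φ j (x + y)),
    coeFn_tensor (Function.update φ j x), coeFn_tensor (Function.update φ j y),
    ae_pi_eval (Lp.coeFn_add x y) j,
    Lp.coeFn_add (tensor (Function.update φ j x)) (tensor (Function.update φ j y))]
    with θ h1 h2 h3 h4 h5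
  rw [h5, Pi.add_apply, h1, h2, h3, update_coeFn_apply, update_coeFn_apply, update_coeFn_apply, h4]
  exact tensorVec_update_add _ _ _ _

theorem tensor_update_smul (φ : Fin m → HSpace τ n) (j : Fin m) (c : ℝ) (x : HSpace τ n) :
    tensor (Function.update φ j (c • x)) = c • tensor (Function.update φ j x) := by
  refine Lp.ext ?_
  filter_upwards [coeFn_tensor (Function.update φ j (c • x)),
    coeFn_tensor (Function.update φ j x), ae_pi_eval (Lp.coeFn_smul c x) j,
    Lp.coeFn_smul c (tensor (Function.update φ j x))] with θ h1 h2 h4 h5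
  rw [h5, Pi.smul_apply, h1, h2, update_coeFn_apply, update_coeFn_apply, h4]
  exact tensorVec_update_smul _ _ _ _

/-- The tensor product as a multilinear map. -/
def tensorM (τ : ℝ) [Fact (0 < τ)] (n m : ℕ) :
    MultilinearMap ℝ (fun _ : Fin m => HSpace τ n) (LSpace τ n m) :=
  MultilinearMap.mk' tensor tensor_update_add tensor_update_smul

/-- The tensor product as a continuous multilinear map. -/
def tensorCM (τ : ℝ) [Fact (0 < τ)] (n m : ℕ) :
    ContinuousMultilinearMap ℝ (fun _ : Fin m => HSpace τ n) (LSpace τ n m) :=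
  (tensorM τ n m).mkContinuous 1 fun φ => by rw [one_mul]; exact (norm_tensor φ).le

theorem continuous_tensor : Continuous (tensor : (Fin m → HSpace τ n) → LSpace τ n m) :=
  (tensorCM τ n m).cont

theorem hasDerivWithinAt_tensor {ξ : Fin m → ℝ → HSpace τ n} {D : Fin m → HSpace τ n}
    {s : Set ℝ} {t : ℝ} (h : ∀ j, HasDerivWithinAt (ξ j) (D j) s t) :
    HasDerivWithinAt (fun r => tensor fun j => ξ j r)
      (∑ j, tensor (Function.update (fun i => ξ i t) j (D j))) s t := by
  have h1 := ((tensorCM τ n m).hasFDerivAt (fun i => ξ i t)).comp_hasDerivWithinAt t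
    (hasDerivWithinAt_pi.2 h)
  rw [ContinuousMultilinearMap.linearDeriv_apply] at h1
  exact h1

/-! ### Density of the linear span of the decomposable tensors -/

theorem tensor_indicatorConstLp {s : Fin m → Set (Hist τ)} (hs : ∀ i, MeasurableSet (s i))
    (a : Fin m → Fin n) :
    tensor (fun i => indicatorConstLp 2 (hs i) (measure_ne_top (histMeasure τ) _)
      (EuclideanSpace.single (a i) (1 : ℝ))) =
    indicatorConstLp 2 (MeasurableSet.univ_pi hs)
      (measure_ne_top (Measure.pi fun _ : Fin m => histMeasure τ) _)
      (EuclideanSpace.single a (1 : ℝ)) := by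
  refine Lp.ext ?_
  have h : ∀ᵐ θ ∂(Measure.pi fun _ : Fin m => histMeasure τ), ∀ i : Fin m,
      indicatorConstLp 2 (hs i) (measure_ne_top (histMeasure τ) _)
        (EuclideanSpace.single (a i) (1 : ℝ)) (θ i) =
        (s i).indicator (fun _ => EuclideanSpace.single (a i) (1 : ℝ)) (θ i) :=
    eventually_all.2 fun i => ae_pi_eval indicatorConstLp_coeFn i
  filter_upwards [coeFn_tensor (fun i => indicatorConstLp 2 (hs i)
      (measure_ne_top (histMeasure τ) _) (EuclideanSpace.single (a i) (1 : ℝ))), h,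
    indicatorConstLp_coeFn (p := 2) (hs := MeasurableSet.univ_pi hs)
      (hμs := measure_ne_top (Measure.pi fun _ : Fin m => histMeasure τ) _)
      (c := EuclideanSpace.single a (1 : ℝ))] with θ h1 h2 h3
  rw [h1, h3]
  simp only [h2]
  ext b
  simp only [tensorVec]
  by_cases hθ : θ ∈ univ.pi s
  · rw [indicator_of_mem hθ]
    have : ∀ i, θ i ∈ s i := fun i => hθ i (mem_univ i)
    simp only [indicator_of_mem (this _), PiLp.single_apply]
    by_cases hb : b = a
    · subst hb; simp
    · rw [if_neg hb]
      obtain ⟨i, hi⟩ := Function.ne_iff.1 hb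
      exact Finset.prod_eq_zero (Finset.mem_univ i) (by simp [hi])
  · rw [indicator_of_notMem hθ]
    simp only [Set.mem_pi, mem_univ, true_imp_iff, not_forall] at hθ
    obtain ⟨i, hi⟩ := hθ
    exact Finset.prod_eq_zero (Finset.mem_univ i) (by simp [indicator_of_notMem hi])

/-- The indicator of a measurable rectangle times a basis vector is decomposable, so every component
of Φ integrates to 0 over rectangles. Rectangles form a π-system that generates the σ-algebra, and
the whole cube is one of them, so all measurable sets follow. -/
theorem eq_zero_of_inner_tensor {Φ : LSpace τ n m} (h : ∀ φ, inner ℝ (tensor φ) Φ = 0) : Φ = 0 := by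
  have hrect : ∀ (a : Fin m → Fin n) (t : Set (Fin m → Hist τ)) (ht : MeasurableSet t),
      inner ℝ (indicatorConstLp 2 ht (measure_ne_top (Measure.pi fun _ : Fin m => histMeasure τ) _)
        (EuclideanSpace.single a (1 : ℝ))) Φ = 0 := by
    intro a t ht
    have hint : Integrable (fun θ => Φ θ a) (Measure.pi fun _ : Fin m => histMeasure τ) := by
      have h1 : Integrable Φ (Measure.pi fun _ : Fin m => histMeasure τ) :=
        (Lp.memLp Φ).integrable (by norm_num)
      exact (PiLp.proj 2 (𝕜 := ℝ) (fun _ : Fin m → Fin n => ℝ) a).integrable_comp h1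
    have hval : ∀ (t : Set (Fin m → Hist τ)) (ht : MeasurableSet t),
      inner ℝ (indicatorConstLp 2 ht (measure_ne_top (Measure.pi fun _ : Fin m => histMeasure τ) _)
        (EuclideanSpace.single a (1 : ℝ))) Φ =
        ∫ θ in t, Φ θ a ∂(Measure.pi fun _ : Fin m => histMeasure τ) := by
      intro t ht
      rw [L2.inner_indicatorConstLp_eq_inner_setIntegral, ← integral_inner]
      · simp [EuclideanSpace.inner_single_left]
      · exact ((Lp.memLp Φ).integrable (by norm_num)).integrableOn
    rw [hval]
    refine MeasurableSpace.induction_on_inter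
      (C := fun t _ => ∫ θ in t, Φ θ a ∂(Measure.pi fun _ : Fin m => histMeasure τ) = 0)
      generateFrom_pi.symm isPiSystem_pi (by simp) ?_ ?_ ?_ t ht
    · rintro _ ⟨s, hs, rfl⟩
      have hs' : ∀ i, MeasurableSet (s i) := fun i => hs i (mem_univ i)
      rw [← hval _ (MeasurableSet.univ_pi hs'), ← tensor_indicatorConstLp hs' a, h]
    · intro t ht h0
      have huniv := h (fun i => indicatorConstLp 2 MeasurableSet.univ
        (measure_ne_top (histMeasure τ) _) (EuclideanSpace.single (a i) (1 : ℝ)))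
      rw [tensor_indicatorConstLp, hval] at huniv
      simp only [Set.pi_univ, setIntegral_univ] at huniv
      have := integral_add_compl ht hint
      rw [h0, huniv] at this
      simpa using this
    · intro f hd hf h0
      rw [integral_iUnion hf hd hint.integrableOn]
      simp [h0]
  have hae : ∀ a : Fin m → Fin n,
      (fun θ => Φ θ a) =ᵐ[Measure.pi fun _ : Fin m => histMeasure τ] 0 := by
    intro a
    have hint : Integrable (fun θ => Φ θ a) (Measure.pi fun _ : Fin m => histMeasure τ) := by
      have h1 : Integrable Φ (Measure.pi fun _ : Fin m => histMeasure τ) :=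
        (Lp.memLp Φ).integrable (by norm_num)
      exact (PiLp.proj 2 (𝕜 := ℝ) (fun _ : Fin m → Fin n => ℝ) a).integrable_comp h1
    refine hint.ae_eq_zero_of_forall_setIntegral_eq_zero fun t ht _ => ?_
    have := hrect a t ht
    rw [L2.inner_indicatorConstLp_eq_inner_setIntegral, ← integral_inner] at this
    · simpa [EuclideanSpace.inner_single_left] using this
    · exact ((Lp.memLp Φ).integrable (by norm_num)).integrableOn
  refine Lp.ext ?_
  filter_upwards [eventually_all.2 hae, Lp.coeFn_zero (TPow n m) 2 (Measure.pi fun _ : Fin m => histMeasure τ)] with θ h1 h2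
  rw [h2]
  ext a
  exact h1 a

/-- The linear map from formal combinations of decomposable tensors. -/
abbrev tensorComb (L : HSpace τ n →L[ℝ] HSpace τ n) :
    ((Fin m → HSpace τ n) →₀ ℝ) →ₗ[ℝ] LSpace τ n m :=
  Finsupp.linearCombination ℝ fun φ => tensor fun i => L (φ i)

theorem denseRange_tensorComb :
    DenseRange (tensorComb (m := m) (ContinuousLinearMap.id ℝ (HSpace τ n))) := by
  have h : (LinearMap.range (tensorComb (m := m)
      (ContinuousLinearMap.id ℝ (HSpace τ n)))).topologicalClosure = ⊤ := by
    rw [Submodule.topologicalClosure_eq_top_iff, Submodule.eq_bot_iff]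
    intro Φ hΦ
    refine eq_zero_of_inner_tensor fun φ => ?_
    refine (Submodule.mem_orthogonal _ _).1 hΦ _ ⟨Finsupp.single φ 1, ?_⟩
    simp
  exact (Submodule.dense_iff_topologicalClosure_eq_top).2 h

/-! ### Compounds -/

/-- The Hadamard product is monotone in the Loewner order on positive semidefinite matrices. In the
induction the difference splits as G_k ∘ (∏G - ∏G') + (G_k - G'_k) ∘ ∏G', and both summands are
positive semidefinite by the Schur product theorem, which is why the two claims are proved together.
-/
theorem posSemidef_prod_sub_prod {ι κ : Type*} [Finite ι] (s : Finset κ) (G G' : κ → Matrix ι ι ℝ)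
    (hG' : ∀ k, (G' k).PosSemidef) (h : ∀ k, (G k - G' k).PosSemidef) :
    (Matrix.of fun a b => ∏ k ∈ s, G' k a b).PosSemidef ∧
    (Matrix.of fun a b => ∏ k ∈ s, G k a b - ∏ k ∈ s, G' k a b).PosSemidef := by
  classical
  induction s using Finset.induction_on with
  | empty =>
    constructor
    · have e : (Matrix.of fun a b => ∏ k ∈ (∅ : Finset κ), G' k a b) =
          Matrix.gram ℝ (fun _ : ι => (1 : ℝ)) := by
        ext a b; simp
      rw [e]
      exact Matrix.posSemidef_gram ℝ _
    · have e : (Matrix.of fun a b => ∏ k ∈ (∅ : Finset κ), G k a b -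
          ∏ k ∈ (∅ : Finset κ), G' k a b) = 0 := by
        ext a b; simp
      rw [e]
      exact Matrix.PosSemidef.zero
  | insert k s hk ih =>
    have hG : (G k).PosSemidef := by simpa using (h k).add (hG' k)
    constructor
    · have e : (Matrix.of fun a b => ∏ k ∈ insert k s, G' k a b) =
          (G' k).hadamard (Matrix.of fun a b => ∏ k ∈ s, G' k a b) := by
        ext a b; simp [Finset.prod_insert hk]
      rw [e]
      exact (hG' k).hadamard ih.1
    · have e : (Matrix.of fun a b => ∏ k ∈ insert k s, G k a b - ∏ k ∈ insert k s, G' k a b) =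
          (G k).hadamard (Matrix.of fun a b => ∏ k ∈ s, G k a b - ∏ k ∈ s, G' k a b) +
          (G k - G' k).hadamard (Matrix.of fun a b => ∏ k ∈ s, G' k a b) := by
        ext a b
        simp [Finset.prod_insert hk]
        ring
      rw [e]
      exact (hG.hadamard ih.2).add ((h k).hadamard ih.1)

theorem norm_sq_tensorComb (L : HSpace τ n →L[ℝ] HSpace τ n) (x : (Fin m → HSpace τ n) →₀ ℝ) :
    ‖tensorComb L x‖ ^ 2 = ∑ φ : x.support, ∑ ψ : x.support,
      x φ * (∏ i, inner ℝ (L (φ.1 i)) (L (ψ.1 i))) * x ψ := by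
  rw [← real_inner_self_eq_norm_sq, Finsupp.linearCombination_apply, Finsupp.sum, sum_inner,
    ← Finset.sum_coe_sort]
  refine Finset.sum_congr rfl fun φ _ => ?_
  rw [inner_sum, ← Finset.sum_coe_sort]
  refine Finset.sum_congr rfl fun ψ _ => ?_
  rw [real_inner_smul_left, real_inner_smul_right, inner_tensor]
  ring

/-- The squared norm of a combination of tensors is a quadratic form in the Hadamard product of the
Gram matrices of the slots. In each slot the Gram matrix of the images under L is at most ‖L‖² times
the original one. The bound also shows that the image depends only on the tensor, not on the formal
combination representing it. -/
theorem norm_tensorComb_le (L : HSpace τ n →L[ℝ] HSpace τ n) (x : (Fin m → HSpace τ n) →₀ ℝ) :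
    ‖tensorComb L x‖ ≤ ‖L‖ ^ m * ‖tensorComb (ContinuousLinearMap.id ℝ (HSpace τ n)) x‖ := by
  refine (sq_le_sq₀ (norm_nonneg _) (by positivity)).1 ?_
  rw [mul_pow, norm_sq_tensorComb, norm_sq_tensorComb]
  have h := (posSemidef_prod_sub_prod (ι := x.support) (Finset.univ : Finset (Fin m))
    (fun i => ‖L‖ ^ 2 • Matrix.gram ℝ fun φ : x.support => φ.1 i)
    (fun i => Matrix.gram ℝ (L ∘ fun φ : x.support => φ.1 i))
    (fun i => Matrix.posSemidef_gram ℝ _)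
    (fun i => Matrix.posSemidef_opNorm_smul_gram_sub_gram _ L)).2
  have h2 := h.dotProduct_mulVec_nonneg (fun φ : x.support => x φ)
  simp only [dotProduct, Matrix.mulVec, star_trivial, Pi.star_apply, Matrix.of_apply,
    Matrix.smul_apply, Matrix.gram_apply, Function.comp_apply, smul_eq_mul,
    Finset.prod_mul_distrib, Finset.prod_const, Finset.card_univ, Fintype.card_fin,
    Finset.mul_sum] at h2
  rw [← sub_nonneg]
  refine le_of_le_of_eq h2 ?_
  simp only [Finset.mul_sum, ← Finset.sum_sub_distrib, ContinuousLinearMap.id_apply]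
  refine Finset.sum_congr rfl fun φ _ => Finset.sum_congr rfl fun ψ _ => ?_
  rw [← pow_mul, ← pow_mul, mul_comm 2 m]
  ring

/-- The multiplicative compound `L^{⊗m}`. -/
def mulCompound (m : ℕ) (L : HSpace τ n →L[ℝ] HSpace τ n) : LSpace τ n m →L[ℝ] LSpace τ n m :=
  (tensorComb L).extendOfNorm (tensorComb (ContinuousLinearMap.id ℝ (HSpace τ n)))

theorem isMultiplicativeCompound_mulCompound (L : HSpace τ n →L[ℝ] HSpace τ n) :
    IsMultiplicativeCompound L (mulCompound m L) := by
  intro φ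
  have := LinearMap.extendOfNorm_eq denseRange_tensorComb ⟨_, norm_tensorComb_le L⟩
    (Finsupp.single φ (1 : ℝ))
  simpa [mulCompound] using this

theorem norm_mulCompound_apply_le (L : HSpace τ n →L[ℝ] HSpace τ n) (Φ : LSpace τ n m) :
    ‖mulCompound m L Φ‖ ≤ ‖L‖ ^ m * ‖Φ‖ :=
  LinearMap.norm_extendOfNorm_apply_le denseRange_tensorComb _ (norm_tensorComb_le L) Φ

theorem tensor_induction {Q : LSpace τ n m → Prop} (hQ : IsClosed {Φ | Q Φ})
    (hadd : ∀ Φ Ψ, Q Φ → Q Ψ → Q (Φ + Ψ)) (hsmul : ∀ (c : ℝ) Φ, Q Φ → Q (c • Φ))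
    (ht : ∀ φ, Q (tensor φ)) (Φ : LSpace τ n m) : Q Φ := by
  have hz : Q 0 := by
    have := hsmul 0 _ (ht 0)
    rwa [zero_smul] at this
  refine denseRange_tensorComb.induction_on Φ hQ fun x => ?_
  induction x using Finsupp.induction_linear with
  | zero => rwa [map_zero]
  | add x y hx hy => rw [map_add]; exact hadd _ _ hx hy
  | single φ c =>
    rw [Finsupp.linearCombination_single]
    exact hsmul _ _ (ht φ)

theorem clm_ext_tensor {T T' : LSpace τ n m →L[ℝ] LSpace τ n m}
    (h : ∀ φ, T (tensor φ) = T' (tensor φ)) : T = T' := by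
  refine ContinuousLinearMap.ext fun Φ => ?_
  refine tensor_induction (Q := fun Φ => T Φ = T' Φ) (isClosed_eq T.continuous T'.continuous)
    (fun Φ Ψ a b => by rw [map_add, map_add, a, b])
    (fun c Φ a => by rw [map_smul, map_smul, a]) h Φ

/-- The algebraic laws hold on decomposable tensors and determine the operators. Strong continuity
on those tensors is continuity of the tensor product; the bound K^m, uniform for t near t₀, carries
it to the closure of their span. -/
theorem isC0Semigroup_mulCompound {G : ℝ≥0 → HSpace τ n →L[ℝ] HSpace τ n} (hG : IsC0Semigroup G)
    (hb : ∀ T : ℝ≥0, ∃ K, ∀ t ≤ T, ‖G t‖ ≤ K) :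
    IsC0Semigroup fun t => mulCompound m (G t) where
  zero := clm_ext_tensor fun φ => by
    rw [isMultiplicativeCompound_mulCompound, hG.zero]
    rfl
  add t s := clm_ext_tensor fun φ => by
    simp only [ContinuousLinearMap.comp_apply, isMultiplicativeCompound_mulCompound _ _, hG.add]
  continuous Φ := by
    refine continuous_iff_continuousAt.2 fun t₀ => ?_
    obtain ⟨K, hK⟩ := hb (t₀ + 1)
    have hK0 : 0 ≤ K := (norm_nonneg _).trans (hK 0 (by positivity))
    have hnhds : ∀ᶠ t in 𝓝 t₀, t ≤ t₀ + 1 :=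
      (eventually_lt_nhds (lt_add_of_pos_right t₀ one_pos)).mono fun t ht => ht.le
    refine tensor_induction (Q := fun Φ => ContinuousAt (fun t => mulCompound m (G t) Φ) t₀)
      ?_ (fun Φ Ψ a b => by simp only [map_add]; exact a.add b)
      (fun c Φ a => by simp only [map_smul]; exact a.const_smul c) (fun φ => ?_) Φ
    · refine isClosed_of_closure_subset fun Φ hΦ => ?_
      change ContinuousAt (fun t => mulCompound m (G t) Φ) t₀
      refine continuousAt_of_locally_uniform_approx_of_continuousAt fun u hu => ?_
      obtain ⟨ε, hε, hεu⟩ := Metric.mem_uniformity_dist.1 hu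
      obtain ⟨Ψ, hΨ, hd⟩ := Metric.mem_closure_iff.1 hΦ (ε / (K ^ m + 1)) (by positivity)
      refine ⟨_, hnhds, fun t => mulCompound m (G t) Ψ, hΨ, fun t ht => hεu ?_⟩
      rw [dist_eq_norm, ← map_sub]
      refine (norm_mulCompound_apply_le _ _).trans_lt ?_
      rw [dist_eq_norm, lt_div_iff₀ (by positivity)] at hd
      have h1 : ‖G t‖ ^ m ≤ K ^ m := pow_le_pow_left₀ (norm_nonneg _) (hK t ht) m
      nlinarith [norm_nonneg (Φ - Ψ)]
    · simp only [isMultiplicativeCompound_mulCompound _ _]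
      exact (continuous_tensor.comp (continuous_pi fun i => hG.continuous (φ i))).continuousAt

theorem isC0Semigroup_mulCompound_evol (m : ℕ) (Atil : C(Hist τ, RVec n) →L[ℝ] RVec n) :
    IsC0Semigroup fun t : ℝ≥0 => mulCompound m (evol (fun _ => Atil) (t : ℝ)) := by
  obtain ⟨κ, hL⟩ := exists_delayCoeff_const Atil
  refine isC0Semigroup_mulCompound (isC0Semigroup_evol Atil) fun T => ⟨growth κ T, fun t ht => ?_⟩
  refine ContinuousLinearMap.opNorm_le_bound _ (zero_le_one.trans (one_le_growth hL.nonneg T.2))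
    fun v => (norm_evol_apply_le hL t.2 v).trans ?_
  exact mul_le_mul_of_nonneg_right (growth_mono hL.nonneg ht) (norm_nonneg _)

/-- The generator `A^{[⊗m]}` of the semigroup `G^{⊗m}`. -/
def addCompound (m : ℕ) (Atil : C(Hist τ, RVec n) →L[ℝ] RVec n) :
    LSpace τ n m →ₗ.[ℝ] LSpace τ n m :=
  generator fun t : ℝ≥0 => mulCompound m (evol (fun _ => Atil) (t : ℝ))

theorem isAdditiveCompound_addCompound (Atil : C(Hist τ, RVec n) →L[ℝ] RVec n) :
    IsAdditiveCompound (delayOperator Atil) (addCompound m Atil) :=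
  ⟨_, _, isC0Semigroup_evol Atil, generator_evol Atil, isC0Semigroup_mulCompound_evol m Atil,
    fun _ => isMultiplicativeCompound_mulCompound _, rfl⟩

/-- The semigroup maps v₁ ⊗ ⋯ ⊗ v_m to the tensor of the orbits G(t)v_j, so the product rule at t =
0 gives the action of the generator. -/
theorem mem_graph_addCompound (Atil : C(Hist τ, RVec n) →L[ℝ] RVec n) {v w : Fin m → HSpace τ n}
    (h : ∀ j, (v j, w j) ∈ (delayOperator Atil).graph) :
    (tensor v, ∑ j, tensor (Function.update v j (w j))) ∈ (addCompound m Atil).graph := by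
  obtain ⟨κ, hL⟩ := exists_delayCoeff_const Atil
  rw [addCompound, mem_graph_generator]
  have hd : ∀ j, HasDerivWithinAt (fun t => evol (fun _ => Atil) t (v j)) (w j) (Ici 0) 0 := by
    intro j
    obtain ⟨ψ, hψ, -⟩ := (mem_graph_delayOperator _ _ _).1 (h j)
    have h1 := h j
    rw [hψ] at h1 ⊢
    have h2 := hasDerivWithinAt_evol hL h1
    rwa [sub_self, ← atomVecL_apply, map_zero, add_zero] at h2
  have := tendsto_of_hasDerivWithinAt (hasDerivWithinAt_tensor hd)
  simp only [evol_zero hL] at this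
  refine this.congr fun t => ?_
  rw [isMultiplicativeCompound_mulCompound]

/-! ### Restrictions of decomposable tensors to faces -/

variable {n m : ℕ}

theorem ofSlot_slotVec (j : Fin m) (v : Fin m → RVec n) (w : RVec n) :
    ofSlot j (slotVec j v w) = tensorVec (Function.update v j w) := by
  rw [← ofSlot_toSlot j (tensorVec _), toSlot_tensorVec, Function.update_self]
  have h : ∀ i : {i : Fin m // i ≠ j}, Function.update v j w i = v i := fun i =>
    Function.update_of_ne i.2 _ _
  simp only [slotVec, h]

theorem ae_faceEmb {Q : (Fin m → Hist τ) → Prop}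
    (h : ∀ᵐ θ ∂(Measure.pi fun _ : Fin m => histMeasure τ), Q θ) (S : Finset (Fin m)) :
    ∀ᵐ θ ∂faceLeb τ S, Q (faceEmb S θ) :=
  (measurePreserving_faceEmb S).quasiMeasurePreserving.ae (ae_restrict_of_ae h)

theorem continuous_faceEmb (S : Finset (Fin m)) : Continuous (faceEmb (τ := τ) S) := by
  refine continuous_pi fun i => ?_
  unfold faceEmb
  by_cases h : i ∈ S
  · simp only [h, dite_true]; fun_prop
  · simp only [h, dite_false]; fun_prop

/-- The restriction of `ψ₁ ⊗ ⋯ ⊗ ψ_m` to a face. -/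
def faceFun (S : Finset (Fin m)) (ψ : Fin m → C(Hist τ, RVec n)) : C(S → Hist τ, TPow n m) where
  toFun θ := tensorVec fun i => ψ i (faceEmb S θ i)
  continuous_toFun := by
    have := continuous_faceEmb (τ := τ) S
    exact continuous_tensorVec.comp (by fun_prop)

theorem faceFun_apply (S : Finset (Fin m)) (ψ : Fin m → C(Hist τ, RVec n)) (θ : S → Hist τ) :
    faceFun S ψ θ = tensorVec fun i => ψ i (faceEmb S θ i) := rfl

theorem continuous_faceFun_seg (S : Finset (Fin m)) (x : Fin m → C(ℝ, RVec n)) :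
    Continuous fun t => faceFun S fun i => seg τ (x i) t := by
  refine ContinuousMap.continuous_of_continuous_uncurry _ ?_
  have h := continuous_faceEmb (τ := τ) S
  refine continuous_tensorVec.comp (continuous_pi fun i => ?_)
  simp only [seg_apply]
  fun_prop

/-- On the face S a slot i ∈ S sees only the Lebesgue part of φ_i, and a slot i ∉ S only its value
at the atom; agreement with ψ_i is needed in that part alone. So an atom vector may be replaced by 0
in the slots of S and by a constant in the others. -/
theorem restrictFace_tensor (S : Finset (Fin m)) (φ : Fin m → HSpace τ n)
    (ψ : Fin m → C(Hist τ, RVec n)) (h1 : ∀ i ∈ S, ∀ᵐ θ ∂leb τ, φ i θ = ψ i θ)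
    (h2 : ∀ i ∉ S, φ i (hzero τ) = ψ i (hzero τ)) :
    restrictFace S (tensor φ) = ContinuousMap.toLp 2 (faceLeb τ S) ℝ (faceFun S ψ) := by
  refine Lp.ext ?_
  have h3 : ∀ᵐ θ ∂faceLeb τ S, ∀ i : S, φ i (θ i) = ψ i (θ i) :=
    eventually_all.2 fun i =>
      (Measure.quasiMeasurePreserving_eval (fun _ : S => leb τ) i).ae (h1 i i.2)
  filter_upwards [MemLp.coeFn_toLp (memLp_restrictFace S (tensor φ)),
    ae_faceEmb (coeFn_tensor φ) S, h3,
    ContinuousMap.coeFn_toLp (p := 2) (𝕜 := ℝ) (faceLeb τ S) (faceFun S ψ)] with θ a b c d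
  rw [d, restrictFace, a, b, faceFun_apply]
  congr 1
  ext1 i
  by_cases hi : i ∈ S
  · simp only [faceEmb, hi, dite_true]
    exact c ⟨i, hi⟩
  · simp only [faceEmb, hi, dite_false]
    exact h2 i hi

theorem restrictFace_tensor_embC (S : Finset (Fin m)) (ψ : Fin m → C(Hist τ, RVec n)) :
    restrictFace S (tensor fun i => embC τ n (ψ i)) =
      ContinuousMap.toLp 2 (faceLeb τ S) ℝ (faceFun S ψ) :=
  restrictFace_tensor S _ ψ (fun i _ => (coeFn_embC (ψ i)).1) fun i _ => (coeFn_embC (ψ i)).2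

theorem restrictFace_tensor_update_atomVec (S : Finset (Fin m)) (ψ : Fin m → C(Hist τ, RVec n))
    (j : Fin m) (w : RVec n) :
    restrictFace S (tensor (Function.update (fun i => embC τ n (ψ i)) j (atomVec w))) =
      if j ∈ S then 0 else ContinuousMap.toLp 2 (faceLeb τ S) ℝ
        (faceFun S (Function.update ψ j (ContinuousMap.const _ w))) := by
  split_ifs with hj
  · rw [restrictFace_tensor S _ (Function.update ψ j 0)]
    · have : faceFun S (Function.update ψ j 0) = 0 := by
        ext θ a
        rw [faceFun_apply]
        exact Finset.prod_eq_zero (Finset.mem_univ j) (by simp)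
      rw [this, map_zero]
    · intro i _
      rcases eq_or_ne i j with rfl | h
      · simp only [Function.update_self]
        exact (coeFn_atomVec w).1
      · simp only [Function.update_of_ne h]
        exact (coeFn_embC (ψ i)).1
    · intro i hi
      have h : i ≠ j := fun h => hi (h ▸ hj)
      simp only [Function.update_of_ne h]
      exact (coeFn_embC (ψ i)).2
  · refine restrictFace_tensor S _ _ ?_ ?_
    · intro i hi
      have h : i ≠ j := fun h => hj (h ▸ hi)
      simp only [Function.update_of_ne h]
      exact (coeFn_embC (ψ i)).1
    · intro i _
      rcases eq_or_ne i j with rfl | h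
      · simp only [Function.update_self]
        exact (coeFn_atomVec w).2
      · simp only [Function.update_of_ne h]
        exact (coeFn_embC (ψ i)).2

/-- `restrictFace` as an additive map. -/
def restrictFaceHom (n : ℕ) (S : Finset (Fin m)) : LSpace τ n m →+ Lp (TPow n m) 2 (faceLeb τ S) :=
  AddMonoidHom.mk' (restrictFace S) fun Φ Ψ => by
    refine Lp.ext ?_
    filter_upwards [MemLp.coeFn_toLp (memLp_restrictFace S (Φ + Ψ)),
      MemLp.coeFn_toLp (memLp_restrictFace S Φ), MemLp.coeFn_toLp (memLp_restrictFace S Ψ),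
      ae_faceEmb (Lp.coeFn_add Φ Ψ) S, Lp.coeFn_add (restrictFace S Φ) (restrictFace S Ψ)]
      with θ a b c d e
    rw [e, Pi.add_apply, restrictFace, restrictFace, restrictFace, a, b, c, d]
    rfl

/-- The open faces partition the cube: θ lies in the face of S = {i : θ_i ≠ 0}. -/
theorem eq_of_restrictFace_eq {Φ Ψ : LSpace τ n m}
    (h : ∀ S : Finset (Fin m), restrictFace S Φ = restrictFace S Ψ) : Φ = Ψ := by
  refine Lp.ext ?_
  have hS : ∀ S : Finset (Fin m), ∀ᵐ θ ∂(Measure.pi fun _ : Fin m => histMeasure τ),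
      θ ∈ openFace τ S → Φ θ = Ψ θ := by
    intro S
    rw [← ae_restrict_iff' (measurableSet_openFace S), ← (measurePreserving_faceEmb S).map_eq,
      ae_map_iff (measurable_faceEmb S).aemeasurable (measurableSet_eq_fun
        (Lp.stronglyMeasurable Φ).measurable (Lp.stronglyMeasurable Ψ).measurable)]
    have h1 := MemLp.coeFn_toLp (memLp_restrictFace S Φ)
    have h2 := MemLp.coeFn_toLp (memLp_restrictFace S Ψ)
    change restrictFace S Φ =ᵐ[_] _ at h1
    change restrictFace S Ψ =ᵐ[_] _ at h2
    rw [← h S] at h2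
    filter_upwards [h1, h2] with θ a b
    rw [← a, b]
  filter_upwards [eventually_all.2 hS] with θ hθ
  classical
  exact hθ (Finset.univ.filter fun i => θ i ≠ hzero τ) fun i => by simp

theorem eq_sum_extendFace (Φ : LSpace τ n m) :
    Φ = ∑ S : Finset (Fin m), extendFace S (restrictFace S Φ) := by
  refine eq_of_restrictFace_eq fun S => ?_
  have h := map_sum (restrictFaceHom (τ := τ) n S)
    (fun S' : Finset (Fin m) => extendFace S' (restrictFace S' Φ)) Finset.univ
  refine Eq.trans ?_ h.symm
  rw [Finset.sum_eq_single S]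
  · exact (restrictFace_extendFace S S _).1.symm
  · intro S' _ hne
    exact (restrictFace_extendFace S' S _).2 hne.symm
  · simp

theorem extendFace_zero (S : Finset (Fin m)) :
    extendFace S (0 : Lp (TPow n m) 2 (faceLeb τ S)) = 0 := by
  have h0 : ∀ S' : Finset (Fin m), restrictFace S' (0 : LSpace τ n m) = 0 := fun S' =>
    map_zero (restrictFaceHom n S')
  refine eq_of_restrictFace_eq fun S' => ?_
  rw [h0]
  rcases eq_or_ne S' S with rfl | h
  · exact (restrictFace_extendFace S' S' _).1
  · exact (restrictFace_extendFace S S' _).2 h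

/-! ### The atom terms as measurement terms -/

section

variable {U M : Type*} [NormedAddCommGroup U] [InnerProductSpace ℝ U]
  [NormedAddCommGroup M] [InnerProductSpace ℝ M]

/-- As a function of θ_j, the slot-j part of a decomposable tensor is a scalar multiple of ψ_j, so C
acts on that factor alone. -/
theorem measurement_faceFun (C : C(Hist τ, RVec n) →L[ℝ] M) (S : Finset (Fin m)) (j : Fin m)
    (ψ : Fin m → C(Hist τ, RVec n)) (θ : S → Hist τ) :
    measurement C S j (faceFun (insert j S) ψ) θ =
      slotVec j (fun i => ψ i (faceEmb S θ i)) (C (ψ j)) := by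
  ext a
  have hs : slice S j (faceFun (insert j S) ψ) a θ =
      (∏ i : {i : Fin m // i ≠ j}, ψ i (faceEmb S θ i) (a i)) • ψ j := by
    ext1 s
    change toSlot j (faceFun (insert j S) ψ (insertVar S j θ s)) a = _
    rw [faceFun_apply, toSlot_tensorVec]
    simp only [slotVec, ContinuousMap.smul_apply]
    congr 1
    · refine Finset.prod_congr rfl fun i _ => ?_
      have : faceEmb (insert j S) (insertVar S j θ s) i = faceEmb S θ i := by
        simp [faceEmb, insertVar, i.2]
      rw [this]
    · simp [faceEmb, insertVar]
  change C (slice S j (faceFun (insert j S) ψ) a θ) = _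
  rw [hs, map_smul]
  rfl

/-- On decomposable tensors F'_j and B_j also act on the slot j alone, so ψ_j is replaced by the
constant vector B̃LCψ_j. -/
theorem faceB_faceF_measurement (C : C(Hist τ, RVec n) →L[ℝ] M) (Btil : U →L[ℝ] RVec n)
    (L : M →L[ℝ] U) {S : Finset (Fin m)} {j : Fin m} (hj : j ∉ S)
    (ψ : Fin m → C(Hist τ, RVec n)) :
    faceB Btil S j (faceF S j L (ContinuousMap.toLp 2 (faceLeb τ S) ℝ
      (measurement C S j (faceFun (insert j S) ψ)))) =
    extendFace S (ContinuousMap.toLp 2 (faceLeb τ S) ℝ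
      (faceFun S (Function.update ψ j (ContinuousMap.const _ (Btil (L (C (ψ j)))))))) := by
  unfold faceB
  congr 1
  refine Lp.ext ?_
  filter_upwards [ContinuousLinearMap.coeFn_compLp (ofSlot j ∘L slotMap j Btil)
      (faceF S j L (ContinuousMap.toLp 2 (faceLeb τ S) ℝ
        (measurement C S j (faceFun (insert j S) ψ)))),
    ContinuousLinearMap.coeFn_compLp (slotMap (n := n) j L) (ContinuousMap.toLp 2 (faceLeb τ S) ℝ
        (measurement C S j (faceFun (insert j S) ψ))),
    ContinuousMap.coeFn_toLp (p := 2) (𝕜 := ℝ) (faceLeb τ S)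
      (measurement C S j (faceFun (insert j S) ψ)),
    ContinuousMap.coeFn_toLp (p := 2) (𝕜 := ℝ) (faceLeb τ S)
      (faceFun S (Function.update ψ j (ContinuousMap.const _ (Btil (L (C (ψ j)))))))] with θ a b c d
  rw [d, a, faceF, b, c, measurement_faceFun, ContinuousLinearMap.comp_apply,
    slotMap_slotVec, slotMap_slotVec, ofSlot_slotVec, faceFun_apply]
  congr 1
  ext1 i
  rcases eq_or_ne i j with rfl | h
  · simp
  · simp [h]

/-- Each tensor on the left is split into its parts on the faces. The parts with j ∈ S vanish, as
the atom vector is zero off 0; the others are given by `faceB_faceF_measurement`. Interchanging the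
sums over j and S and sorting S by cardinality gives the right side. -/
theorem sum_tensor_update_atomVec (C : C(Hist τ, RVec n) →L[ℝ] M) (Btil : U →L[ℝ] RVec n)
    (L : M →L[ℝ] U) (ψ : Fin m → C(Hist τ, RVec n)) :
    ∑ j, tensor (Function.update (fun i => embC τ n (ψ i)) j (atomVec (Btil (L (C (ψ j)))))) =
      ∑ k ∈ Finset.range m, ∑ S ∈ Finset.powersetCard k Finset.univ, ∑ j ∈ Sᶜ,
        faceB Btil S j (faceF S j L (ContinuousMap.toLp 2 (faceLeb τ S) ℝ
          (measurement C S j (faceFun (insert j S) ψ)))) := by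
  have h1 : ∀ j, tensor (Function.update (fun i => embC τ n (ψ i)) j
      (atomVec (Btil (L (C (ψ j)))))) = ∑ S : Finset (Fin m), if j ∈ Sᶜ then
        faceB Btil S j (faceF S j L (ContinuousMap.toLp 2 (faceLeb τ S) ℝ
          (measurement C S j (faceFun (insert j S) ψ)))) else 0 := by
    intro j
    refine (eq_sum_extendFace _).trans (Finset.sum_congr rfl fun S _ => ?_)
    rw [restrictFace_tensor_update_atomVec]
    by_cases hj : j ∈ S
    · rw [if_pos hj, if_neg (by simpa using hj), extendFace_zero]
    · rw [if_neg hj, if_pos (by simpa using hj), faceB_faceF_measurement C Btil L hj]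
  simp_rw [h1]
  rw [Finset.sum_comm]
  simp_rw [Finset.sum_ite_mem, Finset.univ_inter]
  rw [← Finset.powerset_univ, Finset.sum_powerset, Finset.card_univ, Fintype.card_fin,
    Finset.sum_range_succ]
  -- The top cardinality m contributes nothing: its only set is the full one, with empty complement.
  -- Hence k stops at m - 1.
  refine add_eq_left.2 (Finset.sum_eq_zero fun S hS => ?_)
  have : S = Finset.univ := Finset.eq_univ_of_card S (by simpa using (Finset.mem_powersetCard.1 hS).2)
  simp [this]

end

end

end DelayCompound

/-! ### The theorem -/

theorem mainTheorem5 {P U M : Type*} [MetricSpace P] [CompleteSpace P]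
    [NormedAddCommGroup U] [InnerProductSpace ℝ U] [FiniteDimensional ℝ U]
    [NormedAddCommGroup M] [InnerProductSpace ℝ M] [FiniteDimensional ℝ M]
    (τ : ℝ) [Fact (0 < τ)] (n m : ℕ) (hn : 1 ≤ n) (hm : 1 ≤ m)
    (π : Flow ℝ≥0 P)
    (Atil : C(Hist τ, RVec n) →L[ℝ] RVec n) (Btil : U →L[ℝ] RVec n)
    (C : C(Hist τ, RVec n) →L[ℝ] M)
    (F' : P → M →L[ℝ] U) (hF' : Continuous F') (Λ : ℝ) (hΛ : ∀ p, ‖F' p‖ ≤ Λ) :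
    ∃ (Am : LSpace τ n m →ₗ.[ℝ] LSpace τ n m)
      (Ξ : ℝ≥0 → P → HSpace τ n →L[ℝ] HSpace τ n)
      (Ξm : ℝ≥0 → P → LSpace τ n m →L[ℝ] LSpace τ n m),
      IsAdditiveCompound (delayOperator Atil) Am ∧
      IsSolutionCocycle Atil Btil C π F' Ξ ∧
      (∀ t p, IsMultiplicativeCompound (Ξ t p) (Ξm t p)) ∧
      ∀ (p : P) (ξ : Fin m → ℝ → HSpace τ n),
        (∀ j, IsSolution Atil Btil C π F' p (ξ j)) →
        (∀ j, ξ j 0 ∈ (delayOperator Atil).domain) →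
        (∀ t : ℝ≥0, tensor (fun j => ξ j t) = Ξm t p (tensor fun j => ξ j 0)) ∧
        ContDiffOn ℝ 1 (fun t => tensor fun j => ξ j t) (Ici 0) ∧
        ContinuousInDomain Am (fun t => tensor fun j => ξ j t) ∧
        ∃ g : (S : Finset (Fin m)) → ℝ → C(S → Hist τ, TPow n m),
          (∀ S, ContinuousOn (g S) (Ici 0)) ∧
          (∀ S, ∀ t : ℝ, 0 ≤ t → restrictFace S (tensor fun j => ξ j t) =
            ContinuousMap.toLp 2 (faceLeb τ S) ℝ (g S t)) ∧
          ∀ t : ℝ, 0 ≤ t → ∃ y : LSpace τ n m,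
            ((tensor fun j => ξ j t), y) ∈ Am.graph ∧
            HasDerivWithinAt (fun s => tensor fun j => ξ j s)
              (y + ∑ k ∈ Finset.range m, ∑ S ∈ Finset.powersetCard k Finset.univ, ∑ j ∈ Sᶜ,
                faceB Btil S j (faceF S j (F' (π t.toNNReal p))
                  (ContinuousMap.toLp 2 (faceLeb τ S) ℝ
                    (measurement C S j (g (insert j S) t)))))
              (Ici 0) t := by
  choose κ hL using exists_delayCoeff_solCoeff Atil Btil C π hF' hΛ
  refine ⟨addCompound m Atil, fun t p => evol (solCoeff Atil Btil C π F' p) (t : ℝ),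
    fun t p => mulCompound m (evol (solCoeff Atil Btil C π F' p) (t : ℝ)),
    isAdditiveCompound_addCompound Atil,
    fun p v => ⟨evol_zero (hL p) v, isSolution_evol (hL p) v⟩,
    fun t p => isMultiplicativeCompound_mulCompound _, fun p ξ hξ h0 => ?_⟩
  choose hC x y hx hyc hy hd using fun j => (hξ j).exists_seg (hL p) (h0 j)
  have hxt : ∀ t, 0 ≤ t → (fun j => ξ j t) = fun j => embC τ n (seg τ (x j) t) := fun t ht =>
    funext fun j => hx j t ht
  have hξc : ContinuousOn (fun t => (fun j => ξ j t)) (Ici 0) :=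
    continuousOn_pi.2 fun j => (hC j).continuousOn
  refine ⟨fun t => ?_, ?_, ⟨continuous_tensor.comp_continuousOn hξc,
    fun t => ∑ j, tensor (Function.update (fun i => ξ i t) j (y j t)), ?_, fun t ht =>
      mem_graph_addCompound Atil fun j => hy j t ht⟩,
    fun S t => faceFun S fun i => seg τ (x i) t, fun S => (continuous_faceFun_seg S x).continuousOn,
    fun S t ht => ?_, fun t ht => ⟨_, mem_graph_addCompound Atil fun j => hy j t ht, ?_⟩⟩
  · rw [isMultiplicativeCompound_mulCompound]
    congr 1
    ext1 j
    exact (hξ j).eq_evol (hL p) t.2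
  · exact (tensorCM τ n m).contDiff.comp_contDiffOn (contDiffOn_pi.2 hC)
  · refine continuousOn_finsetSum _ fun j _ => continuous_tensor.comp_continuousOn
      (continuousOn_pi.2 fun i => ?_)
    rcases eq_or_ne i j with rfl | h
    · simpa only [Function.update_self] using hyc i
    · simpa only [Function.update_of_ne h] using (hC i).continuousOn
  · rw [hxt t ht]
    exact restrictFace_tensor_embC S _
  · have h1 := hasDerivWithinAt_tensor fun j => hd j t ht
    simp only [tensor_update_add, Finset.sum_add_distrib] at h1
    rw [← sum_tensor_update_atomVec C Btil (F' (π t.toNNReal p)), ← hxt t ht]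
    exact h1
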